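/- Let $\Bbbk$ be an uncountable algebraically closed field of characteristic zero. Let $\mathfrak q=\mathfrak q_2$ be the queer Lie superalgebra over $\Bbbk$: it consists of the block matrices $\mathtt M(A,B)=\begin{pmatrix}A&B\\B&A\end{pmatrix}$ with $A,B\in\mathfrak{gl}_2(\Bbbk)$, the matrices $\mathtt M(A,0)$ being even and $\mathtt M(0,B)$ odd, with bracket $[X,Y]=XY-(-1)^{|X||Y|}YX$ for homogeneous $X,Y$. Put $E=\mathtt M(E_{12},0)$, $F=\mathtt M(E_{21},0)$, $H_i=\mathtt M(E_{ii},0)$, $\overline E=\mathtt M(0,E_{12})$, $\overline F=\mathtt M(0,E_{21})$. A $\mathfrak q$-supermodule is a superspace $V=V_{\bar 0}\oplus V_{\bar 1}$ with a homomorphism of Lie superalgebras from $\mathfrak q$ to the Lie superalgebra of linear operators on $V$; isomorphisms are even, and $V$ is simple if it is nonzero and has no subsupermodules other than $0$ and $V$. It is a weight supermodule if it is the direct sum of the spaces $V_\lambda=\{v: H_1v=\lambda_1v,\ H_2v=\lambda_2v\}$, $\lambda\in\Bbbk^2$. It is a highest (resp. lowest) weight supermodule if it is generated by a nonzero homogeneous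 vector that lies in some $V_\lambda$ and is annihilated by $E$ and $\overline E$ (resp. by $F$ and $\overline F$). Let $U'$ be the Ore localization of the universal enveloping superalgebra $U(\mathfrak q)$ with respect to $\{1,F,F^2,\dots\}$, and let $(\theta_z)_{z\in\Bbbk}$ be the unique family of automorphisms of $U'$ that is polynomial in $z$ and satisfies $\theta_z(u)=F^zuF^{-z}$ for $z\in\mathbb Z$. Let ${}^zU'$ be the $U(\mathfrak q)$-$U(\mathfrak q)$-bimodule $U'$ with the usual right multiplication, on which $u\in U(\mathfrak q)$ acts on the left as multiplication by $\theta_z(u)$. Then every simple weight $\mathfrak q$-supermodule is isomorphic to one of the following: (a) a simple finite-dimensional supermodule; (b) a simple infinite-dimensional highest weight supermodule; (c) a simple infinite-dimensional lowest weight supermodule; (d) a simple supermodule of the form $L^z={}^zU'\otimes_{U(\mathfrak q)}L$ for some $z\in\Bbbk$ and some simple infinite-dimensional highest weight supermodule $L$. -/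

import Mathlib

open scoped TensorProduct

universe u v w

namespace Queer

noncomputable section

/-! ### The queer Lie superalgebra `𝔮₂` -/

section Algebra

variable (k : Type u) [Field k]

/-- The underlying space of the queer Lie superalgebra `𝔮₂`: the pair `(A, B)` stands for the
block matrix `M(A, B)` with rows `(A, B)` and `(B, A)`; see `Q2.toBlock`. -/
abbrev Q2 : Type u := Matrix (Fin 2) (Fin 2) k × Matrix (Fin 2) (Fin 2) k

variable {k}

/-- The block matrix `M(A, B)`. -/
def Q2.toBlock (x : Q2 k) : Matrix (Fin 2 ⊕ Fin 2) (Fin 2 ⊕ Fin 2) k :=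
  Matrix.fromBlocks x.1 x.2 x.2 x.1

variable (k) in
/-- The homogeneous components: `M(A, 0)` is even, `M(0, B)` is odd. -/
def Q2.part (i : ZMod 2) : Submodule k (Q2 k) :=
  if i = 0 then Submodule.prod ⊤ ⊥ else Submodule.prod ⊥ ⊤

/-- The Lie superbracket, the bilinear extension of
`[X, Y] = X Y - (-1)^(|X||Y|) Y X`; see `Q2.toBlock_sbracket`. -/
def Q2.sbracket (x y : Q2 k) : Q2 k :=
  (x.1 * y.1 - y.1 * x.1 + (x.2 * y.2 + y.2 * x.2),
    x.1 * y.2 - y.2 * x.1 + (x.2 * y.1 - y.1 * x.2))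

/-- The Koszul sign `(-1)^(ij)`. -/
def ksign (k : Type u) [Field k] (i j : ZMod 2) : k := (-1) ^ (i.val * j.val)

theorem Q2.mem_part_zero {x : Q2 k} : x ∈ Q2.part k 0 ↔ x.2 = 0 := by
  simp [Q2.part, Submodule.mem_prod]

theorem Q2.mem_part_one {x : Q2 k} : x ∈ Q2.part k 1 ↔ x.1 = 0 := by
  simp [Q2.part, Submodule.mem_prod]

theorem zmod_two_cases (i : ZMod 2) : i = 0 ∨ i = 1 := by
  revert i; decide

theorem ksign_zero_left (j : ZMod 2) : ksign k 0 j = 1 := by simp [ksign]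

theorem ksign_zero_right (j : ZMod 2) : ksign k j 0 = 1 := by simp [ksign]

theorem ksign_one_one : ksign k 1 1 = -1 := by simp [ksign, ZMod.val_one]

theorem Q2.toBlock_sbracket {i j : ZMod 2} {x y : Q2 k} (hx : x ∈ Q2.part k i)
    (hy : y ∈ Q2.part k j) :
    (Q2.sbracket x y).toBlock =
      x.toBlock * y.toBlock - ksign k i j • (y.toBlock * x.toBlock) := by
  obtain ⟨A, B⟩ := x
  obtain ⟨A', B'⟩ := y
  rcases zmod_two_cases i with rfl | rfl <;> rcases zmod_two_cases j with rfl | rfl <;>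
    simp only [Q2.mem_part_zero, Q2.mem_part_one] at hx hy <;> subst hx <;> subst hy <;>
    simp [Q2.toBlock, Q2.sbracket, ksign_zero_left, ksign_zero_right, ksign_one_one,
      Matrix.fromBlocks_multiply, sub_eq_add_neg, Matrix.fromBlocks_neg, Matrix.fromBlocks_add]

variable (k)

/-- `E = M(E₁₂, 0)`. -/
def Q2.E : Q2 k := (Matrix.single 0 1 1, 0)
/-- `F = M(E₂₁, 0)`. -/
def Q2.F : Q2 k := (Matrix.single 1 0 1, 0)
/-- `H₁ = M(E₁₁, 0)`. -/
def Q2.H1 : Q2 k := (Matrix.single 0 0 1, 0)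
/-- `H₂ = M(E₂₂, 0)`. -/
def Q2.H2 : Q2 k := (Matrix.single 1 1 1, 0)
/-- The odd element `M(0, E₁₂)`. -/
def Q2.Ebar : Q2 k := (0, Matrix.single 0 1 1)
/-- The odd element `M(0, E₂₁)`. -/
def Q2.Fbar : Q2 k := (0, Matrix.single 1 0 1)

/-- The map `[F, -]` on `𝔮₂`. -/
def Q2.adF : Q2 k →ₗ[k] Q2 k where
  toFun := Q2.sbracket (Q2.F k)
  map_add' x y := by
    ext : 1 <;> simp [Q2.sbracket, Q2.F, mul_add, add_mul] <;> abel
  map_smul' c x := by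
    ext : 1 <;> simp [Q2.sbracket, Q2.F, smul_sub]

theorem Q2.F_mem : Q2.F k ∈ Q2.part k 0 := by simp [Q2.mem_part_zero, Q2.F]

theorem Q2.adF_F : Q2.adF k (Q2.F k) = 0 := by
  simp [Q2.adF, Q2.sbracket, Q2.F]

theorem Q2.adF_cube (x : Q2 k) : Q2.adF k (Q2.adF k (Q2.adF k x)) = 0 := by
  obtain ⟨A, B⟩ := x
  have hF : (Matrix.single 1 0 1 : Matrix (Fin 2) (Fin 2) k) * Matrix.single 1 0 1 = 0 := by
    simp
  have key : ∀ f a : Matrix (Fin 2) (Fin 2) k, f * f = 0 →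
      f * (f * (f * a - a * f) - (f * a - a * f) * f)
        - (f * (f * a - a * f) - (f * a - a * f) * f) * f = 0 := by
    intro f a h
    have e : f * (f * (f * a - a * f) - (f * a - a * f) * f)
        - (f * (f * a - a * f) - (f * a - a * f) * f) * f
        = (f * f) * (f * a) - 3 • ((f * f) * (a * f)) + 3 • (f * a * (f * f)) - a * f * (f * f) := by
      noncomm_ring
    rw [e, h]; simp
  ext : 1 <;> simp [Q2.adF, Q2.sbracket, Q2.F, -Matrix.single_mul_single_same] <;>
    exact key _ _ hF

theorem Q2.adF_mem {i : ZMod 2} {x : Q2 k} (hx : x ∈ Q2.part k i) :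
    Q2.adF k x ∈ Q2.part k i := by
  rcases zmod_two_cases i with rfl | rfl
  · rw [Q2.mem_part_zero] at hx ⊢
    simp [Q2.adF, Q2.sbracket, Q2.F, hx]
  · rw [Q2.mem_part_one] at hx ⊢
    simp [Q2.adF, Q2.sbracket, Q2.F, hx]

/-! ### The universal enveloping superalgebra -/

/-- The relations `x y = (-1)^(|x||y|) y x + [x, y]` for homogeneous `x, y ∈ 𝔮₂`. -/
inductive U.Rel : TensorAlgebra k (Q2 k) → TensorAlgebra k (Q2 k) → Prop
  | super_comm (i j : ZMod 2) (x y : Q2 k) (hx : x ∈ Q2.part k i) (hy : y ∈ Q2.part k j) :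
      U.Rel (TensorAlgebra.ι k x * TensorAlgebra.ι k y)
        (ksign k i j • (TensorAlgebra.ι k y * TensorAlgebra.ι k x)
          + TensorAlgebra.ι k (Q2.sbracket x y))

/-- The universal enveloping superalgebra `U(𝔮₂)`. -/
def U : Type u := RingQuot (U.Rel k)

instance : Ring (U k) := inferInstanceAs (Ring (RingQuot (U.Rel k)))

instance : Algebra k (U k) := inferInstanceAs (Algebra k (RingQuot (U.Rel k)))

/-- The quotient map from the tensor algebra. -/
def U.mk : TensorAlgebra k (Q2 k) →ₐ[k] U k := RingQuot.mkAlgHom k (U.Rel k)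

/-- The canonical map `𝔮₂ → U(𝔮₂)`. -/
def U.ι : Q2 k →ₗ[k] U k := (U.mk k).toLinearMap ∘ₗ TensorAlgebra.ι k

variable {k}

theorem U.ι_mul_ι {i j : ZMod 2} {x y : Q2 k} (hx : x ∈ Q2.part k i) (hy : y ∈ Q2.part k j) :
    U.ι k x * U.ι k y = ksign k i j • (U.ι k y * U.ι k x) + U.ι k (Q2.sbracket x y) := by
  have h := RingQuot.mkAlgHom_rel k (U.Rel.super_comm i j x y hx hy)
  change U.mk k _ = U.mk k _ at h
  rw [map_mul, map_add, map_smul, map_mul] at h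
  exact h

/-- The universal property of `U(𝔮₂)`. -/
def U.lift {A : Type w} [Ring A] [Algebra k A] (f : Q2 k →ₗ[k] A)
    (hf : ∀ (i j : ZMod 2) (x y : Q2 k), x ∈ Q2.part k i → y ∈ Q2.part k j →
      f x * f y = ksign k i j • (f y * f x) + f (Q2.sbracket x y)) : U k →ₐ[k] A :=
  RingQuot.liftAlgHom k ⟨TensorAlgebra.lift k f, by
    rintro _ _ ⟨i, j, x, y, hx, hy⟩
    simpa using hf i j x y hx hy⟩

theorem U.lift_ι {A : Type w} [Ring A] [Algebra k A] (f : Q2 k →ₗ[k] A)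
    (hf : ∀ (i j : ZMod 2) (x y : Q2 k), x ∈ Q2.part k i → y ∈ Q2.part k j →
      f x * f y = ksign k i j • (f y * f x) + f (Q2.sbracket x y)) (x : Q2 k) :
    U.lift f hf (U.ι k x) = f x := by
  have := RingQuot.liftAlgHom_mkAlgHom_apply (S := k) (TensorAlgebra.lift k f)
    (s := U.Rel k) (by
      rintro _ _ ⟨i, j, x, y, hx, hy⟩
      simpa using hf i j x y hx hy) (TensorAlgebra.ι k x)
  rw [TensorAlgebra.lift_ι_apply] at this
  exact this

theorem U.induction {P : U k → Prop} (hs : ∀ c : k, P (algebraMap k (U k) c))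
    (hι : ∀ x, P (U.ι k x)) (hadd : ∀ a b, P a → P b → P (a + b))
    (hmul : ∀ a b, P a → P b → P (a * b)) (a : U k) : P a := by
  obtain ⟨t, rfl⟩ := RingQuot.mkAlgHom_surjective k (U.Rel k) a
  change P (U.mk k t)
  induction t using TensorAlgebra.induction with
  | algebraMap r => rw [AlgHom.commutes]; exact hs r
  | ι x => exact hι x
  | mul a b ha hb => rw [map_mul]; exact hmul _ _ ha hb
  | add a b ha hb => rw [map_add]; exact hadd _ _ ha hb

theorem U.F_mul_ι (x : Q2 k) :
    U.ι k (Q2.F k) * U.ι k x = U.ι k x * U.ι k (Q2.F k) + U.ι k (Q2.adF k x) := by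
  obtain ⟨A, B⟩ := x
  have e : ((A, B) : Q2 k) = (A, 0) + (0, B) := by simp
  have h0 := U.ι_mul_ι (Q2.F_mem k) (y := (A, 0)) (j := 0) (Q2.mem_part_zero.2 rfl)
  have h1 := U.ι_mul_ι (Q2.F_mem k) (y := (0, B)) (j := 1) (Q2.mem_part_one.2 rfl)
  rw [ksign_zero_left, one_smul] at h0 h1
  rw [e, map_add, map_add, map_add, mul_add, add_mul, h0, h1]
  simp only [Q2.adF, LinearMap.coe_mk, AddHom.coe_mk]
  abel

/-! ### The Ore localization `U'` of `U(𝔮₂)` at the powers of `F` -/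

variable (k) in
/-- The multiplicative set `{1, F, F², …}`. -/
abbrev powF : Submonoid (U k) := Submonoid.powers (U.ι k (Q2.F k))

variable (k) in
/-- The map `u ↦ F u - u F` on `U(𝔮₂)`. -/
def U.adF : U k →ₗ[k] U k :=
  LinearMap.mulLeft k (U.ι k (Q2.F k)) - LinearMap.mulRight k (U.ι k (Q2.F k))

theorem U.adF_apply (a : U k) :
    U.adF k a = U.ι k (Q2.F k) * a - a * U.ι k (Q2.F k) := rfl

theorem U.adF_mul (a b : U k) : U.adF k (a * b) = U.adF k a * b + a * U.adF k b := by
  simp only [U.adF_apply]; noncomm_ring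

theorem U.adF_pow_mul (n p q : ℕ) (h : n = p + q) (a b : U k) (ha : (U.adF k ^ p) a = 0)
    (hb : (U.adF k ^ q) b = 0) : (U.adF k ^ n) (a * b) = 0 := by
  induction n generalizing p q a b with
  | zero =>
    obtain rfl : p = 0 := by omega
    have : a = 0 := by simpa using ha
    simp [this]
  | succ n ih =>
    rw [pow_succ, Module.End.mul_apply, U.adF_mul, map_add]
    rcases p with _ | p
    · have : a = 0 := by simpa using ha
      simp [this]
    rcases q with _ | q
    · have : b = 0 := by simpa using hb
      simp [this]
    rw [ih p (q + 1) (by omega) _ _ (by rwa [pow_succ, Module.End.mul_apply] at ha) hb,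
      ih (p + 1) q (by omega) _ _ ha (by rwa [pow_succ, Module.End.mul_apply] at hb), add_zero]

theorem U.adF_nilpotent (a : U k) : ∃ n, (U.adF k ^ n) a = 0 := by
  induction a using U.induction with
  | hs c => exact ⟨1, by simp [U.adF_apply, Algebra.commutes]⟩
  | hι x =>
    have h : ∀ y, U.adF k (U.ι k y) = U.ι k (Q2.adF k y) := fun y => by
      rw [U.adF_apply, U.F_mul_ι]; abel
    refine ⟨3, ?_⟩
    rw [pow_succ, pow_succ, pow_one, Module.End.mul_apply, Module.End.mul_apply, h, h, h,
      Q2.adF_cube, map_zero]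
  | hadd a b ha hb =>
    obtain ⟨m, hm⟩ := ha
    obtain ⟨n, hn⟩ := hb
    refine ⟨m + n, ?_⟩
    rw [map_add]
    have h1 : (U.adF k ^ (m + n)) a = 0 := by
      rw [add_comm, pow_add, Module.End.mul_apply, hm, map_zero]
    have h2 : (U.adF k ^ (m + n)) b = 0 := by
      rw [pow_add, Module.End.mul_apply, hn, map_zero]
    rw [h1, h2, add_zero]
  | hmul a b ha hb =>
    obtain ⟨m, hm⟩ := ha
    obtain ⟨n, hn⟩ := hb
    exact ⟨m + n, U.adF_pow_mul _ m n rfl a b hm hn⟩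

theorem U.ore_eq (a : U k) (m : ℕ) :
    ∃ (n : ℕ) (b : U k), U.ι k (Q2.F k) ^ n * a = b * U.ι k (Q2.F k) ^ m := by
  suffices H : ∀ N : ℕ, ∀ a : U k, (U.adF k ^ N) a = 0 → ∀ m : ℕ, ∃ (n : ℕ) (b : U k),
      U.ι k (Q2.F k) ^ n * a = b * U.ι k (Q2.F k) ^ m by
    obtain ⟨N, hN⟩ := U.adF_nilpotent a
    exact H N a hN m
  intro N
  induction N with
  | zero =>
    intro a ha m
    have : a = 0 := by simpa using ha
    exact ⟨0, 0, by simp [this]⟩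
  | succ N ihN =>
    intro a ha m
    induction m with
    | zero => exact ⟨0, a, by simp⟩
    | succ m ihm =>
      obtain ⟨n, b, hb⟩ := ihm
      obtain ⟨n', b', hb'⟩ := ihN (U.adF k a)
        (by rwa [pow_succ, Module.End.mul_apply] at ha) (m + 1)
      refine ⟨n' + n + 1, U.ι k (Q2.F k) ^ n' * b + U.ι k (Q2.F k) ^ n * b', ?_⟩
      have e : U.ι k (Q2.F k) * a = a * U.ι k (Q2.F k) + U.adF k a := by
        rw [U.adF_apply]; abel
      rw [pow_succ, mul_assoc, e, mul_add, add_mul]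
      congr 1
      · rw [pow_add, ← mul_assoc, mul_assoc _ (_ ^ n), hb, pow_succ]; simp only [mul_assoc]
      · rw [add_comm n', pow_add, mul_assoc, hb', mul_assoc]

theorem U.ore_cancel (a : U k) (m : ℕ) (h : a * U.ι k (Q2.F k) ^ m = 0) :
    ∃ n : ℕ, U.ι k (Q2.F k) ^ n * a = 0 := by
  induction m generalizing a with
  | zero => exact ⟨0, by simpa using h⟩
  | succ m ih =>
    have key : ∀ c : U k, c * U.ι k (Q2.F k) = 0 →
        ∃ n : ℕ, U.ι k (Q2.F k) ^ n * c = 0 := by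
      intro c hc
      obtain ⟨N, hN⟩ := U.adF_nilpotent c
      refine ⟨N, ?_⟩
      have : ∀ n : ℕ, U.ι k (Q2.F k) ^ n * c = (U.adF k ^ n) c := by
        intro n
        induction n with
        | zero => simp
        | succ n ihn =>
          rw [pow_succ' (U.adF k), Module.End.mul_apply, ← ihn, U.adF_apply, mul_assoc _ c, hc,
            mul_zero, sub_zero, pow_succ', mul_assoc]
      rw [this, hN]
    obtain ⟨n, hn⟩ := key (a * U.ι k (Q2.F k) ^ m) (by rw [mul_assoc, ← pow_succ]; exact h)
    obtain ⟨n', hn'⟩ := ih (U.ι k (Q2.F k) ^ n * a) (by rw [mul_assoc]; exact hn)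
    exact ⟨n' + n, by rw [pow_add, mul_assoc]; exact hn'⟩

instance instOreSetPowF : OreLocalization.OreSet (powF k) :=
  Classical.choice <| OreLocalization.nonempty_oreSet_iff.2 ⟨by
    rintro a b ⟨_, m, rfl⟩ h
    obtain ⟨n, hn⟩ := U.ore_cancel (a - b) m (by
      rw [sub_mul, sub_eq_zero]; exact h)
    refine ⟨⟨_, n, rfl⟩, ?_⟩
    rw [mul_sub, sub_eq_zero] at hn
    exact hn, by
    rintro a ⟨_, m, rfl⟩
    obtain ⟨n, b, h⟩ := U.ore_eq a m
    exact ⟨b, ⟨_, n, rfl⟩, h⟩⟩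

variable (k) in
/-- The Ore localization `U'` of `U(𝔮₂)` with respect to `{1, F, F², …}`. -/
def U' : Type u := OreLocalization (powF k) (U k)

instance : Ring (U' k) := inferInstanceAs (Ring (OreLocalization (powF k) (U k)))

instance : Algebra k (U' k) := inferInstanceAs (Algebra k (OreLocalization (powF k) (U k)))

variable (k) in
/-- The canonical map `U(𝔮₂) → U'`. -/
def U'.of : U k →ₐ[k] U' k :=
  { (OreLocalization.numeratorRingHom : U k →+* OreLocalization (powF k) (U k)) with
    commutes' := fun _ => rfl }

variable (k) in
/-- The canonical map `𝔮₂ → U'`. -/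
def U'.ι : Q2 k →ₗ[k] U' k := (U'.of k).toLinearMap ∘ₗ U.ι k

variable (k) in
/-- `F` as a unit of `U'`. -/
def U'.F : (U' k)ˣ :=
  OreLocalization.numeratorUnit (⟨U.ι k (Q2.F k), 1, pow_one _⟩ : powF k)

theorem U'.F_val : (U'.F k : U' k) = U'.ι k (Q2.F k) := rfl

theorem U'.exists_eq (a : U' k) :
    ∃ (n : ℕ) (b : U k), a = ((U'.F k ^ n)⁻¹ : (U' k)ˣ) * U'.of k b := by
  induction a using OreLocalization.ind with
  | _ r s =>
    obtain ⟨_, n, rfl⟩ := s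
    refine ⟨n, r, ?_⟩
    refine (Units.eq_inv_mul_iff_mul_eq (U'.F k ^ n)).2 ?_
    rw [Units.val_pow_eq_pow_val, U'.F_val]
    have : U'.ι k (Q2.F k) ^ n = U'.of k (U.ι k (Q2.F k) ^ n) := by
      rw [map_pow]; rfl
    rw [this]
    exact OreLocalization.mul_cancel (s := (⟨_, n, rfl⟩ : powF k)) (t := 1)

/-- Extension to `U'` of an algebra map from `U(𝔮₂)` sending `F` to a unit. -/
def U'.lift {A : Type w} [Ring A] [Algebra k A] (f : U k →ₐ[k] A) (g : Aˣ)
    (hg : f (U.ι k (Q2.F k)) = g) : U' k →ₐ[k] A :=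
  let h : ∀ s : powF k, IsUnit (f s) := by
    rintro ⟨_, n, rfl⟩
    simp only [map_pow, hg]
    exact (g ^ n).isUnit
  let fS : powF k →* Aˣ := IsUnit.liftRight ((f : U k →* A).comp (powF k).subtype) h
  let φ : OreLocalization (powF k) (U k) →+* A :=
    OreLocalization.universalHom (f : U k →+* A) fS (fun _ => rfl)
  have hφ : ∀ r : U k, φ (OreLocalization.numeratorHom r) = f r := fun _ =>
    OreLocalization.universalHom_commutes _ _ _
  { φ with
    commutes' := fun c => (hφ (algebraMap k (U k) c)).trans (f.commutes c) }

theorem U'.lift_of {A : Type w} [Ring A] [Algebra k A] (f : U k →ₐ[k] A) (g : Aˣ)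
    (hg : f (U.ι k (Q2.F k)) = g) (a : U k) : U'.lift f g hg (U'.of k a) = f a :=
  OreLocalization.universalHom_commutes _ _ _

theorem U'.induction {P : U' k → Prop} (hs : ∀ c : k, P (algebraMap k (U' k) c))
    (hι : ∀ x, P (U'.ι k x)) (hF : P ((U'.F k)⁻¹ : (U' k)ˣ))
    (hadd : ∀ a b, P a → P b → P (a + b))
    (hmul : ∀ a b, P a → P b → P (a * b)) (a : U' k) : P a := by
  obtain ⟨n, b, rfl⟩ := U'.exists_eq a
  refine hmul _ _ ?_ ?_
  · induction n with
    | zero => simpa using hs 1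
    | succ n ih =>
      rw [pow_succ, mul_inv_rev, Units.val_mul]
      exact hmul _ _ hF ih
  · induction b using U.induction with
    | hs c => rw [AlgHom.commutes]; exact hs c
    | hι x => exact hι x
    | hadd a b ha hb => rw [map_add]; exact hadd _ _ ha hb
    | hmul a b ha hb => rw [map_mul]; exact hmul _ _ ha hb

theorem U'.hom_ext {A : Type w} [Ring A] [Algebra k A] {f g : U' k →ₐ[k] A}
    (h : ∀ x, f (U'.ι k x) = g (U'.ι k x)) : f = g := by
  ext a
  induction a using U'.induction with
  | hs c => simp
  | hι x => exact h x
  | hF =>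
    have h1 : Units.map (f : U' k →* A) (U'.F k) = Units.map (g : U' k →* A) (U'.F k) :=
      Units.ext (h (Q2.F k))
    have h2 := congrArg (fun t : Aˣ => ((t⁻¹ : Aˣ) : A)) h1
    simpa [← map_inv] using h2
  | hadd a b ha hb => rw [map_add, map_add, ha, hb]
  | hmul a b ha hb => rw [map_mul, map_mul, ha, hb]

/-! ### The parity of `U'` -/

/-- The sign `(-1)^i`. -/
def psign (k : Type u) [Field k] (i : ZMod 2) : k := (-1) ^ i.val

theorem psign_zero : psign k 0 = 1 := by simp [psign]

theorem psign_one : psign k 1 = -1 := by simp [psign, ZMod.val_one]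

theorem psign_add (i j : ZMod 2) : psign k (i + j) = psign k i * psign k j := by
  have h : (1 + 1 : ZMod 2) = 0 := by decide
  rcases zmod_two_cases i with rfl | rfl <;> rcases zmod_two_cases j with rfl | rfl <;>
    simp [psign_zero, psign_one, h]

variable (k) in
/-- The parity involution `M(A, B) ↦ M(A, -B)` of `𝔮₂`. -/
def Q2.parity : Q2 k →ₗ[k] Q2 k := LinearMap.prodMap LinearMap.id (-LinearMap.id)

theorem Q2.parity_of_mem {i : ZMod 2} {x : Q2 k} (hx : x ∈ Q2.part k i) :
    Q2.parity k x = psign k i • x := by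
  obtain ⟨A, B⟩ := x
  rcases zmod_two_cases i with rfl | rfl <;>
    simp only [Q2.mem_part_zero, Q2.mem_part_one] at hx <;> subst hx <;>
    simp [Q2.parity, psign_zero, psign_one]

theorem Q2.parity_parity (x : Q2 k) : Q2.parity k (Q2.parity k x) = x := by
  simp [Q2.parity]

theorem Q2.sbracket_mem {i j : ZMod 2} {x y : Q2 k} (hx : x ∈ Q2.part k i)
    (hy : y ∈ Q2.part k j) : Q2.sbracket x y ∈ Q2.part k (i + j) := by
  have h : (1 + 1 : ZMod 2) = 0 := by decide
  rcases zmod_two_cases i with rfl | rfl <;> rcases zmod_two_cases j with rfl | rfl <;>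
    simp only [h, add_zero, zero_add, Q2.mem_part_zero, Q2.mem_part_one] at hx hy ⊢ <;>
    simp [Q2.sbracket, hx, hy]

variable (k) in
/-- The parity automorphism of `U(𝔮₂)`. -/
def U.parity : U k →ₐ[k] U k :=
  U.lift (U.ι k ∘ₗ Q2.parity k) (by
    intro i j x y hx hy
    simp only [LinearMap.comp_apply, Q2.parity_of_mem hx, Q2.parity_of_mem hy,
      Q2.parity_of_mem (Q2.sbracket_mem hx hy), map_smul, smul_mul_assoc, mul_smul_comm,
      U.ι_mul_ι hx hy, psign_add, smul_add, smul_smul]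
    congr 2 <;> ring)

theorem U.parity_ι (x : Q2 k) : U.parity k (U.ι k x) = U.ι k (Q2.parity k x) :=
  U.lift_ι _ _ x

variable (k) in
/-- The parity automorphism of `U'`, which multiplies a homogeneous element of degree `i`
by `(-1)^i`. -/
def U'.parity : U' k →ₐ[k] U' k :=
  U'.lift ((U'.of k).comp (U.parity k)) (U'.F k) (by
    rw [AlgHom.comp_apply, U.parity_ι, Q2.parity_of_mem (Q2.F_mem k), psign_zero, one_smul]
    rfl)

theorem U'.parity_of (a : U k) : U'.parity k (U'.of k a) = U'.of k (U.parity k a) :=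
  U'.lift_of _ _ _ a

theorem U'.parity_ι (x : Q2 k) : U'.parity k (U'.ι k x) = U'.ι k (Q2.parity k x) := by
  change U'.parity k (U'.of k (U.ι k x)) = U'.of k (U.ι k (Q2.parity k x))
  rw [U'.parity_of, U.parity_ι]

theorem U'.parity_parity (a : U' k) : U'.parity k (U'.parity k a) = a := by
  have : (U'.parity k).comp (U'.parity k) = AlgHom.id k (U' k) := U'.hom_ext fun x => by
    simp [U'.parity_ι, Q2.parity_parity]
  exact DFunLike.congr_fun this a

variable (k) in
/-- The homogeneous component of degree `i` of `U'`. -/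
def U'.part (i : ZMod 2) : Submodule k (U' k) :=
  LinearMap.ker ((U'.parity k).toLinearMap - psign k i • LinearMap.id)

theorem U'.mem_part {i : ZMod 2} {a : U' k} :
    a ∈ U'.part k i ↔ U'.parity k a = psign k i • a := by
  simp [U'.part, sub_eq_zero]

theorem U'.mul_mem {i j : ZMod 2} {a b : U' k} (ha : a ∈ U'.part k i) (hb : b ∈ U'.part k j) :
    a * b ∈ U'.part k (i + j) := by
  rw [U'.mem_part] at *
  rw [map_mul, ha, hb, psign_add, smul_mul_assoc, mul_smul_comm, mul_smul]

theorem U'.ι_mem {i : ZMod 2} {x : Q2 k} (hx : x ∈ Q2.part k i) :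
    U'.ι k x ∈ U'.part k i := by
  rw [U'.mem_part, U'.parity_ι, Q2.parity_of_mem hx, map_smul]

theorem U'.F_inv_mem : (((U'.F k)⁻¹ : (U' k)ˣ) : U' k) ∈ U'.part k 0 := by
  rw [U'.mem_part, psign_zero, one_smul]
  have h1 : Units.map (U'.parity k : U' k →* U' k) (U'.F k) = U'.F k := by
    ext
    change U'.parity k (U'.ι k (Q2.F k)) = U'.ι k (Q2.F k)
    rw [U'.parity_ι, Q2.parity_of_mem (Q2.F_mem k), psign_zero, one_smul]
  have h2 := congrArg (fun t : (U' k)ˣ => ((t⁻¹ : (U' k)ˣ) : U' k)) h1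
  simpa [← map_inv] using h2

end Algebra

/-! ### The automorphisms `θ_z` of `U'` -/

section Theta

variable {k : Type u} [Field k]

/-- The polynomial functions `k → W`. -/
def polyFun (k : Type u) [Field k] (W : Type w) [AddCommGroup W] [Module k W] :
    Submodule k (k → W) :=
  Submodule.span k {f | ∃ (n : ℕ) (c : W), f = fun z => z ^ n • c}

theorem polyFun_eq_zero [CharZero k] {W : Type w} [AddCommGroup W] [Module k W] {f : k → W}
    (hf : f ∈ polyFun k W) (h : ∀ n : ℕ, f n = 0) (z : k) : f z = 0 := by
  rw [← Module.forall_dual_apply_eq_zero_iff k]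
  intro φ
  obtain ⟨p, hp⟩ : ∃ p : Polynomial k, ∀ t, φ (f t) = p.eval t := by
    clear h
    induction hf using Submodule.span_induction with
    | mem f hf =>
      obtain ⟨n, c, rfl⟩ := hf
      exact ⟨Polynomial.C (φ c) * Polynomial.X ^ n, fun t => by
        simp only [map_smul, smul_eq_mul, Polynomial.eval_mul, Polynomial.eval_C,
          Polynomial.eval_pow, Polynomial.eval_X]
        exact mul_comm _ _⟩
    | zero => exact ⟨0, fun t => by simp⟩
    | add f g _ _ hf hg =>
      obtain ⟨p, hp⟩ := hf
      obtain ⟨q, hq⟩ := hg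
      exact ⟨p + q, fun t => by simp [hp, hq]⟩
    | smul c f _ hf =>
      obtain ⟨p, hp⟩ := hf
      exact ⟨Polynomial.C c * p, fun t => by simp [hp]⟩
  have hp0 : p = 0 := by
    refine Polynomial.eq_zero_of_infinite_isRoot p ?_
    refine (Set.infinite_range_of_injective (Nat.cast_injective (R := k))).mono ?_
    rintro _ ⟨n, rfl⟩
    change p.eval (n : k) = 0
    rw [← hp, h, map_zero]
  rw [hp, hp0, Polynomial.eval_zero]

theorem polyFun_const {W : Type w} [AddCommGroup W] [Module k W] (c : W) :
    (fun _ => c) ∈ polyFun k W :=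
  Submodule.subset_span ⟨0, c, by simp⟩

theorem polyFun_mul {A : Type w} [Ring A] [Algebra k A] {f g : k → A}
    (hf : f ∈ polyFun k A) (hg : g ∈ polyFun k A) : f * g ∈ polyFun k A := by
  induction hf using Submodule.span_induction with
  | mem f hf =>
    obtain ⟨n, c, rfl⟩ := hf
    induction hg using Submodule.span_induction with
    | mem g hg =>
      obtain ⟨m, d, rfl⟩ := hg
      exact Submodule.subset_span ⟨n + m, c * d, by
        ext z
        simp only [Pi.mul_apply, smul_mul_assoc, mul_smul_comm, smul_smul, pow_add]
        rw [mul_comm (z ^ m)]⟩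
    | zero => rw [mul_zero]; exact Submodule.zero_mem _
    | add g g' _ _ h h' => rw [mul_add]; exact Submodule.add_mem _ h h'
    | smul c' g _ h => rw [mul_smul_comm]; exact Submodule.smul_mem _ _ h
  | zero => rw [zero_mul]; exact Submodule.zero_mem _
  | add f f' _ _ h h' => rw [add_mul]; exact Submodule.add_mem _ h h'
  | smul c' f _ h => rw [smul_mul_assoc]; exact Submodule.smul_mem _ _ h

/-- The restriction of `θ_z` to `𝔮₂`:
`x ↦ ∑ᵢ (z choose i) (ad F)^i(x) F^(-i)`, where `(ad F)³ = 0` on `𝔮₂`. -/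
def thetaGen (z : k) : Q2 k →ₗ[k] U' k :=
  U'.ι k
    + z • (LinearMap.mulRight k ((U'.F k)⁻¹ : (U' k)ˣ).val ∘ₗ U'.ι k ∘ₗ Q2.adF k)
    + (z * (z - 1) / 2) • (LinearMap.mulRight k (((U'.F k)⁻¹ : (U' k)ˣ).val ^ 2) ∘ₗ
        U'.ι k ∘ₗ Q2.adF k ∘ₗ Q2.adF k)

theorem thetaGen_apply (z : k) (x : Q2 k) :
    thetaGen z x = U'.ι k x + z • (U'.ι k (Q2.adF k x) * ((U'.F k)⁻¹ : (U' k)ˣ).val)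
      + (z * (z - 1) / 2) •
        (U'.ι k (Q2.adF k (Q2.adF k x)) * ((U'.F k)⁻¹ : (U' k)ˣ).val ^ 2) := rfl

theorem U'.F_mul_ι (x : Q2 k) :
    (U'.F k : U' k) * U'.ι k x = U'.ι k x * (U'.F k : U' k) + U'.ι k (Q2.adF k x) := by
  have h := congrArg (U'.of k) (U.F_mul_ι x)
  rwa [map_mul, map_add, map_mul] at h

theorem U'.conj_ι (x : Q2 k) :
    (U'.F k : U' k) * U'.ι k x * ((U'.F k)⁻¹ : (U' k)ˣ).val
      = U'.ι k x + U'.ι k (Q2.adF k x) * ((U'.F k)⁻¹ : (U' k)ˣ).val := by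
  rw [U'.F_mul_ι, add_mul, mul_assoc, Units.mul_inv, mul_one]

theorem thetaGen_succ [CharZero k] (z : k) (x : Q2 k) :
    thetaGen (z + 1) x
      = (U'.F k : U' k) * thetaGen z x * ((U'.F k)⁻¹ : (U' k)ˣ).val := by
  have h1 := U'.conj_ι x
  have h2 := U'.conj_ι (Q2.adF k x)
  have h3 := U'.conj_ι (Q2.adF k (Q2.adF k x))
  rw [Q2.adF_cube, map_zero, zero_mul, add_zero] at h3
  have e3 : (z + 1) * (z + 1 - 1) / 2 = z + z * (z - 1) / 2 := by ring
  rw [thetaGen_apply, thetaGen_apply, e3]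
  set f := (U'.F k : U' k)
  set g := ((U'.F k)⁻¹ : (U' k)ˣ).val
  set a := U'.ι k x
  set b := U'.ι k (Q2.adF k x)
  set c := U'.ι k (Q2.adF k (Q2.adF k x))
  have e1 : f * (b * g) * g = b * g + c * g ^ 2 := by
    rw [← mul_assoc f, h2, add_mul, mul_assoc c, pow_two]
  have e2 : f * (c * g ^ 2) * g = c * g ^ 2 := by
    rw [pow_two, ← mul_assoc c, ← mul_assoc f, ← mul_assoc f, h3, mul_assoc]
  simp only [mul_add, add_mul, mul_smul_comm, smul_mul_assoc, h1, e1, e2]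
  module

theorem thetaGen_natCast [CharZero k] (n : ℕ) (x : Q2 k) :
    thetaGen (n : k) x
      = ((U'.F k ^ n : (U' k)ˣ) : U' k) * U'.ι k x * ((U'.F k ^ n)⁻¹ : (U' k)ˣ).val := by
  induction n with
  | zero => simp [thetaGen_apply]
  | succ n ih =>
    rw [Nat.cast_succ, thetaGen_succ, ih, pow_succ', mul_inv_rev, Units.val_mul, Units.val_mul]
    simp only [mul_assoc]

theorem thetaGen_poly [CharZero k] (x : Q2 k) :
    (fun z => thetaGen z x) ∈ polyFun k (U' k) := by
  have h1 : ∀ c : U' k, (fun z : k => z • c) ∈ polyFun k (U' k) := fun c =>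
    Submodule.subset_span ⟨1, c, by simp⟩
  have h2 : ∀ c : U' k, (fun z : k => (z * (z - 1) / 2) • c) ∈ polyFun k (U' k) := fun c => by
    have e : (fun z : k => (z * (z - 1) / 2) • c)
        = (2⁻¹ : k) • (fun z : k => z ^ 2 • c) - (2⁻¹ : k) • (fun z : k => z • c) := by
      ext z
      simp only [Pi.sub_apply, Pi.smul_apply, smul_smul, ← sub_smul]
      congr 1
      ring
    rw [e]
    exact Submodule.sub_mem _ (Submodule.smul_mem _ _ (Submodule.subset_span ⟨2, c, rfl⟩))
      (Submodule.smul_mem _ _ (h1 c))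
  exact Submodule.add_mem _ (Submodule.add_mem _ (polyFun_const _) (h1 _)) (h2 _)

theorem thetaGen_rel [CharZero k] (z : k) (i j : ZMod 2) (x y : Q2 k) (hx : x ∈ Q2.part k i)
    (hy : y ∈ Q2.part k j) :
    thetaGen z x * thetaGen z y
      = ksign k i j • (thetaGen z y * thetaGen z x) + thetaGen z (Q2.sbracket x y) := by
  rw [← sub_eq_zero]
  refine polyFun_eq_zero (f := fun z => thetaGen z x * thetaGen z y
    - (ksign k i j • (thetaGen z y * thetaGen z x) + thetaGen z (Q2.sbracket x y))) ?_ ?_ z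
  · exact Submodule.sub_mem _ (polyFun_mul (thetaGen_poly x) (thetaGen_poly y))
      (Submodule.add_mem _ (Submodule.smul_mem _ _
        (polyFun_mul (thetaGen_poly y) (thetaGen_poly x))) (thetaGen_poly _))
  · intro n
    have h := congrArg (U'.of k) (U.ι_mul_ι hx hy)
    rw [map_mul, map_add, map_smul, map_mul] at h
    change U'.ι k x * U'.ι k y
      = ksign k i j • (U'.ι k y * U'.ι k x) + U'.ι k (Q2.sbracket x y) at h
    have key : ∀ a b : U' k,
        ((U'.F k ^ n : (U' k)ˣ) : U' k) * a * ((U'.F k ^ n)⁻¹ : (U' k)ˣ).val *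
          (((U'.F k ^ n : (U' k)ˣ) : U' k) * b * ((U'.F k ^ n)⁻¹ : (U' k)ˣ).val)
        = ((U'.F k ^ n : (U' k)ˣ) : U' k) * (a * b) * ((U'.F k ^ n)⁻¹ : (U' k)ˣ).val := by
      intro a b
      simp only [mul_assoc, Units.inv_mul_cancel_left]
    simp only [thetaGen_natCast, key, h]
    simp only [mul_add, add_mul, mul_smul_comm, smul_mul_assoc, sub_self]

theorem thetaGen_F (z : k) : thetaGen z (Q2.F k) = U'.F k := by
  rw [thetaGen_apply, Q2.adF_F]; simp [U'.F_val]

variable [CharZero k]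

/-- `θ_z` as an endomorphism of `U'`. -/
def thetaHom (z : k) : U' k →ₐ[k] U' k :=
  U'.lift (U.lift (thetaGen z) (thetaGen_rel z)) (U'.F k) (by rw [U.lift_ι, thetaGen_F])

theorem thetaHom_ι (z : k) (x : Q2 k) : thetaHom z (U'.ι k x) = thetaGen z x := by
  change thetaHom z (U'.of k (U.ι k x)) = _
  rw [thetaHom, U'.lift_of, U.lift_ι]

theorem thetaHom_F_inv (z : k) :
    thetaHom z ((U'.F k)⁻¹ : (U' k)ˣ).val = ((U'.F k)⁻¹ : (U' k)ˣ).val := by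
  have h1 : Units.map (thetaHom z : U' k →* U' k) (U'.F k) = U'.F k := by
    ext
    change thetaHom z (U'.ι k (Q2.F k)) = _
    rw [thetaHom_ι, thetaGen_F]
  have h2 := congrArg (fun t : (U' k)ˣ => ((t⁻¹ : (U' k)ˣ) : U' k)) h1
  simpa [← map_inv] using h2

theorem thetaHom_comp (z t : k) : (thetaHom z).comp (thetaHom t) = thetaHom (z + t) := by
  refine U'.hom_ext fun x => ?_
  rw [AlgHom.comp_apply, thetaHom_ι, thetaHom_ι, thetaGen_apply t]
  simp only [map_add, map_smul, map_mul, map_pow, thetaHom_F_inv, thetaHom_ι]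
  have e : (z + t) * (z + t - 1) / 2 = z * (z - 1) / 2 + t * z + t * (t - 1) / 2 := by ring
  simp only [thetaGen_apply, e]
  simp only [Q2.adF_cube, map_zero, zero_mul, smul_zero, add_zero, add_mul,
    smul_mul_assoc, mul_assoc, ← pow_two, smul_add, smul_smul]
  module

theorem thetaHom_zero : thetaHom (0 : k) = AlgHom.id k (U' k) :=
  U'.hom_ext fun x => by rw [thetaHom_ι, thetaGen_apply]; simp

/-- The automorphism `θ_z` of `U'`. The family is polynomial in `z` (`theta_poly`) and `θ_n` is
the conjugation by `F^n` for integers `n` (`theta_intCast`). -/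
def theta (z : k) : U' k ≃ₐ[k] U' k :=
  AlgEquiv.ofAlgHom (thetaHom z) (thetaHom (-z))
    (by rw [thetaHom_comp, add_neg_cancel, thetaHom_zero])
    (by rw [thetaHom_comp, neg_add_cancel, thetaHom_zero])

theorem theta_ι (z : k) (x : Q2 k) : theta z (U'.ι k x) = thetaGen z x := thetaHom_ι z x

theorem theta_poly (a : U' k) : (fun z => theta z a) ∈ polyFun k (U' k) := by
  induction a using U'.induction with
  | hs c => simpa using polyFun_const (k := k) (algebraMap k (U' k) c)
  | hι x => simpa only [theta_ι] using thetaGen_poly x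
  | hF =>
    have : (fun z : k => theta z ((U'.F k)⁻¹ : (U' k)ˣ).val)
        = fun _ => ((U'.F k)⁻¹ : (U' k)ˣ).val := funext fun z => thetaHom_F_inv z
    rw [this]; exact polyFun_const _
  | hadd a b ha hb => simp only [map_add]; exact Submodule.add_mem _ ha hb
  | hmul a b ha hb => simp only [map_mul]; exact polyFun_mul ha hb

theorem theta_natCast (n : ℕ) (a : U' k) :
    theta (n : k) a = ((U'.F k ^ n : (U' k)ˣ) : U' k) * a * ((U'.F k ^ n)⁻¹ : (U' k)ˣ).val := by
  induction a using U'.induction with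
  | hs c => rw [← Algebra.commutes, mul_assoc, Units.mul_inv, mul_one, AlgEquiv.commutes]
  | hι x => rw [theta_ι, thetaGen_natCast]
  | hF =>
    refine (thetaHom_F_inv _).trans ?_
    simp only [← Units.val_mul]
    congr 1
    group
  | hadd a b ha hb => rw [map_add, ha, hb, mul_add, add_mul]
  | hmul a b ha hb =>
    rw [map_mul, ha, hb]; simp only [mul_assoc, Units.inv_mul_cancel_left]

theorem theta_intCast (n : ℤ) (a : U' k) :
    theta (n : k) a = ((U'.F k ^ n : (U' k)ˣ) : U' k) * a * ((U'.F k ^ n)⁻¹ : (U' k)ˣ).val := by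
  obtain ⟨n, rfl | rfl⟩ := n.eq_nat_or_neg
  · simpa using theta_natCast n a
  · apply (theta (n : k)).injective
    have : theta (n : k) (theta ((-n : ℤ) : k) a) = a := by
      push_cast
      have := DFunLike.congr_fun (thetaHom_comp (n : k) (-n)) a
      rw [add_neg_cancel, thetaHom_zero] at this
      exact this
    rw [this, theta_natCast]
    simp only [zpow_neg, zpow_natCast, inv_inv, mul_assoc, Units.mul_inv_cancel_left,
      Units.mul_inv, mul_one]

theorem theta_mem (z : k) {i : ZMod 2} {x : Q2 k} (hx : x ∈ Q2.part k i) :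
    theta z (U'.ι k x) ∈ U'.part k i := by
  rw [theta_ι, thetaGen_apply]
  have h1 := U'.mul_mem (U'.ι_mem (Q2.adF_mem k hx)) (U'.F_inv_mem (k := k))
  have h2 := U'.mul_mem (U'.mul_mem (U'.ι_mem (Q2.adF_mem k (Q2.adF_mem k hx)))
    (U'.F_inv_mem (k := k))) (U'.F_inv_mem (k := k))
  rw [add_zero] at h1
  rw [add_zero, add_zero, mul_assoc, ← pow_two] at h2
  exact Submodule.add_mem _ (Submodule.add_mem _ (U'.ι_mem hx) (Submodule.smul_mem _ _ h1))
    (Submodule.smul_mem _ _ h2)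

end Theta

/-! ### Supermodules -/

/-- A `𝔮₂`-supermodule structure on `V`: a decomposition `V = V₀ ⊕ V₁` and a homomorphism of Lie
superalgebras from `𝔮₂` to the Lie superalgebra of linear operators on `V`. -/
structure Supermodule (k : Type u) [Field k] (V : Type v) [AddCommGroup V] [Module k V] where
  /-- the homogeneous components -/
  part : ZMod 2 → Submodule k V
  isCompl : IsCompl (part 0) (part 1)
  /-- the action of `𝔮₂` -/
  ρ : Q2 k →ₗ[k] Module.End k V
  ρ_mem : ∀ {i j : ZMod 2} {x : Q2 k} {v : V}, x ∈ Q2.part k i → v ∈ part j →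
    ρ x v ∈ part (i + j)
  ρ_sbracket : ∀ {i j : ZMod 2} {x y : Q2 k}, x ∈ Q2.part k i → y ∈ Q2.part k j →
    ρ (Q2.sbracket x y) = ρ x * ρ y - ksign k i j • (ρ y * ρ x)

namespace Supermodule

variable {k : Type u} [Field k] {V : Type v} [AddCommGroup V] [Module k V]
  {W : Type w} [AddCommGroup W] [Module k W]

/-- A subspace is a subsupermodule if it is graded and stable under `𝔮₂`. -/
def IsSub (S : Supermodule k V) (X : Submodule k V) : Prop :=
  X = (X ⊓ S.part 0) ⊔ (X ⊓ S.part 1) ∧ ∀ (x : Q2 k), ∀ v ∈ X, S.ρ x v ∈ X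

/-- A supermodule is simple if it is nonzero and has no proper nonzero subsupermodules. -/
def IsSimple (S : Supermodule k V) : Prop :=
  Nontrivial V ∧ ∀ X : Submodule k V, S.IsSub X → X = ⊥ ∨ X = ⊤

/-- The weight space `V_μ = {v : H₁ v = μ₁ v, H₂ v = μ₂ v}`. -/
def weightSpace (S : Supermodule k V) (μ : k × k) : Submodule k V :=
  LinearMap.ker (S.ρ (Q2.H1 k) - μ.1 • LinearMap.id)
    ⊓ LinearMap.ker (S.ρ (Q2.H2 k) - μ.2 • LinearMap.id)

theorem mem_weightSpace (S : Supermodule k V) {μ : k × k} {v : V} :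
    v ∈ S.weightSpace μ ↔ S.ρ (Q2.H1 k) v = μ.1 • v ∧ S.ρ (Q2.H2 k) v = μ.2 • v := by
  simp [weightSpace, sub_eq_zero]

/-- A weight supermodule is the (direct) sum of its weight spaces. -/
def IsWeight (S : Supermodule k V) : Prop :=
  iSupIndep S.weightSpace ∧ ⨆ μ, S.weightSpace μ = ⊤

/-- `S` is generated by a nonzero homogeneous weight vector annihilated by `E` and `Ē`. -/
def IsHighestWeight (S : Supermodule k V) : Prop :=
  ∃ (μ : k × k) (i : ZMod 2) (v : V), v ≠ 0 ∧ v ∈ S.weightSpace μ ∧ v ∈ S.part i ∧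
    S.ρ (Q2.E k) v = 0 ∧ S.ρ (Q2.Ebar k) v = 0 ∧
    ∀ X : Submodule k V, S.IsSub X → v ∈ X → X = ⊤

/-- `S` is generated by a nonzero homogeneous weight vector annihilated by `F` and `F̄`. -/
def IsLowestWeight (S : Supermodule k V) : Prop :=
  ∃ (μ : k × k) (i : ZMod 2) (v : V), v ≠ 0 ∧ v ∈ S.weightSpace μ ∧ v ∈ S.part i ∧
    S.ρ (Q2.F k) v = 0 ∧ S.ρ (Q2.Fbar k) v = 0 ∧
    ∀ X : Submodule k V, S.IsSub X → v ∈ X → X = ⊤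

/-- Isomorphism of supermodules: a linear bijection of degree zero that commutes with `𝔮₂`. -/
def Iso (S : Supermodule k V) (T : Supermodule k W) : Prop :=
  ∃ e : V ≃ₗ[k] W, (∀ i, ∀ v ∈ S.part i, e v ∈ T.part i) ∧
    ∀ (x : Q2 k) (v : V), e (S.ρ x v) = T.ρ x (e v)

/-- The action of `U(𝔮₂)` on a supermodule. -/
def act (S : Supermodule k V) : U k →ₐ[k] Module.End k V :=
  U.lift S.ρ fun _ _ _ _ hx hy => by rw [S.ρ_sbracket hx hy]; abel

theorem act_ι (S : Supermodule k V) (x : Q2 k) : S.act (U.ι k x) = S.ρ x := U.lift_ι _ _ x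

/-! ### The tensor product `U' ⊗_{U(𝔮₂)} L` -/

/-- The subspace of `U' ⊗_k L` spanned by the elements `a u ⊗ m - a ⊗ u m` with `u ∈ U(𝔮₂)`. -/
def balanced (S : Supermodule k V) : Submodule k (U' k ⊗[k] V) :=
  Submodule.span k {t | ∃ (a : U' k) (c : U k) (m : V),
    t = (a * U'.of k c) ⊗ₜ[k] m - a ⊗ₜ[k] (S.act c m)}

/-- The tensor product `U' ⊗_{U(𝔮₂)} L`, the quotient of `U' ⊗_k L` by the relations
`a u ⊗ m = a ⊗ u m`. -/
abbrev LocTensor (S : Supermodule k V) : Type (max u v) := (U' k ⊗[k] V) ⧸ S.balanced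

/-- The class of `a ⊗ m` in `U' ⊗_{U(𝔮₂)} L`. -/
def tmul (S : Supermodule k V) (a : U' k) (m : V) : S.LocTensor :=
  S.balanced.mkQ (a ⊗ₜ[k] m)

theorem tmul_act (S : Supermodule k V) (a : U' k) (c : U k) (m : V) :
    S.tmul (a * U'.of k c) m = S.tmul a (S.act c m) := by
  rw [tmul, tmul, ← sub_eq_zero, ← map_sub, Submodule.mkQ_apply,
    Submodule.Quotient.mk_eq_zero]
  exact Submodule.subset_span ⟨a, c, m, rfl⟩

theorem locTensor_induction (S : Supermodule k V) {P : S.LocTensor → Prop}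
    (h0 : P 0) (ht : ∀ a m, P (S.tmul a m)) (hadd : ∀ s t, P s → P t → P (s + t))
    (t : S.LocTensor) : P t := by
  obtain ⟨t, rfl⟩ := S.balanced.mkQ_surjective t
  induction t using TensorProduct.induction_on with
  | zero => rw [map_zero]; exact h0
  | tmul a m => exact ht a m
  | add s t hs ht => rw [map_add]; exact hadd _ _ hs ht

theorem locTensor_ext (S : Supermodule k V) {f g : S.LocTensor →ₗ[k] W}
    (h : ∀ a m, f (S.tmul a m) = g (S.tmul a m)) : f = g := by
  refine LinearMap.ext fun t => ?_
  induction t using S.locTensor_induction with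
  | h0 => simp
  | ht a m => exact h a m
  | hadd s t hs ht => rw [map_add, map_add, hs, ht]

/-- Left multiplication by `b ∈ U'` on `U' ⊗_{U(𝔮₂)} L`. -/
def lmulEnd (S : Supermodule k V) (b : U' k) : Module.End k S.LocTensor :=
  S.balanced.mapQ S.balanced (LinearMap.rTensor V (LinearMap.mulLeft k b)) (by
    rw [balanced, Submodule.span_le]
    rintro _ ⟨a, c, m, rfl⟩
    refine Submodule.subset_span ⟨b * a, c, m, ?_⟩
    simp [mul_assoc])

theorem lmulEnd_tmul (S : Supermodule k V) (b a : U' k) (m : V) :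
    S.lmulEnd b (S.tmul a m) = S.tmul (b * a) m := by
  simp [lmulEnd, tmul]

theorem tmul_add_left (S : Supermodule k V) (a b : U' k) (m : V) :
    S.tmul (a + b) m = S.tmul a m + S.tmul b m := by
  simp [tmul, TensorProduct.add_tmul]

theorem tmul_add_right (S : Supermodule k V) (a : U' k) (m n : V) :
    S.tmul a (m + n) = S.tmul a m + S.tmul a n := by
  simp [tmul, TensorProduct.tmul_add]

theorem tmul_smul_left (S : Supermodule k V) (c : k) (a : U' k) (m : V) :
    S.tmul (c • a) m = c • S.tmul a m := by
  rw [tmul, ← TensorProduct.smul_tmul', map_smul]; rfl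

theorem tmul_smul_right (S : Supermodule k V) (c : k) (a : U' k) (m : V) :
    S.tmul a (c • m) = c • S.tmul a m := by
  rw [tmul, TensorProduct.tmul_smul, map_smul]; rfl

/-- The `U'`-module structure of `U' ⊗_{U(𝔮₂)} L`. -/
def lmul (S : Supermodule k V) : U' k →ₐ[k] Module.End k S.LocTensor :=
  AlgHom.ofLinearMap
    { toFun := S.lmulEnd
      map_add' := fun a b => S.locTensor_ext fun c m => by
        simp only [LinearMap.add_apply, lmulEnd_tmul, add_mul, tmul_add_left]
      map_smul' := fun r a => S.locTensor_ext fun c m => by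
        simp only [LinearMap.smul_apply, lmulEnd_tmul, smul_mul_assoc, tmul_smul_left,
          RingHom.id_apply] }
    (S.locTensor_ext fun c m => by
      simp only [LinearMap.coe_mk, AddHom.coe_mk, lmulEnd_tmul, one_mul, Module.End.one_apply])
    (fun a b => S.locTensor_ext fun c m => by
      simp only [LinearMap.coe_mk, AddHom.coe_mk, lmulEnd_tmul, mul_assoc,
        Module.End.mul_apply])

theorem lmul_tmul (S : Supermodule k V) (b a : U' k) (m : V) :
    S.lmul b (S.tmul a m) = S.tmul (b * a) m := S.lmulEnd_tmul b a m

/-- The component of degree `i` of `U' ⊗_{U(𝔮₂)} L`, spanned by the `a ⊗ m` with `a` and `m`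
homogeneous of degrees adding up to `i`. -/
def locPart (S : Supermodule k V) (i : ZMod 2) : Submodule k S.LocTensor :=
  Submodule.span k {t | ∃ (j l : ZMod 2) (a : U' k) (m : V),
    j + l = i ∧ a ∈ U'.part k j ∧ m ∈ S.part l ∧ t = S.tmul a m}

/-- The parity operator of a supermodule. -/
def parity (S : Supermodule k V) : Module.End k V :=
  Submodule.projection _ _ S.isCompl - Submodule.projection _ _ S.isCompl.symm

theorem parity_of_mem (S : Supermodule k V) {i : ZMod 2} {m : V} (hm : m ∈ S.part i) :
    S.parity m = psign k i • m := by
  rcases zmod_two_cases i with rfl | rfl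
  · rw [parity, LinearMap.sub_apply, Submodule.projection_apply_of_mem_left _ hm,
      Submodule.projection_apply_of_mem_right _ hm, psign_zero, one_smul, sub_zero]
  · rw [parity, LinearMap.sub_apply, Submodule.projection_apply_of_mem_left _ hm,
      Submodule.projection_apply_of_mem_right _ hm, psign_one, neg_smul, one_smul, zero_sub]

theorem exists_parts (S : Supermodule k V) (m : V) :
    ∃ m₀ ∈ S.part 0, ∃ m₁ ∈ S.part 1, m₀ + m₁ = m :=
  Submodule.mem_sup.1 (S.isCompl.sup_eq_top ▸ Submodule.mem_top)

theorem parity_act (S : Supermodule k V) (c : U k) (m : V) :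
    S.parity (S.act c m) = S.act (U.parity k c) (S.parity m) := by
  induction c using U.induction generalizing m with
  | hs c => simp [Module.algebraMap_end_apply]
  | hι x =>
    rw [U.parity_ι, act_ι, act_ι]
    have key : ∀ {i j : ZMod 2} {x : Q2 k} {m : V}, x ∈ Q2.part k i → m ∈ S.part j →
        S.parity (S.ρ x m) = S.ρ (Q2.parity k x) (S.parity m) := by
      intro i j x m hx hm
      rw [S.parity_of_mem (S.ρ_mem hx hm), S.parity_of_mem hm, Q2.parity_of_mem hx, psign_add]
      simp only [map_smul, LinearMap.smul_apply, smul_smul]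
      rw [mul_comm]
    obtain ⟨A, B⟩ := x
    have e : ((A, B) : Q2 k) = (A, 0) + (0, B) := by simp
    obtain ⟨m₀, h₀, m₁, h₁, rfl⟩ := S.exists_parts m
    have hA : ((A, 0) : Q2 k) ∈ Q2.part k 0 := Q2.mem_part_zero.2 rfl
    have hB : ((0, B) : Q2 k) ∈ Q2.part k 1 := Q2.mem_part_one.2 rfl
    rw [e]
    simp only [map_add, LinearMap.add_apply, key hA h₀, key hA h₁, key hB h₀, key hB h₁]
  | hadd a b ha hb => simp [ha, hb]
  | hmul a b ha hb => simp [ha, hb]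

/-- The parity operator of `U' ⊗_{U(𝔮₂)} L`. -/
def locParity (S : Supermodule k V) : Module.End k S.LocTensor :=
  S.balanced.mapQ S.balanced (TensorProduct.map (U'.parity k).toLinearMap S.parity) (by
    rw [balanced, Submodule.span_le]
    rintro _ ⟨a, c, m, rfl⟩
    refine Submodule.subset_span ⟨U'.parity k a, U.parity k c, S.parity m, ?_⟩
    simp [S.parity_act, U'.parity_of])

theorem locParity_of_mem (S : Supermodule k V) {i : ZMod 2} {t : S.LocTensor}
    (ht : t ∈ S.locPart i) : S.locParity t = psign k i • t := by
  induction ht using Submodule.span_induction with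
  | mem t ht =>
    obtain ⟨j, l, a, m, rfl, ha, hm, rfl⟩ := ht
    have : S.locParity (S.tmul a m) = S.tmul (U'.parity k a) (S.parity m) := by
      simp [locParity, tmul]
    rw [this, U'.mem_part.1 ha, S.parity_of_mem hm, tmul_smul_left, tmul_smul_right, psign_add,
      mul_smul]
  | zero => simp
  | add s t _ _ hs ht => rw [map_add, hs, ht, smul_add]
  | smul c t _ ht => rw [map_smul, ht, smul_comm]

theorem tmul_mem_locPart (S : Supermodule k V) {j l : ZMod 2} {a : U' k} {m : V}
    (ha : a ∈ U'.part k j) (hm : m ∈ S.part l) : S.tmul a m ∈ S.locPart (j + l) :=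
  Submodule.subset_span ⟨j, l, a, m, rfl, ha, hm, rfl⟩

theorem isCompl_locPart [CharZero k] (S : Supermodule k V) :
    IsCompl (S.locPart 0) (S.locPart 1) := by
  constructor
  · rw [Submodule.disjoint_def]
    intro t h0 h1
    have e := (S.locParity_of_mem h0).symm.trans (S.locParity_of_mem h1)
    rw [psign_zero, psign_one, one_smul, neg_smul, one_smul, eq_neg_iff_add_eq_zero,
      ← two_smul k] at e
    exact (smul_eq_zero.1 e).resolve_left two_ne_zero
  · rw [codisjoint_iff, eq_top_iff]
    rintro t -
    induction t using S.locTensor_induction with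
    | h0 => exact Submodule.zero_mem _
    | hadd s t hs ht => exact Submodule.add_mem _ hs ht
    | ht a m =>
      have h11 : (1 + 1 : ZMod 2) = 0 := by decide
      have mem : ∀ {j l : ZMod 2} {a : U' k} {m : V}, a ∈ U'.part k j → m ∈ S.part l →
          S.tmul a m ∈ S.locPart 0 ⊔ S.locPart 1 := by
        intro j l a m ha hm
        have := S.tmul_mem_locPart ha hm
        rcases zmod_two_cases (j + l) with h | h <;> rw [h] at this
        · exact Submodule.mem_sup_left this
        · exact Submodule.mem_sup_right this
      obtain ⟨m₀, h₀, m₁, h₁, rfl⟩ := S.exists_parts m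
      have ha0 : (2⁻¹ : k) • (a + U'.parity k a) ∈ U'.part k 0 := by
        rw [U'.mem_part, psign_zero, one_smul, map_smul, map_add, U'.parity_parity, add_comm]
      have ha1 : (2⁻¹ : k) • (a - U'.parity k a) ∈ U'.part k 1 := by
        rw [U'.mem_part, psign_one, map_smul, map_sub, U'.parity_parity]
        module
      have ea : a = (2⁻¹ : k) • (a + U'.parity k a) + (2⁻¹ : k) • (a - U'.parity k a) := by
        rw [← smul_add, add_add_sub_cancel, ← two_smul k a, smul_smul,
          inv_mul_cancel₀ two_ne_zero, one_smul]
      rw [ea, tmul_add_left, tmul_add_right, tmul_add_right]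
      exact Submodule.add_mem _ (Submodule.add_mem _ (mem ha0 h₀) (mem ha0 h₁))
        (Submodule.add_mem _ (mem ha1 h₀) (mem ha1 h₁))

theorem lmul_mem (S : Supermodule k V) {i j : ZMod 2} {b : U' k} {t : S.LocTensor}
    (hb : b ∈ U'.part k i) (ht : t ∈ S.locPart j) : S.lmul b t ∈ S.locPart (i + j) := by
  induction ht using Submodule.span_induction with
  | mem t ht =>
    obtain ⟨j, l, a, m, rfl, ha, hm, rfl⟩ := ht
    rw [lmul_tmul, ← add_assoc]
    exact S.tmul_mem_locPart (U'.mul_mem hb ha) hm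
  | zero => rw [map_zero]; exact Submodule.zero_mem _
  | add s t _ _ hs ht => rw [map_add]; exact Submodule.add_mem _ hs ht
  | smul c t _ ht => rw [map_smul]; exact Submodule.smul_mem _ _ ht

/-- The twisted localization `L^z = ᶻU' ⊗_{U(𝔮₂)} L`: the space `U' ⊗_{U(𝔮₂)} L` on which
`x ∈ 𝔮₂` acts as left multiplication by `θ_z(x)`. -/
def twist [CharZero k] (S : Supermodule k V) (z : k) : Supermodule k S.LocTensor where
  part := S.locPart
  isCompl := S.isCompl_locPart
  ρ := S.lmul.toLinearMap ∘ₗ (theta z).toLinearMap ∘ₗ U'.ι k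
  ρ_mem hx hv := S.lmul_mem (theta_mem z hx) hv
  ρ_sbracket {i j x y} hx hy := by
    have h := thetaGen_rel z i j x y hx hy
    simp only [LinearMap.comp_apply, AlgEquiv.toLinearMap_apply, AlgHom.toLinearMap_apply,
      theta_ι, ← map_mul, ← map_smul, ← map_sub]
    rw [h, add_sub_cancel_left]

end Supermodule

end

end Queer

namespace Queer

noncomputable section

/-! ### Brackets in `𝔮₂` -/

section Brackets

/-! Let `V` be a simple weight supermodule. If `E` kills a nonzero vector, then, since `(ad E)³ =
0`, the vectors killed by a power of `E` form a nonzero subsupermodule, so `E` is locally nilpotent.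
A last nonzero vector `E^n w` of a homogeneous weight vector `w`, or its image under `Ē`, is then a
highest weight vector (`IsSimple.exists_extremal`). The same argument with `F` gives a lowest weight
vector. What remains is the case where `E` and `F` are both injective.

The weight spaces of `V` are finite-dimensional (`IsSimple.finiteDimensional_wt`). Indeed `U(𝔮₂)` is
finitely generated as a left module over the subalgebra generated by `𝔤𝔩₂`, the even part
(`U.filt_four_eq_top`), so `V` has a maximal proper `𝔤𝔩₂`-stable subspace `K`. On the simple weight
module `V/K` the Casimir operator is a scalar, and its weight spaces have dimension at most one. As
`K` contains no nonzero subsupermodule, a weight vector of `V` is determined by the classes modulo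
`K` of its images, and those of its parity conjugate, under finitely many odd words.

Now `E` and `F` are injections between adjacent weight spaces, whose dimensions therefore agree, and
`F` is bijective. Hence `U'` acts on `V`, and the action can be twisted by `θ_z` (`conj`). The
operator `θ_z(E) F` acts on a weight vector as `EF` plus a scalar that is quadratic in `z`, so an
eigenvector of `EF` yields a `z` for which `θ_z(E)` has a kernel (`exists_conj_E_eq_zero`). The
Casimir operator is annihilated by a nonzero polynomial, and this leaves only finitely many possible
weights in that kernel, which is thus finite-dimensional (`finiteDimensional_ker_conj_E`). Comparing
dimensions inside it produces a simple subsupermodule `L` of the twisted module on which `E` is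
locally nilpotent (`exists_simple_sub`); it is a highest weight supermodule, and
infinite-dimensional because `F` is injective.

Finally `a ⊗ l ↦ θ_z(a) l` maps `L^(-z)` to `V` and intertwines the actions. It is injective because
every tensor has the form `F^(-n) ⊗ m`, and surjective because `V` is simple (`IsSimple.iso_twist`).
-/

theorem Q2.ext_entries {R : Type u} {x y : Q2 R} (h1 : ∀ i j, x.1 i j = y.1 i j)
    (h2 : ∀ i j, x.2 i j = y.2 i j) : x = y :=
  Prod.ext (Matrix.ext h1) (Matrix.ext h2)

variable {k : Type u} [Field k]

theorem Q2.mem_even (A : Matrix (Fin 2) (Fin 2) k) : ((A, 0) : Q2 k) ∈ Q2.part k 0 :=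
  Q2.mem_part_zero.2 rfl

theorem Q2.mem_odd (B : Matrix (Fin 2) (Fin 2) k) : ((0, B) : Q2 k) ∈ Q2.part k 1 :=
  Q2.mem_part_one.2 rfl

theorem Q2.E_mem : Q2.E k ∈ Q2.part k 0 := Q2.mem_even _
theorem Q2.H1_mem : Q2.H1 k ∈ Q2.part k 0 := Q2.mem_even _
theorem Q2.H2_mem : Q2.H2 k ∈ Q2.part k 0 := Q2.mem_even _
theorem Q2.Ebar_mem : Q2.Ebar k ∈ Q2.part k 1 := Q2.mem_odd _
theorem Q2.Fbar_mem : Q2.Fbar k ∈ Q2.part k 1 := Q2.mem_odd _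

variable (k) in
/-- The odd element `M(0, E₁₁)`. -/
def Q2.H1bar : Q2 k := (0, Matrix.single 0 0 1)

variable (k) in
/-- The odd element `M(0, E₂₂)`. -/
def Q2.H2bar : Q2 k := (0, Matrix.single 1 1 1)

theorem Q2.H1bar_mem : Q2.H1bar k ∈ Q2.part k 1 := Q2.mem_odd _
theorem Q2.H2bar_mem : Q2.H2bar k ∈ Q2.part k 1 := Q2.mem_odd _

theorem Q2.sbracket_E_F : Q2.sbracket (Q2.E k) (Q2.F k) = Q2.H1 k - Q2.H2 k := by
  apply Q2.ext_entries <;> intro i j <;> fin_cases i <;> fin_cases j <;>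
    simp [Q2.sbracket, Q2.E, Q2.F, Q2.H1, Q2.H2]

theorem Q2.sbracket_H1_E : Q2.sbracket (Q2.H1 k) (Q2.E k) = (1 : k) • Q2.E k := by
  apply Q2.ext_entries <;> intro i j <;> fin_cases i <;> fin_cases j <;>
    simp [Q2.sbracket, Q2.E, Q2.H1]

theorem Q2.sbracket_H1_F : Q2.sbracket (Q2.H1 k) (Q2.F k) = (-1 : k) • Q2.F k := by
  apply Q2.ext_entries <;> intro i j <;> fin_cases i <;> fin_cases j <;>
    simp [Q2.sbracket, Q2.F, Q2.H1]

theorem Q2.sbracket_H1_Ebar : Q2.sbracket (Q2.H1 k) (Q2.Ebar k) = (1 : k) • Q2.Ebar k := by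
  apply Q2.ext_entries <;> intro i j <;> fin_cases i <;> fin_cases j <;>
    simp [Q2.sbracket, Q2.Ebar, Q2.H1]

theorem Q2.sbracket_H1_Fbar : Q2.sbracket (Q2.H1 k) (Q2.Fbar k) = (-1 : k) • Q2.Fbar k := by
  apply Q2.ext_entries <;> intro i j <;> fin_cases i <;> fin_cases j <;>
    simp [Q2.sbracket, Q2.Fbar, Q2.H1]

theorem Q2.sbracket_H1_H1bar : Q2.sbracket (Q2.H1 k) (Q2.H1bar k) = (0 : k) • Q2.H1bar k := by
  apply Q2.ext_entries <;> intro i j <;> fin_cases i <;> fin_cases j <;>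
    simp [Q2.sbracket, Q2.H1bar, Q2.H1]

theorem Q2.sbracket_H1_H2bar : Q2.sbracket (Q2.H1 k) (Q2.H2bar k) = (0 : k) • Q2.H2bar k := by
  apply Q2.ext_entries <;> intro i j <;> fin_cases i <;> fin_cases j <;>
    simp [Q2.sbracket, Q2.H2bar, Q2.H1]

theorem Q2.sbracket_H1_H1 : Q2.sbracket (Q2.H1 k) (Q2.H1 k) = (0 : k) • Q2.H1 k := by
  simp [Q2.sbracket, Q2.H1]

theorem Q2.sbracket_H1_H2 : Q2.sbracket (Q2.H1 k) (Q2.H2 k) = (0 : k) • Q2.H2 k := by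
  simp [Q2.sbracket, Q2.H1, Q2.H2]

theorem Q2.sbracket_E_Ebar : Q2.sbracket (Q2.E k) (Q2.Ebar k) = 0 := by
  simp [Q2.sbracket, Q2.E, Q2.Ebar]

theorem Q2.sbracket_F_Fbar : Q2.sbracket (Q2.F k) (Q2.Fbar k) = 0 := by
  simp [Q2.sbracket, Q2.F, Q2.Fbar]

theorem Q2.sbracket_Ebar_Ebar : Q2.sbracket (Q2.Ebar k) (Q2.Ebar k) = 0 := by
  simp [Q2.sbracket, Q2.Ebar]

theorem Q2.sbracket_Fbar_Fbar : Q2.sbracket (Q2.Fbar k) (Q2.Fbar k) = 0 := by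
  simp [Q2.sbracket, Q2.Fbar]

theorem Q2.sbracket_center (x : Q2 k) : Q2.sbracket (Q2.H1 k + Q2.H2 k) x = 0 := by
  have h : (Q2.H1 k + Q2.H2 k) = (1, 0) := by
    apply Q2.ext_entries <;> intro i j <;> fin_cases i <;> fin_cases j <;>
      simp [Q2.H1, Q2.H2]
  rw [h]; simp [Q2.sbracket]

/-- `ad E` raises the weight by the root `α`, and the only weights of `𝔮₂` are `-α`, `0` and `α`. -/
theorem Q2.sbracket_E_cube (x : Q2 k) :
    Q2.sbracket (Q2.E k) (Q2.sbracket (Q2.E k) (Q2.sbracket (Q2.E k) x)) = 0 := by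
  apply Q2.ext_entries <;> intro i j <;> fin_cases i <;> fin_cases j <;>
    simp [Q2.sbracket, Q2.E, Matrix.mul_apply, Matrix.single_apply]

theorem Q2.eq_even (x : Q2 k) (hx : x ∈ Q2.part k 0) :
    x = x.1 0 1 • Q2.E k + x.1 1 0 • Q2.F k + x.1 0 0 • Q2.H1 k + x.1 1 1 • Q2.H2 k := by
  rw [Q2.mem_part_zero] at hx
  apply Q2.ext_entries <;> intro i j <;> fin_cases i <;> fin_cases j <;>
    simp [Q2.E, Q2.F, Q2.H1, Q2.H2, hx]

theorem Q2.eq_odd (x : Q2 k) (hx : x ∈ Q2.part k 1) :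
    x = x.2 0 1 • Q2.Ebar k + x.2 1 0 • Q2.Fbar k + x.2 0 0 • Q2.H1bar k
      + x.2 1 1 • Q2.H2bar k := by
  rw [Q2.mem_part_one] at hx
  apply Q2.ext_entries <;> intro i j <;> fin_cases i <;> fin_cases j <;>
    simp [Q2.Ebar, Q2.Fbar, Q2.H1bar, Q2.H2bar, hx]

theorem Q2.eq_even_add_odd (x : Q2 k) :
    ∃ y ∈ Q2.part k 0, ∃ z ∈ Q2.part k 1, x = y + z :=
  ⟨(x.1, 0), Q2.mem_even _, (0, x.2), Q2.mem_odd _, by simp⟩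

end Brackets

namespace Supermodule

variable {k : Type u} [Field k] {V : Type v} [AddCommGroup V] [Module k V]

/-! ### Commutation relations in a supermodule -/

/-- No sign occurs when one argument is even, so `y` need not be homogeneous. -/
theorem ρ_comm (S : Supermodule k V) {x : Q2 k} (hx : x ∈ Q2.part k 0) (y : Q2 k) (v : V) :
    S.ρ x (S.ρ y v) = S.ρ y (S.ρ x v) + S.ρ (Q2.sbracket x y) v := by
  obtain ⟨y₀, h₀, y₁, h₁, rfl⟩ := Q2.eq_even_add_odd y
  have e : Q2.sbracket x (y₀ + y₁) = Q2.sbracket x y₀ + Q2.sbracket x y₁ := by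
    ext : 1 <;> simp [Q2.sbracket, mul_add, add_mul] <;> abel
  have h0 := LinearMap.congr_fun (S.ρ_sbracket hx h₀) v
  have h1 := LinearMap.congr_fun (S.ρ_sbracket hx h₁) v
  simp only [ksign_zero_left, one_smul, LinearMap.sub_apply, Module.End.mul_apply] at h0 h1
  simp only [e, map_add, LinearMap.add_apply, h0, h1]
  abel

theorem ρ_anticomm (S : Supermodule k V) {x y : Q2 k} (hx : x ∈ Q2.part k 1)
    (hy : y ∈ Q2.part k 1) (v : V) :
    S.ρ x (S.ρ y v) = -S.ρ y (S.ρ x v) + S.ρ (Q2.sbracket x y) v := by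
  have h1 := LinearMap.congr_fun (S.ρ_sbracket hx hy) v
  simp only [ksign_one_one, neg_smul, one_smul, sub_neg_eq_add, LinearMap.add_apply,
    Module.End.mul_apply] at h1
  rw [h1]; abel

theorem ρ_E_F (S : Supermodule k V) (v : V) :
    S.ρ (Q2.E k) (S.ρ (Q2.F k) v)
      = S.ρ (Q2.F k) (S.ρ (Q2.E k) v) + (S.ρ (Q2.H1 k) v - S.ρ (Q2.H2 k) v) := by
  rw [S.ρ_comm Q2.E_mem, Q2.sbracket_E_F, map_sub, LinearMap.sub_apply]

/-- The eigenspace of `H₁`. -/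
abbrev wt (S : Supermodule k V) (a : k) : Submodule k V := Module.End.eigenspace (S.ρ (Q2.H1 k)) a

theorem mem_wt (S : Supermodule k V) {a : k} {v : V} :
    v ∈ S.wt a ↔ S.ρ (Q2.H1 k) v = a • v := Module.End.mem_eigenspace_iff

theorem ρ_mem_wt (S : Supermodule k V) {x : Q2 k} {s a : k} {v : V}
    (hx : Q2.sbracket (Q2.H1 k) x = s • x) (hv : v ∈ S.wt a) : S.ρ x v ∈ S.wt (a + s) := by
  rw [mem_wt] at *
  rw [S.ρ_comm Q2.H1_mem, hx, hv, map_smul, map_smul, LinearMap.smul_apply, add_smul]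

/-! ### Parity and subsupermodules -/

theorem parity_ρ (S : Supermodule k V) (x : Q2 k) (v : V) :
    S.parity (S.ρ x v) = S.ρ (Q2.parity k x) (S.parity v) := by
  have := S.parity_act (U.ι k x) v
  rwa [U.parity_ι, act_ι, act_ι] at this

theorem parity_ρ_even (S : Supermodule k V) {x : Q2 k} (hx : x ∈ Q2.part k 0) (v : V) :
    S.parity (S.ρ x v) = S.ρ x (S.parity v) := by
  rw [parity_ρ, Q2.parity_of_mem hx, psign_zero, one_smul]

theorem parity_parity (S : Supermodule k V) (v : V) : S.parity (S.parity v) = v := by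
  obtain ⟨a, ha, b, hb, rfl⟩ := S.exists_parts v
  simp [S.parity_of_mem ha, S.parity_of_mem hb, psign_zero, psign_one]

/-- The two parts are the eigenspaces of the parity operator because `2` is invertible. Homogeneity
thus becomes an equation, which can be checked after applying an injective map. -/
theorem mem_part_iff [CharZero k] (S : Supermodule k V) {i : ZMod 2} {v : V} :
    v ∈ S.part i ↔ S.parity v = psign k i • v := by
  refine ⟨S.parity_of_mem, fun h => ?_⟩
  obtain ⟨a, ha, b, hb, rfl⟩ := S.exists_parts v
  rw [map_add, S.parity_of_mem ha, S.parity_of_mem hb] at h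
  have half : ∀ w : V, w + w = 0 → w = 0 := fun w hw => by
    rw [← two_smul k] at hw; exact (smul_eq_zero.1 hw).resolve_left two_ne_zero
  rcases zmod_two_cases i with rfl | rfl
  · simp only [psign_zero, psign_one, one_smul, neg_smul, add_right_inj] at h
    rw [half b (by nth_rw 1 [← h]; simp), add_zero]; exact ha
  · simp only [psign_zero, psign_one, one_smul, neg_smul, neg_add, add_left_inj] at h
    rw [half a (by nth_rw 1 [h]; simp), zero_add]; exact hb

/-- The homogeneous components of `v` are `(v ± Πv)/2` with `Π` the parity operator, so being graded
means being stable under `Π`. -/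
theorem isSub_iff [CharZero k] (S : Supermodule k V) {X : Submodule k V} :
    S.IsSub X ↔ (∀ v ∈ X, S.parity v ∈ X) ∧ ∀ x, ∀ v ∈ X, S.ρ x v ∈ X := by
  refine and_congr_left fun _ => ⟨fun h v hv => ?_, fun h => le_antisymm (fun v hv => ?_) ?_⟩
  · rw [h] at hv
    obtain ⟨a, ha, b, hb, rfl⟩ := Submodule.mem_sup.1 hv
    rw [map_add, S.parity_of_mem ha.2, S.parity_of_mem hb.2]
    exact X.add_mem (X.smul_mem _ ha.1) (X.smul_mem _ hb.1)
  · obtain ⟨a, ha, b, hb, rfl⟩ := S.exists_parts v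
    have h' := h _ hv
    rw [map_add, S.parity_of_mem ha, S.parity_of_mem hb, psign_zero, psign_one] at h'
    have h0 : a ∈ X := by
      have := X.smul_mem (2⁻¹ : k) (X.add_mem hv h')
      convert this using 1
      module
    have h1 : b ∈ X := by simpa using X.sub_mem hv h0
    exact Submodule.add_mem_sup ⟨h0, ha⟩ ⟨h1, hb⟩
  · exact sup_le inf_le_left inf_le_left

theorem IsSub.parity_mem [CharZero k] {S : Supermodule k V} {X : Submodule k V} (h : S.IsSub X)
    {v : V} (hv : v ∈ X) : S.parity v ∈ X := (S.isSub_iff.1 h).1 v hv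

theorem isSub_sInf [CharZero k] (S : Supermodule k V) {Y : Set (Submodule k V)}
    (h : ∀ X ∈ Y, S.IsSub X) : S.IsSub (sInf Y) := by
  refine S.isSub_iff.2 ⟨fun v hv => ?_, fun x v hv => ?_⟩
  all_goals
    rw [Submodule.mem_sInf] at *
    intro X hX
  · exact (h X hX).parity_mem (hv X hX)
  · exact (h X hX).2 x v (hv X hX)

theorem IsSimple.eq_top {S : Supermodule k V} (hS : S.IsSimple) {X : Submodule k V}
    (hX : S.IsSub X) {v : V} (hv : v ∈ X) (h0 : v ≠ 0) : X = ⊤ :=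
  (hS.2 X hX).resolve_left fun h => h0 (by rwa [h, Submodule.mem_bot] at hv)

/-! ### The locally nilpotent part of an even operator -/

/-- The vectors killed by some power of `x`. -/
def nilPart (S : Supermodule k V) (x : Q2 k) : Submodule k V :=
  ⨆ n : ℕ, LinearMap.ker (S.ρ x ^ n)

theorem mem_nilPart (S : Supermodule k V) {x : Q2 k} {v : V} :
    v ∈ S.nilPart x ↔ ∃ n : ℕ, (S.ρ x ^ n) v = 0 := by
  rw [nilPart, Submodule.mem_iSup_of_directed _ (Monotone.directed_le ?_)]
  · simp
  · refine monotone_nat_of_le_succ fun n v hv => ?_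
    rw [LinearMap.mem_ker] at *
    rw [pow_succ', Module.End.mul_apply, hv, map_zero]

/-- Leibniz rule: `x^(m+r) y` is a combination of the terms `(ad x)^i(y) x^(m+r-i)`. Those with `i ≥
r` vanish, and the others kill `v` because `m + r - i > m`. The double induction moves one `x` at a
time past `y`. -/
theorem pow_ρ_eq_zero (S : Supermodule k V) {x : Q2 k} (hx : x ∈ Q2.part k 0) (r : ℕ) :
    ∀ y : Q2 k, (Q2.sbracket x)^[r] y = 0 → ∀ (m : ℕ) (v : V), (S.ρ x ^ m) v = 0 →
      (S.ρ x ^ (m + r)) (S.ρ y v) = 0 := by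
  induction r with
  | zero =>
    intro y hy m v _
    rw [Function.iterate_zero, id] at hy
    simp [hy]
  | succ r ih =>
    intro y hy m
    induction m with
    | zero =>
      intro v hv
      have : v = 0 := by simpa using hv
      simp [this]
    | succ m ihm =>
      intro v hv
      have h1 := ih _ (by rwa [Function.iterate_succ_apply] at hy) (m + 1) v hv
      have h2 := ihm (S.ρ x v) (by rwa [pow_succ, Module.End.mul_apply] at hv)
      rw [show m + 1 + (r + 1) = (m + 1 + r) + 1 by ring, pow_succ, Module.End.mul_apply,
        S.ρ_comm hx, map_add, h1, add_zero, add_right_comm]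
      exact h2

theorem isSub_nilPart [CharZero k] (S : Supermodule k V) {x : Q2 k} (hx : x ∈ Q2.part k 0)
    (h3 : ∀ y, Q2.sbracket x (Q2.sbracket x (Q2.sbracket x y)) = 0) :
    S.IsSub (S.nilPart x) := by
  refine S.isSub_iff.2 ⟨fun v hv => ?_, fun y v hv => ?_⟩
  all_goals
    rw [mem_nilPart] at *
    obtain ⟨n, hn⟩ := hv
  · refine ⟨n, ?_⟩
    have : ∀ (n : ℕ) (v : V), (S.ρ x ^ n) (S.parity v) = S.parity ((S.ρ x ^ n) v) := by
      intro n
      induction n with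
      | zero => simp
      | succ n ih => intro v; rw [pow_succ, Module.End.mul_apply, ← S.parity_ρ_even hx, ih]; rfl
    rw [this, hn, map_zero]
  · exact ⟨_, S.pow_ρ_eq_zero hx 3 y (h3 y) n v hn⟩

theorem isSub_nilPart_E [CharZero k] (S : Supermodule k V) : S.IsSub (S.nilPart (Q2.E k)) :=
  S.isSub_nilPart Q2.E_mem Q2.sbracket_E_cube

/-! ### The central element `H₁ + H₂` -/

/-- Schur's lemma with the eigenvalue given: `H₁ + H₂` is even and central, so its eigenspace
through a weight vector is a nonzero subsupermodule. From here on weights are recorded by their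
`H₁`-eigenvalue alone. -/
theorem IsSimple.exists_central [CharZero k] {S : Supermodule k V} (hS : S.IsSimple)
    (h : ∃ μ : k × k, ∃ v ∈ S.weightSpace μ, v ≠ 0) :
    ∃ c : k, ∀ v, S.ρ (Q2.H1 k) v + S.ρ (Q2.H2 k) v = c • v := by
  obtain ⟨μ, v, hv, h0⟩ := h
  rw [mem_weightSpace] at hv
  refine ⟨μ.1 + μ.2, fun w => ?_⟩
  have hsub : S.IsSub (Module.End.eigenspace (S.ρ (Q2.H1 k + Q2.H2 k)) (μ.1 + μ.2)) := by
    have hz : Q2.H1 k + Q2.H2 k ∈ Q2.part k 0 := Submodule.add_mem _ Q2.H1_mem Q2.H2_mem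
    refine S.isSub_iff.2 ⟨fun v hv => ?_, fun y v hv => ?_⟩
    all_goals rw [Module.End.mem_eigenspace_iff] at *
    · rw [← S.parity_ρ_even hz, hv, map_smul]
    · rw [S.ρ_comm hz, hv, Q2.sbracket_center]; simp
  have htop := hS.eq_top hsub (v := v) (by
    rw [Module.End.mem_eigenspace_iff, map_add, LinearMap.add_apply, hv.1, hv.2, add_smul]) h0
  have : w ∈ Module.End.eigenspace (S.ρ (Q2.H1 k + Q2.H2 k)) (μ.1 + μ.2) := by
    rw [htop]; trivial
  rwa [Module.End.mem_eigenspace_iff, map_add, LinearMap.add_apply] at this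

/-! ### Extremal vectors -/

/-- If `x` is `E` or `F`, with odd partner `xb`, and `x` has a kernel, there is a generating
homogeneous weight vector killed by `x` and `xb`. -/
theorem IsSimple.exists_extremal [CharZero k] {S : Supermodule k V} (hS : S.IsSimple)
    (h : ∃ μ : k × k, ∃ v ∈ S.weightSpace μ, v ≠ 0)
    {x xb : Q2 k} (hx : x ∈ Q2.part k 0) (hxb : xb ∈ Q2.part k 1)
    (h3 : ∀ y, Q2.sbracket x (Q2.sbracket x (Q2.sbracket x y)) = 0)
    (hxx : Q2.sbracket x xb = 0) (hbb : Q2.sbracket xb xb = 0) {s : k}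
    (hs : Q2.sbracket (Q2.H1 k) x = s • x) (hsb : Q2.sbracket (Q2.H1 k) xb = s • xb)
    (hker : ∃ v, v ≠ 0 ∧ S.ρ x v = 0) :
    ∃ (μ : k × k) (i : ZMod 2) (v : V), v ≠ 0 ∧ v ∈ S.weightSpace μ ∧ v ∈ S.part i ∧
      S.ρ x v = 0 ∧ S.ρ xb v = 0 ∧ ∀ X : Submodule k V, S.IsSub X → v ∈ X → X = ⊤ := by
  obtain ⟨c, hc⟩ := hS.exists_central h
  have hw : ∀ {a : k} {v : V}, v ∈ S.wt a → v ∈ S.weightSpace (a, c - a) := by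
    intro a v hv
    rw [mem_wt] at hv
    refine S.mem_weightSpace.2 ⟨hv, ?_⟩
    have := hc v
    rw [hv] at this
    rw [sub_smul, ← this, add_sub_cancel_left]
  -- One vector killed by `x` makes `x` locally nilpotent on the whole simple module.
  have hnil : S.nilPart x = ⊤ := by
    obtain ⟨v, h0, hv⟩ := hker
    exact hS.eq_top (S.isSub_nilPart hx h3) (S.mem_nilPart.2 ⟨1, by simpa using hv⟩) h0
  obtain ⟨μ, v, hv, h0⟩ := h
  obtain ⟨v₀, h₀, v₁, h₁, hv01⟩ := S.exists_parts v
  have hmem : v ∈ S.wt μ.1 := S.mem_wt.2 (S.mem_weightSpace.1 hv).1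
  -- a homogeneous weight vector
  obtain ⟨i, w, hwi, hwt, hw0⟩ : ∃ (i : ZMod 2) (w : V), w ∈ S.part i ∧ w ∈ S.wt μ.1 ∧ w ≠ 0 := by
    have hp : S.parity v ∈ S.wt μ.1 := by
      rw [mem_wt] at *
      rw [← S.parity_ρ_even Q2.H1_mem, hmem, map_smul]
    have e : S.parity v = v₀ - v₁ := by
      rw [← hv01, map_add, S.parity_of_mem h₀, S.parity_of_mem h₁, psign_zero, psign_one]
      module
    by_cases hz : v₀ = 0
    · refine ⟨1, v₁, h₁, ?_, fun h => h0 (by rw [← hv01, hz, h, add_zero])⟩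
      rw [hz, zero_add] at hv01
      rwa [hv01]
    · refine ⟨0, v₀, h₀, ?_, hz⟩
      have := (S.wt μ.1).smul_mem (2⁻¹ : k) (add_mem hmem hp)
      convert this using 1
      rw [e, ← hv01]; module
  -- the last nonzero power
  obtain ⟨n, hn⟩ := S.mem_nilPart.1 (show w ∈ S.nilPart x by rw [hnil]; trivial)
  obtain ⟨a, u, hui, hua, hu0, hux⟩ : ∃ (a : k) (u : V), u ∈ S.part i ∧ u ∈ S.wt a ∧ u ≠ 0 ∧
      S.ρ x u = 0 := by
    clear hv01 hmem hv h₀ h₁ h0 hnil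
    generalize μ.1 = b at hwt
    induction n generalizing w b with
    | zero => exact absurd (by simpa using hn) hw0
    | succ n ih =>
      by_cases hz : S.ρ x w = 0
      · exact ⟨b, w, hwi, hwt, hw0, hz⟩
      · refine ih (S.ρ x w) ?_ hz (by rwa [pow_succ, Module.End.mul_apply] at hn) _
          (S.ρ_mem_wt hs hwt)
        simpa using S.ρ_mem hx hwi
  -- If `xb u ≠ 0`, this vector replaces `u`: `x` commutes with `xb`, and `2 xb² = [xb, xb] = 0`.
  by_cases hz : S.ρ xb u = 0
  · exact ⟨_, i, u, hu0, hw hua, hui, hux, hz, fun X hX hu => hS.eq_top hX hu hu0⟩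
  · refine ⟨_, _, S.ρ xb u, hz, hw (S.ρ_mem_wt hsb hua), S.ρ_mem hxb hui, ?_, ?_,
      fun X hX hu => hS.eq_top hX hu hz⟩
    · rw [S.ρ_comm hx, hux, hxx]; simp
    · have := S.ρ_anticomm hxb hxb u
      rw [hbb, map_zero, LinearMap.zero_apply, add_zero, eq_neg_iff_add_eq_zero,
        ← two_smul k] at this
      exact (smul_eq_zero.1 this).resolve_left two_ne_zero

theorem IsSimple.isHighestWeight [CharZero k] {S : Supermodule k V} (hS : S.IsSimple)
    (h : ∃ μ : k × k, ∃ v ∈ S.weightSpace μ, v ≠ 0)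
    (hker : ∃ v, v ≠ 0 ∧ S.ρ (Q2.E k) v = 0) : S.IsHighestWeight :=
  hS.exists_extremal h Q2.E_mem Q2.Ebar_mem Q2.sbracket_E_cube Q2.sbracket_E_Ebar
    Q2.sbracket_Ebar_Ebar Q2.sbracket_H1_E Q2.sbracket_H1_Ebar hker

theorem IsSimple.isLowestWeight [CharZero k] {S : Supermodule k V} (hS : S.IsSimple)
    (h : ∃ μ : k × k, ∃ v ∈ S.weightSpace μ, v ≠ 0)
    (hker : ∃ v, v ≠ 0 ∧ S.ρ (Q2.F k) v = 0) : S.IsLowestWeight :=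
  hS.exists_extremal h (Q2.F_mem k) Q2.Fbar_mem (Q2.adF_cube k) Q2.sbracket_F_Fbar
    Q2.sbracket_Fbar_Fbar Q2.sbracket_H1_F Q2.sbracket_H1_Fbar hker

end Supermodule

/-! ### `U(𝔮₂)` is finitely generated over the enveloping algebra of its even part -/

section Generation

variable {k : Type u} [Field k]

variable (k) in
/-- The subalgebra of `U(𝔮₂)` generated by the even part of `𝔮₂`. -/
def U.even : Subalgebra k (U k) := Algebra.adjoin k (U.ι k '' (Q2.part k 0 : Set (Q2 k)))

theorem U.ι_mem_even {x : Q2 k} (hx : x ∈ Q2.part k 0) : U.ι k x ∈ U.even k :=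
  Algebra.subset_adjoin ⟨x, hx, rfl⟩

variable (k) in
/-- A basis of the odd part of `𝔮₂` consisting of weight vectors. -/
def Q2.oddBasis : Fin 4 → Q2 k := ![Q2.Ebar k, Q2.Fbar k, Q2.H1bar k, Q2.H2bar k]

theorem Q2.oddBasis_mem (i : Fin 4) : Q2.oddBasis k i ∈ Q2.part k 1 := by
  fin_cases i
  exacts [Q2.Ebar_mem, Q2.Fbar_mem, Q2.H1bar_mem, Q2.H2bar_mem]

theorem Q2.exists_weight_oddBasis (i : Fin 4) :
    ∃ s : k, Q2.sbracket (Q2.H1 k) (Q2.oddBasis k i) = s • Q2.oddBasis k i := by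
  fin_cases i
  exacts [⟨_, Q2.sbracket_H1_Ebar⟩, ⟨_, Q2.sbracket_H1_Fbar⟩, ⟨_, Q2.sbracket_H1_H1bar⟩,
    ⟨_, Q2.sbracket_H1_H2bar⟩]

theorem Q2.mem_span_oddBasis {x : Q2 k} (hx : x ∈ Q2.part k 1) :
    x ∈ Submodule.span k (Set.range (Q2.oddBasis k)) := by
  rw [Q2.eq_odd x hx]
  have h : ∀ i, Q2.oddBasis k i ∈ Submodule.span k (Set.range (Q2.oddBasis k)) := fun i =>
    Submodule.subset_span ⟨i, rfl⟩
  exact add_mem (add_mem (add_mem (Submodule.smul_mem _ _ (h 0)) (Submodule.smul_mem _ _ (h 1)))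
    (Submodule.smul_mem _ _ (h 2))) (Submodule.smul_mem _ _ (h 3))

variable (k) in
/-- The product of a list of odd basis vectors. -/
def U.word (l : List (Fin 4)) : U k := (l.map fun i => U.ι k (Q2.oddBasis k i)).prod

theorem U.word_cons (i : Fin 4) (l : List (Fin 4)) :
    U.word k (i :: l) = U.ι k (Q2.oddBasis k i) * U.word k l := by simp [U.word]

theorem U.word_append (l l' : List (Fin 4)) :
    U.word k (l ++ l') = U.word k l * U.word k l' := by simp [U.word]

variable (k) in
/-- The left `U.even k`-span of the words of length at most `n`. -/
def U.filt (n : ℕ) : Submodule k (U k) :=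
  Submodule.span k {c | ∃ a ∈ U.even k, ∃ l : List (Fin 4), l.length ≤ n ∧ c = a * U.word k l}

theorem U.mul_word_mem {a : U k} (ha : a ∈ U.even k) {l : List (Fin 4)} {n : ℕ}
    (hl : l.length ≤ n) : a * U.word k l ∈ U.filt k n :=
  Submodule.subset_span ⟨a, ha, l, hl, rfl⟩

theorem U.filt_mono {m n : ℕ} (h : m ≤ n) : U.filt k m ≤ U.filt k n := by
  refine Submodule.span_mono ?_
  rintro _ ⟨a, ha, l, hl, rfl⟩
  exact ⟨a, ha, l, hl.trans h, rfl⟩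

theorem U.even_mul_mem {n : ℕ} {a c : U k} (ha : a ∈ U.even k) (hc : c ∈ U.filt k n) :
    a * c ∈ U.filt k n := by
  induction hc using Submodule.span_induction with
  | mem c hc =>
    obtain ⟨b, hb, l, hl, rfl⟩ := hc
    rw [← mul_assoc]
    exact U.mul_word_mem (mul_mem ha hb) hl
  | zero => simp
  | add c d _ _ hc hd => rw [mul_add]; exact add_mem hc hd
  | smul r c _ hc => rw [mul_smul_comm]; exact Submodule.smul_mem _ _ hc

theorem U.filt_mul_word {m n : ℕ} {c : U k} (hc : c ∈ U.filt k m) {l : List (Fin 4)}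
    (h : m + l.length ≤ n) : c * U.word k l ∈ U.filt k n := by
  induction hc using Submodule.span_induction with
  | mem c hc =>
    obtain ⟨b, hb, l', hl', rfl⟩ := hc
    rw [mul_assoc, ← U.word_append]
    exact U.mul_word_mem hb (by rw [List.length_append]; omega)
  | zero => simp
  | add c d _ _ hc hd => rw [add_mul]; exact add_mem hc hd
  | smul r c _ hc => rw [smul_mul_assoc]; exact Submodule.smul_mem _ _ hc

/-- Bracketing with an even element preserves the odd part, so moving an odd factor to the right
past even ones leaves exactly one odd factor in each term. -/
theorem U.odd_mul_even {x : Q2 k} (hx : x ∈ Q2.part k 1) {a : U k} (ha : a ∈ U.even k) :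
    U.ι k x * a ∈ U.filt k 1 := by
  -- The induction on `a` needs arbitrary odd elements on the right; expansion in `Q2.oddBasis` is
  -- postponed to the end.
  suffices H : U.ι k x * a ∈ Submodule.span k
      {c | ∃ b ∈ U.even k, ∃ y ∈ Q2.part k 1, c = b * U.ι k y} by
    refine (Submodule.span_le.2 ?_) H
    rintro _ ⟨b, hb, y, hy, rfl⟩
    refine U.even_mul_mem hb ?_
    have h := Submodule.mem_map_of_mem (f := U.ι k) (Q2.mem_span_oddBasis hy)
    rw [Submodule.map_span] at h
    refine (Submodule.span_le.2 ?_) h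
    rintro _ ⟨_, ⟨i, rfl⟩, rfl⟩
    simpa [U.word] using U.mul_word_mem (k := k) (one_mem _) (l := [i]) (n := 1) (by simp)
  induction ha using Algebra.adjoin_induction generalizing x with
  | mem a ha =>
    obtain ⟨y, hy, rfl⟩ := ha
    have h := U.ι_mul_ι hy hx
    rw [ksign_zero_left, one_smul] at h
    rw [eq_sub_of_add_eq h.symm]
    refine sub_mem (Submodule.subset_span ⟨_, U.ι_mem_even hy, x, hx, rfl⟩)
      (Submodule.subset_span ⟨1, one_mem _, _, ?_, (one_mul _).symm⟩)
    simpa using Q2.sbracket_mem hy hx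
  | algebraMap r =>
    exact Submodule.subset_span ⟨algebraMap k _ r, Subalgebra.algebraMap_mem _ r, x, hx,
      (Algebra.commutes _ _).symm⟩
  | add a b _ _ ha hb => rw [mul_add]; exact add_mem (ha hx) (hb hx)
  | mul a b _ _ ha hb =>
    rw [← mul_assoc]
    have h := ha hx
    generalize U.ι k x * a = c at h
    induction h using Submodule.span_induction with
    | mem c hc =>
      obtain ⟨a', ha', y, hy, rfl⟩ := hc
      have h := hb hy
      rw [mul_assoc]
      generalize U.ι k y * b = d at h
      induction h using Submodule.span_induction with
      | mem d hd =>
        obtain ⟨b', hb', y', hy', rfl⟩ := hd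
        exact Submodule.subset_span ⟨a' * b', mul_mem ha' hb', y', hy', (mul_assoc _ _ _).symm⟩
      | zero => simp
      | add c d _ _ hc hd => rw [mul_add]; exact add_mem hc hd
      | smul r c _ hc => rw [mul_smul_comm]; exact Submodule.smul_mem _ _ hc
    | zero => simp
    | add c d _ _ hc hd => rw [add_mul]; exact add_mem hc hd
    | smul r c _ hc => rw [smul_mul_assoc]; exact Submodule.smul_mem _ _ hc

theorem U.odd_mul_mem {x : Q2 k} (hx : x ∈ Q2.part k 1) {n : ℕ} {c : U k}
    (hc : c ∈ U.filt k n) : U.ι k x * c ∈ U.filt k (n + 1) := by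
  induction hc using Submodule.span_induction with
  | mem c hc =>
    obtain ⟨b, hb, l, hl, rfl⟩ := hc
    rw [← mul_assoc]
    exact U.filt_mul_word (U.odd_mul_even hx hb) (by omega)
  | zero => simp
  | add c d _ _ hc hd => rw [mul_add]; exact add_mem hc hd
  | smul r c _ hc => rw [mul_smul_comm]; exact Submodule.smul_mem _ _ hc

theorem U.word_mul_mem (l : List (Fin 4)) {n : ℕ} {c : U k}
    (hc : c ∈ U.filt k n) : U.word k l * c ∈ U.filt k (l.length + n) := by
  induction l with
  | nil => simpa [U.word] using hc
  | cons i l ih =>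
    rw [U.word_cons, mul_assoc, List.length_cons, add_right_comm]
    exact U.odd_mul_mem (Q2.oddBasis_mem i) ih

/-- Odd elements anticommute up to an even bracket. Swapping two neighbours changes the sign of a
word modulo words with two letters fewer, once the bracket has been moved to the left. The prefix
`t` lets the induction act inside a word. -/
theorem U.word_perm_mem {n : ℕ} {l l' : List (Fin 4)} (h : l.Perm l') :
    ∀ t : List (Fin 4), t.length + l.length ≤ n + 1 → U.word k (t ++ l) ∈ U.filt k n →
      U.word k (t ++ l') ∈ U.filt k n := by
  induction h with
  | nil => exact fun _ _ h => h
  | cons i _ ih =>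
    intro t ht h
    have := ih (t ++ [i]) (by simp only [List.length_append, List.length_cons, List.length_nil] at *; omega)
      (by simpa using h)
    simpa using this
  | swap i j l =>
    intro t ht h
    have hc := U.ι_mul_ι (Q2.oddBasis_mem (k := k) i) (Q2.oddBasis_mem j)
    rw [ksign_one_one, neg_smul, one_smul] at hc
    have e : U.word k (t ++ i :: j :: l) = -U.word k (t ++ j :: i :: l)
        + U.word k t * (U.ι k (Q2.sbracket (Q2.oddBasis k i) (Q2.oddBasis k j)) * U.word k l) := by
      simp only [U.word_append, U.word_cons]
      rw [← mul_assoc (U.ι k (Q2.oddBasis k i)), hc]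
      noncomm_ring
    rw [e]
    have hev : Q2.sbracket (Q2.oddBasis k i) (Q2.oddBasis k j) ∈ Q2.part k 0 :=
      Q2.sbracket_mem (Q2.oddBasis_mem i) (Q2.oddBasis_mem j)
    refine add_mem (neg_mem h) (U.filt_mono ?_ (U.word_mul_mem t
      (U.mul_word_mem (U.ι_mem_even hev) le_rfl)))
    simp only [List.length_cons] at ht
    omega
  | trans h₁ _ ih₁ ih₂ =>
    intro t ht h
    exact ih₂ t (by rwa [← h₁.length_eq]) (ih₁ t ht h)

/-- Five letters from an alphabet of four contain a repetition. After a permutation the repeated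
letter stands twice in front, and its square is half of its bracket with itself, hence even; three
letters remain. -/
theorem U.word_mem_filt_four [CharZero k] {l : List (Fin 4)} (hl : l.length ≤ 5) :
    U.word k l ∈ U.filt k 4 := by
  by_cases h4 : l.length ≤ 4
  · simpa using U.mul_word_mem (k := k) (one_mem _) h4
  have hdup : ¬ l.Nodup := fun h => by
    have := h.length_le_card
    simp only [Fintype.card_fin] at this
    omega
  simp only [List.nodup_iff_sublist, not_forall, not_not] at hdup
  obtain ⟨i, hi⟩ := hdup
  obtain ⟨t, ht⟩ := hi.exists_perm_append
  have hlen := ht.length_eq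
  simp only [List.length_append, List.length_cons, List.length_nil] at hlen
  refine U.word_perm_mem (n := 4) ht.symm [] (by simp; omega) ?_
  have hc := U.ι_mul_ι (Q2.oddBasis_mem (k := k) i) (Q2.oddBasis_mem i)
  rw [ksign_one_one, neg_smul, one_smul, ← sub_eq_iff_eq_add', sub_neg_eq_add,
    ← two_smul k] at hc
  have hsq : U.ι k (Q2.oddBasis k i) * U.ι k (Q2.oddBasis k i) ∈ U.even k := by
    have hev : Q2.sbracket (Q2.oddBasis k i) (Q2.oddBasis k i) ∈ Q2.part k 0 :=
      Q2.sbracket_mem (Q2.oddBasis_mem i) (Q2.oddBasis_mem i)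
    have := Subalgebra.smul_mem _ (U.ι_mem_even hev) (2⁻¹ : k)
    rwa [← hc, smul_smul, inv_mul_cancel₀ two_ne_zero, one_smul] at this
  have e : U.word k ([] ++ ([i, i] ++ t))
      = U.ι k (Q2.oddBasis k i) * U.ι k (Q2.oddBasis k i) * U.word k t := by
    simp [U.word, mul_assoc]
  rw [e]
  exact U.mul_word_mem hsq (by omega)

/-- The span is a left ideal containing `1`: an odd generator produces words of length at most five,
which fall back into it. So `U(𝔮₂)` is finitely generated as a left `U.even k`-module. -/
theorem U.filt_four_eq_top [CharZero k] : U.filt k 4 = ⊤ := by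
  have h54 : U.filt k 5 ≤ U.filt k 4 := by
    refine Submodule.span_le.2 ?_
    rintro _ ⟨a, ha, l, hl, rfl⟩
    exact U.even_mul_mem ha (U.word_mem_filt_four hl)
  have key : ∀ c d : U k, d ∈ U.filt k 4 → c * d ∈ U.filt k 4 := by
    intro c
    induction c using U.induction with
    | hs c => exact fun d hd => U.even_mul_mem (Subalgebra.algebraMap_mem _ c) hd
    | hι x =>
      intro d hd
      obtain ⟨y, hy, z, hz, rfl⟩ := Q2.eq_even_add_odd x
      rw [map_add, add_mul]
      exact add_mem (U.even_mul_mem (U.ι_mem_even hy) hd) (h54 (U.odd_mul_mem hz hd))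
    | hadd a b ha hb => exact fun d hd => by rw [add_mul]; exact add_mem (ha d hd) (hb d hd)
    | hmul a b ha hb => exact fun d hd => by rw [mul_assoc]; exact ha _ (hb d hd)
  refine eq_top_iff.2 fun c _ => ?_
  have h1 : (1 : U k) ∈ U.filt k 4 := by
    simpa [U.word] using U.mul_word_mem (k := k) (one_mem _) (l := []) (n := 4) (by simp)
  simpa using key c 1 h1

end Generation

/-! ### Invariant subspaces and eigenvectors -/

section Eigen

variable {k : Type u} [Field k] {V : Type v} [AddCommGroup V] [Module k V]

/-- Applying `f - a` removes the term of eigenvalue `a` and multiplies each other term by the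
nonzero scalar `b - a`. -/
theorem eigenvector_mem_of_sum_mem {f : Module.End k V} {p : Submodule k V}
    (hp : ∀ x ∈ p, f x ∈ p) (s : Finset k) :
    ∀ v : k → V, (∀ b ∈ s, f (v b) = b • v b) → ∑ b ∈ s, v b ∈ p → ∀ b ∈ s, v b ∈ p := by
  classical
  induction s using Finset.induction_on with
  | empty => simp
  | insert a s ha ih =>
    intro v hv hsum
    rw [Finset.sum_insert ha] at hsum
    have hs : ∀ b ∈ s, v b ∈ p := by
      have h1 : ∑ b ∈ s, (b - a) • v b ∈ p := by
        have := sub_mem (hp _ hsum) (p.smul_mem a hsum)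
        rw [map_add, map_sum, hv a (Finset.mem_insert_self _ _), smul_add, Finset.smul_sum,
          add_sub_add_left_eq_sub, ← Finset.sum_sub_distrib] at this
        convert this using 1
        exact Finset.sum_congr rfl fun b hb => by
          rw [hv b (Finset.mem_insert_of_mem hb), sub_smul]
      intro b hb
      have h2 := ih (fun b => (b - a) • v b)
        (fun b hb => by rw [map_smul, hv b (Finset.mem_insert_of_mem hb), smul_comm]) h1 b hb
      have hne : b - a ≠ 0 := sub_ne_zero.2 fun h => ha (h ▸ hb)
      exact (p.smul_mem_iff hne).1 h2
    intro b hb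
    rcases Finset.mem_insert.1 hb with rfl | hb
    · exact (p.add_mem_iff_left (p.sum_mem hs)).1 hsum
    · exact hs b hb

theorem exists_sum_eigenvectors {f : Module.End k V}
    (htop : ⨆ a, Module.End.eigenspace f a = ⊤) (x : V) :
    ∃ (s : Finset k) (v : k → V), (∀ b, f (v b) = b • v b) ∧ ∑ b ∈ s, v b = x := by
  have hx : x ∈ ⨆ a, Module.End.eigenspace f a := by rw [htop]; trivial
  obtain ⟨g, hg, hsum⟩ := (Submodule.mem_iSup_iff_exists_finsupp _ _).1 hx
  exact ⟨g.support, g, fun b => Module.End.mem_eigenspace_iff.1 (hg b), hsum⟩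

/-- This drops the contributions of all other weights. If `y = q + ∑ g b` with `q ∈ p` and `b ≠ a`,
then `q = y - ∑ g b` splits an element of `p` into eigenvectors for distinct eigenvalues, so each of
them lies in `p`. -/
theorem eigenspace_le_of_le_sup {f : Module.End k V} {p : Submodule k V}
    (hp : ∀ x ∈ p, f x ∈ p) {a : k} {y : V} (hy : f y = a • y)
    (h : y ∈ p ⊔ ⨆ b, ⨆ (_ : b ≠ a), Module.End.eigenspace f b) : y ∈ p := by
  classical
  obtain ⟨q, hq, r, hr, rfl⟩ := Submodule.mem_sup.1 h
  obtain ⟨g, hg, rfl⟩ := (Submodule.mem_iSup_iff_exists_finsupp _ _).1 hr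
  have hga : g a = 0 := by simpa using hg a
  have hg' : ∀ b, f (g b) = b • g b := by
    intro b
    by_cases hb : b = a
    · subst hb; simp [hga]
    · have := hg b
      rw [iSup_pos hb] at this
      exact Module.End.mem_eigenspace_iff.1 this
  have ha : a ∉ g.support := by simp [hga]
  have key := eigenvector_mem_of_sum_mem hp (insert a g.support)
    (fun b => if b = a then q + g.sum (fun _ x => x) else -g b) (by
      intro b _
      by_cases hb : b = a
      · subst hb; simpa using hy
      · simp [hb, hg' b]) (by
      rw [Finset.sum_insert ha]
      have e : ∑ b ∈ g.support, (if b = a then q + g.sum (fun _ x => x) else -g b)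
          = -g.sum (fun _ x => x) := by
        rw [Finsupp.sum, ← Finset.sum_neg_distrib]
        exact Finset.sum_congr rfl fun b hb =>
          if_neg (ne_of_mem_of_not_mem hb ha)
      rw [e, if_pos rfl]
      simpa using hq) a (Finset.mem_insert_self _ _)
  simpa using key

end Eigen

namespace Supermodule

variable {k : Type u} [Field k] {V : Type v} [AddCommGroup V] [Module k V]

/-! ### The Casimir operator of `𝔤𝔩₂` -/

/-- The Casimir operator `4 F E + h² + 2 h` of `𝔤𝔩₂`, where `h = H₁ - H₂`. -/
def casimir (S : Supermodule k V) : Module.End k V :=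
  4 • (S.ρ (Q2.F k) * S.ρ (Q2.E k))
    + ((S.ρ (Q2.H1 k) - S.ρ (Q2.H2 k)) * (S.ρ (Q2.H1 k) - S.ρ (Q2.H2 k))
      + 2 • (S.ρ (Q2.H1 k) - S.ρ (Q2.H2 k)))

theorem ρ_even_mul (S : Supermodule k V) {x : Q2 k} (hx : x ∈ Q2.part k 0) (y : Q2 k) :
    S.ρ x * S.ρ y = S.ρ y * S.ρ x + S.ρ (Q2.sbracket x y) :=
  LinearMap.ext fun v => S.ρ_comm hx y v

theorem sbracket_h_E : Q2.sbracket (Q2.H1 k - Q2.H2 k) (Q2.E k) = (2 : k) • Q2.E k := by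
  apply Q2.ext_entries <;> intro i j <;> fin_cases i <;> fin_cases j <;>
    simp [Q2.sbracket, Q2.E, Q2.H1, Q2.H2]
  norm_num

theorem sbracket_h_F : Q2.sbracket (Q2.H1 k - Q2.H2 k) (Q2.F k) = (-2 : k) • Q2.F k := by
  apply Q2.ext_entries <;> intro i j <;> fin_cases i <;> fin_cases j <;>
    simp [Q2.sbracket, Q2.F, Q2.H1, Q2.H2]
  norm_num

theorem h_mem : Q2.H1 k - Q2.H2 k ∈ Q2.part k 0 := sub_mem Q2.H1_mem Q2.H2_mem

/-- On `E` and `F` the corrections coming from `[h, E] = 2E`, `[h, F] = -2F` and `[E, F] = h`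
cancel, and `F E` and `h` have weight zero. -/
theorem commute_casimir (S : Supermodule k V) {x : Q2 k} (hx : x ∈ Q2.part k 0) :
    Commute S.casimir (S.ρ x) := by
  have hEF := S.ρ_even_mul Q2.E_mem (Q2.F k)
  have hhE := S.ρ_even_mul h_mem (Q2.E k)
  have hhF := S.ρ_even_mul h_mem (Q2.F k)
  rw [Q2.sbracket_E_F] at hEF
  rw [sbracket_h_E, map_smul, two_smul] at hhE
  rw [sbracket_h_F, map_smul, neg_smul, two_smul] at hhF
  have hHE := S.ρ_even_mul Q2.H1_mem (Q2.E k)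
  have hHF := S.ρ_even_mul Q2.H1_mem (Q2.F k)
  rw [Q2.sbracket_H1_E, map_smul, one_smul] at hHE
  rw [Q2.sbracket_H1_F, map_smul, neg_smul, one_smul] at hHF
  have hHh : S.ρ (Q2.H1 k) * S.ρ (Q2.H1 k - Q2.H2 k)
      = S.ρ (Q2.H1 k - Q2.H2 k) * S.ρ (Q2.H1 k) := by
    rw [S.ρ_even_mul Q2.H1_mem]; simp [Q2.sbracket, Q2.H1, Q2.H2, mul_sub, sub_mul, Prod.mk_zero_zero]
  have eC : S.casimir = 4 • (S.ρ (Q2.F k) * S.ρ (Q2.E k))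
    + (S.ρ (Q2.H1 k - Q2.H2 k) * S.ρ (Q2.H1 k - Q2.H2 k) + 2 • S.ρ (Q2.H1 k - Q2.H2 k)) := by
    rw [casimir, map_sub]
  have cE : Commute S.casimir (S.ρ (Q2.E k)) := by
    rw [eC]
    set h := S.ρ (Q2.H1 k - Q2.H2 k)
    set e := S.ρ (Q2.E k)
    set f := S.ρ (Q2.F k)
    change _ * _ = _ * _
    have e1 : e * (f * e) = f * e * e + h * e := by rw [← mul_assoc, hEF, add_mul]
    have e2 : h * h * e = e * (h * h) + 4 • (e * h) + 4 • e := by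
      rw [mul_assoc, hhE, mul_add, mul_add, ← mul_assoc, hhE]; noncomm_ring
    simp only [mul_add, add_mul, mul_smul_comm, smul_mul_assoc, e1, e2, hhE]
    noncomm_ring
  have cF : Commute S.casimir (S.ρ (Q2.F k)) := by
    rw [eC]
    set h := S.ρ (Q2.H1 k - Q2.H2 k)
    set e := S.ρ (Q2.E k)
    set f := S.ρ (Q2.F k)
    change _ * _ = _ * _
    have e1 : f * e * f = f * (f * e) + f * h := by rw [mul_assoc, hEF, mul_add]
    have e2 : h * h * f = f * (h * h) - 4 • (f * h) + 4 • f := by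
      rw [mul_assoc, hhF, mul_add, mul_neg, mul_add, ← mul_assoc, hhF]; noncomm_ring
    simp only [mul_add, add_mul, mul_smul_comm, smul_mul_assoc, e1, e2, hhF]
    noncomm_ring
  have cH : Commute S.casimir (S.ρ (Q2.H1 k)) := by
    rw [eC]
    have c1 : Commute (S.ρ (Q2.F k) * S.ρ (Q2.E k)) (S.ρ (Q2.H1 k)) := by
      change _ * _ = _ * _
      rw [← mul_assoc, hHF, mul_assoc, add_mul, mul_assoc, hHE]
      noncomm_ring
    have c2 : Commute (S.ρ (Q2.H1 k - Q2.H2 k)) (S.ρ (Q2.H1 k)) := hHh.symm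
    exact (c1.smul_left 4).add_left ((c2.mul_left c2).add_left (c2.smul_left 2))
  -- `H₂` is the central element `H₁ + H₂` minus `H₁`.
  have cH2 : Commute S.casimir (S.ρ (Q2.H2 k)) := by
    have hz : Commute (S.ρ (Q2.H1 k + Q2.H2 k)) S.casimir := by
      have hz : ∀ y, Commute (S.ρ (Q2.H1 k + Q2.H2 k)) (S.ρ y) := fun y => by
        change _ * _ = _ * _
        rw [S.ρ_even_mul (add_mem Q2.H1_mem Q2.H2_mem), Q2.sbracket_center, map_zero, add_zero]
      rw [eC]
      exact (((hz _).mul_right (hz _)).smul_right 4).add_right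
        (((hz _).mul_right (hz _)).add_right ((hz _).smul_right 2))
    have := hz.symm.sub_right cH
    rwa [map_add, add_sub_cancel_left] at this
  rw [Q2.eq_even x hx]
  simp only [map_add, map_smul]
  exact (((cE.smul_right _).add_right (cF.smul_right _)).add_right (cH.smul_right _)).add_right
    (cH2.smul_right _)

theorem casimir_ρ (S : Supermodule k V) {x : Q2 k} (hx : x ∈ Q2.part k 0) (v : V) :
    S.casimir (S.ρ x v) = S.ρ x (S.casimir v) :=
  LinearMap.congr_fun (S.commute_casimir hx) v

theorem aeval_casimir_ρ (S : Supermodule k V) {x : Q2 k} (hx : x ∈ Q2.part k 0)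
    (g : Polynomial k) (v : V) :
    Polynomial.aeval S.casimir g (S.ρ x v) = S.ρ x (Polynomial.aeval S.casimir g v) := by
  have h : Commute (Polynomial.aeval S.casimir g) (S.ρ x) :=
    (Algebra.commute_of_mem_adjoin_singleton_of_commute
      (Polynomial.aeval_mem_adjoin_singleton k S.casimir) (S.commute_casimir hx).symm).symm
  exact LinearMap.congr_fun h v

/-- The formula for `F E` on vectors of weight `a`, if `H₁ + H₂` acts as `c`. -/
theorem ρ_F_E (S : Supermodule k V) [CharZero k] {c : k}
    (hc : ∀ v, S.ρ (Q2.H1 k) v + S.ρ (Q2.H2 k) v = c • v) {a : k} {v : V} (hv : v ∈ S.wt a) :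
    S.ρ (Q2.F k) (S.ρ (Q2.E k) v)
      = (4⁻¹ : k) • (S.casimir v - ((2 * a - c) ^ 2 + 2 * (2 * a - c)) • v) := by
  rw [mem_wt] at hv
  have h2 : S.ρ (Q2.H2 k) v = (c - a) • v := by
    rw [sub_smul, ← hc v, hv, add_sub_cancel_left]
  simp only [casimir, LinearMap.add_apply, LinearMap.smul_apply, Module.End.mul_apply,
    LinearMap.sub_apply, hv, h2, map_sub, map_smul]
  module

end Supermodule

namespace Supermodule

variable {k : Type u} [Field k] {V : Type v} [AddCommGroup V] [Module k V]

/-! ### Subspaces stable under the even part -/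

/-- Stability under the even part of `𝔮₂`. -/
def EvenStable (S : Supermodule k V) (K : Submodule k V) : Prop :=
  ∀ x ∈ Q2.part k 0, ∀ v ∈ K, S.ρ x v ∈ K

theorem EvenStable.of_basis {S : Supermodule k V} {K : Submodule k V}
    (hE : ∀ v ∈ K, S.ρ (Q2.E k) v ∈ K) (hF : ∀ v ∈ K, S.ρ (Q2.F k) v ∈ K)
    (hH1 : ∀ v ∈ K, S.ρ (Q2.H1 k) v ∈ K) (hH2 : ∀ v ∈ K, S.ρ (Q2.H2 k) v ∈ K) :
    S.EvenStable K := by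
  intro x hx v hv
  rw [Q2.eq_even x hx]
  simp only [map_add, map_smul, LinearMap.add_apply, LinearMap.smul_apply]
  exact add_mem (add_mem (add_mem (K.smul_mem _ (hE v hv)) (K.smul_mem _ (hF v hv)))
    (K.smul_mem _ (hH1 v hv))) (K.smul_mem _ (hH2 v hv))

theorem EvenStable.sup {S : Supermodule k V} {K L : Submodule k V} (hK : S.EvenStable K)
    (hL : S.EvenStable L) : S.EvenStable (K ⊔ L) := by
  intro x hx v hv
  obtain ⟨a, ha, b, hb, rfl⟩ := Submodule.mem_sup.1 hv
  rw [map_add]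
  exact Submodule.add_mem_sup (hK x hx a ha) (hL x hx b hb)

theorem EvenStable.act_mem {S : Supermodule k V} {K : Submodule k V} (hK : S.EvenStable K)
    {c : U k} (hc : c ∈ U.even k) {v : V} (hv : v ∈ K) : S.act c v ∈ K := by
  induction hc using Algebra.adjoin_induction generalizing v with
  | mem a ha =>
    obtain ⟨x, hx, rfl⟩ := ha
    rw [act_ι]; exact hK x hx v hv
  | algebraMap r => simpa [Module.algebraMap_end_apply] using K.smul_mem r hv
  | add a b _ _ ha hb => rw [map_add]; exact add_mem (ha hv) (hb hv)
  | mul a b _ _ ha hb => rw [map_mul]; exact ha (hb hv)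

theorem EvenStable.casimir_mem {S : Supermodule k V} {K : Submodule k V} (hK : S.EvenStable K)
    {v : V} (hv : v ∈ K) : S.casimir v ∈ K := by
  have hh : ∀ v ∈ K, S.ρ (Q2.H1 k) v - S.ρ (Q2.H2 k) v ∈ K := fun v hv =>
    sub_mem (hK _ Q2.H1_mem v hv) (hK _ Q2.H2_mem v hv)
  simp only [casimir, LinearMap.add_apply, LinearMap.smul_apply, Module.End.mul_apply,
    LinearMap.sub_apply]
  exact add_mem (nsmul_mem (hK _ (Q2.F_mem k) _ (hK _ Q2.E_mem v hv)) 4)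
    (add_mem (hh _ (hh v hv)) (nsmul_mem (hh v hv) 2))

theorem EvenStable.aeval_casimir_mem {S : Supermodule k V} {K : Submodule k V}
    (hK : S.EvenStable K) (g : Polynomial k) {v : V} (hv : v ∈ K) :
    Polynomial.aeval S.casimir g v ∈ K := by
  induction g using Polynomial.induction_on' generalizing v with
  | add p q hp hq => rw [map_add]; exact add_mem (hp hv) (hq hv)
  | monomial n a =>
    rw [Polynomial.aeval_monomial, Module.End.mul_apply, Module.algebraMap_end_apply]
    refine K.smul_mem _ ?_
    induction n with
    | zero => simpa using hv
    | succ n ih => rw [pow_succ', Module.End.mul_apply]; exact hK.casimir_mem ih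

theorem EvenStable.comap_aeval_casimir {S : Supermodule k V} {K : Submodule k V}
    (hK : S.EvenStable K) (g : Polynomial k) :
    S.EvenStable (K.comap (Polynomial.aeval S.casimir g)) := by
  intro x hx v hv
  rw [Submodule.mem_comap] at *
  rw [S.aeval_casimir_ρ hx]
  exact hK x hx _ hv

theorem exists_homogeneous_ne_zero (S : Supermodule k V) [Nontrivial V] :
    ∃ (i : ZMod 2) (v : V), v ∈ S.part i ∧ v ≠ 0 := by
  obtain ⟨v, hv⟩ := exists_ne (0 : V)
  obtain ⟨a, ha, b, hb, rfl⟩ := S.exists_parts v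
  by_cases h : a = 0
  · exact ⟨1, b, hb, fun h' => hv (by rw [h, h', add_zero])⟩
  · exact ⟨0, a, ha, h⟩

/-- Homogeneity of `v` is what makes `U(𝔮₂) v` graded: parity sends `c v` to a multiple of `U.parity
k c` applied to `v`. -/
theorem IsSimple.exists_act_eq [CharZero k] {S : Supermodule k V} (hS : S.IsSimple)
    {i : ZMod 2} {v : V} (hv : v ∈ S.part i) (h0 : v ≠ 0) (w : V) : ∃ c : U k, S.act c v = w := by
  let X : Submodule k V := LinearMap.range ((LinearMap.applyₗ v) ∘ₗ S.act.toLinearMap)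
  have hX : S.IsSub X := by
    refine S.isSub_iff.2 ⟨?_, ?_⟩
    · rintro _ ⟨c, rfl⟩
      refine ⟨psign k i • U.parity k c, ?_⟩
      have := S.parity_act c v
      rw [S.parity_of_mem hv, map_smul] at this
      simp [this]
    · rintro x _ ⟨c, rfl⟩
      exact ⟨U.ι k x * c, by simp [act_ι]⟩
  have htop := hS.eq_top hX (v := v) ⟨1, by simp⟩ h0
  have : w ∈ X := by rw [htop]; trivial
  obtain ⟨c, hc⟩ := this
  exact ⟨c, hc⟩

/-- A simple supermodule has a maximal proper subspace stable under the even part. -/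
theorem IsSimple.exists_maximal_evenStable [CharZero k] {S : Supermodule k V} (hS : S.IsSimple) :
    ∃ K : Submodule k V, K ≠ ⊤ ∧ S.EvenStable K ∧
      ∀ K', S.EvenStable K' → K ≤ K' → K' = K ∨ K' = ⊤ := by
  have := hS.1
  obtain ⟨i, v, hv, h0⟩ := S.exists_homogeneous_ne_zero
  let _ : Module (U k) V := Module.compHom V S.act.toRingHom
  have smul_def : ∀ (a : U.even k) (w : V), a • w = S.act (a : U k) w := fun _ _ => rfl
  -- `V = U(𝔮₂) v`, so the finitely many words of length at most four, applied to `v`, generate `V`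
  -- over `U.even k`. A nonzero finitely generated module has a maximal proper submodule.
  have hfg : (⊤ : Submodule (U.even k) V).FG := by
    let s : Set V := (fun l => S.act (U.word k l) v) '' {l : List (Fin 4) | l.length ≤ 4}
    have hs : s.Finite := (List.finite_length_le (Fin 4) 4).image _
    refine Submodule.fg_def.2 ⟨s, hs, eq_top_iff.2 fun w hw => ?_⟩
    clear hw
    obtain ⟨c, rfl⟩ := hS.exists_act_eq hv h0 w
    have hc : c ∈ U.filt k 4 := by rw [U.filt_four_eq_top]; trivial
    induction hc using Submodule.span_induction with
    | mem c hc =>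
      obtain ⟨a, ha, l, hl, rfl⟩ := hc
      rw [map_mul]
      exact Submodule.smul_mem _ (⟨a, ha⟩ : U.even k) (Submodule.subset_span ⟨l, hl, rfl⟩)
    | zero => simp
    | add c d _ _ hc hd => rw [map_add]; exact add_mem hc hd
    | smul r c _ hc =>
      have := Submodule.smul_mem _ (algebraMap k (U.even k) r) hc
      rw [smul_def] at this
      simpa [Module.algebraMap_end_apply] using this
  have : Module.Finite (U.even k) V := ⟨hfg⟩
  obtain ⟨M, hM⟩ := (eq_top_or_exists_le_coatom (⊥ : Submodule (U.even k) V)).resolve_left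
    bot_ne_top
  -- The two notions of subspace agree: scalars act through `U.even k`, and conversely stability
  -- under the even part gives stability under the algebra it generates.
  let toK : Submodule (U.even k) V → Submodule k V := fun K =>
    { K.toAddSubmonoid with
      smul_mem' := fun r w hw => by
        have := K.smul_mem (algebraMap k (U.even k) r) hw
        rw [smul_def] at this
        simpa [Module.algebraMap_end_apply] using this }
  refine ⟨toK M, ?_, ?_, ?_⟩
  · intro h
    refine hM.1.1 (eq_top_iff.2 fun w _ => ?_)
    have : w ∈ toK M := by rw [h]; trivial
    exact this
  · intro x hx w hw
    have := M.smul_mem (⟨U.ι k x, U.ι_mem_even hx⟩ : U.even k) hw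
    rwa [smul_def, act_ι] at this
  · intro K' hK' hle
    let M' : Submodule (U.even k) V :=
      { K'.toAddSubmonoid with smul_mem' := fun a w hw => hK'.act_mem a.2 hw }
    have hMM' : M ≤ M' := fun w hw => hle hw
    rcases hMM'.eq_or_lt with h | h
    · left
      ext w
      change w ∈ M' ↔ w ∈ M
      rw [h]
    · right
      have := hM.1.2 _ h
      refine eq_top_iff.2 fun w _ => ?_
      change w ∈ M'
      rw [this]; trivial

/-! ### Weight spaces modulo a maximal even-stable subspace -/

theorem pow_mem_wt (S : Supermodule k V) {x : Q2 k} {s a : k} {v : V}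
    (hx : Q2.sbracket (Q2.H1 k) x = s • x) (hv : v ∈ S.wt a) (n : ℕ) :
    (S.ρ x ^ n) v ∈ S.wt (a + n * s) := by
  induction n with
  | zero => simpa using hv
  | succ n ih =>
    rw [pow_succ', Module.End.mul_apply]
    have := S.ρ_mem_wt hx ih
    rwa [add_assoc, ← add_one_mul, ← Nat.cast_succ] at this

theorem ρ_H2_eq (S : Supermodule k V) {c : k}
    (hc : ∀ v, S.ρ (Q2.H1 k) v + S.ρ (Q2.H2 k) v = c • v) (v : V) :
    S.ρ (Q2.H2 k) v = c • v - S.ρ (Q2.H1 k) v := by rw [← hc, add_sub_cancel_left]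

/-- On each weight space `F E` is an affine function of the Casimir operator, which commutes with
`F`; the innermost `F E` can therefore be peeled off repeatedly. -/
theorem exists_pow_F_pow_E (S : Supermodule k V) [CharZero k] {c : k}
    (hc : ∀ v, S.ρ (Q2.H1 k) v + S.ρ (Q2.H2 k) v = c • v) {a : k} {v : V} (hv : v ∈ S.wt a)
    (n : ℕ) : ∃ g : Polynomial k,
      (S.ρ (Q2.F k) ^ n) ((S.ρ (Q2.E k) ^ n) v) = Polynomial.aeval S.casimir g v := by
  induction n with
  | zero => exact ⟨1, by simp⟩
  | succ n ih =>
    obtain ⟨g, hg⟩ := ih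
    have hw := S.pow_mem_wt Q2.sbracket_H1_E hv n
    set b := a + n * (1 : k)
    -- The new factor is the formula `ρ_F_E` at the weight `b = a + n` of `E^n v`.
    refine ⟨Polynomial.C (4⁻¹ : k) * (Polynomial.X
      - Polynomial.C ((2 * b - c) ^ 2 + 2 * (2 * b - c))) * g, ?_⟩
    have hcomm : ∀ w, S.casimir ((S.ρ (Q2.F k) ^ n) w) = (S.ρ (Q2.F k) ^ n) (S.casimir w) :=
      fun w => LinearMap.congr_fun ((S.commute_casimir (Q2.F_mem k)).pow_right n) w
    rw [pow_succ, pow_succ', Module.End.mul_apply, Module.End.mul_apply, S.ρ_F_E hc hw, map_smul,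
      map_sub, map_smul, ← hcomm, hg]
    generalize (2 * b - c) ^ 2 + 2 * (2 * b - c) = t
    simp [Module.algebraMap_end_apply]

section Maximal

variable [CharZero k] {S : Supermodule k V} {K : Submodule k V}

/-- Modulo `K` the vector `v` generates everything under `𝔤𝔩₂`, and the vectors `F^i E^j v` span
what it generates. Only those with `i = j` have weight `a`, and they are polynomials in the Casimir
operator applied to `v`. -/
theorem EvenStable.exists_aeval_sub_mem (hK : S.EvenStable K)
    (hmax : ∀ K', S.EvenStable K' → K ≤ K' → K' = K ∨ K' = ⊤) {c : k}
    (hc : ∀ v, S.ρ (Q2.H1 k) v + S.ρ (Q2.H2 k) v = c • v) {a : k} {v : V} (hv : v ∈ S.wt a)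
    (hvK : v ∉ K) {y : V} (hy : y ∈ S.wt a) :
    ∃ g : Polynomial k, y - Polynomial.aeval S.casimir g v ∈ K := by
  let R : Submodule k V :=
    LinearMap.range ((LinearMap.applyₗ v) ∘ₗ (Polynomial.aeval S.casimir).toLinearMap)
  let Y : Submodule k V := Submodule.span k
    {w | ∃ i j : ℕ, w = (S.ρ (Q2.F k) ^ i) ((S.ρ (Q2.E k) ^ j) v)}
  have hwt : ∀ i j : ℕ, (S.ρ (Q2.F k) ^ i) ((S.ρ (Q2.E k) ^ j) v) ∈ S.wt (a + j - i) := by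
    intro i j
    have := S.pow_mem_wt Q2.sbracket_H1_F (S.pow_mem_wt Q2.sbracket_H1_E hv j) i
    rwa [mul_one, mul_neg_one, ← sub_eq_add_neg] at this
  have hYgen : ∀ {T : Module.End k V},
      (∀ i j : ℕ, T ((S.ρ (Q2.F k) ^ i) ((S.ρ (Q2.E k) ^ j) v)) ∈ Y) → ∀ w ∈ Y, T w ∈ Y := by
    intro T hT w hw
    have : Y ≤ Y.comap T := by
      refine Submodule.span_le.2 ?_
      rintro _ ⟨i, j, rfl⟩
      exact hT i j
    exact this hw
  have hmem : ∀ i j : ℕ, (S.ρ (Q2.F k) ^ i) ((S.ρ (Q2.E k) ^ j) v) ∈ Y := fun i j =>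
    Submodule.subset_span ⟨i, j, rfl⟩
  have hH1 : ∀ w ∈ Y, S.ρ (Q2.H1 k) w ∈ Y := hYgen fun i j => by
    rw [S.mem_wt.1 (hwt i j)]; exact Y.smul_mem _ (hmem i j)
  have hH2 : ∀ w ∈ Y, S.ρ (Q2.H2 k) w ∈ Y := fun w hw => by
    rw [S.ρ_H2_eq hc]; exact sub_mem (Y.smul_mem _ hw) (hH1 w hw)
  have hF : ∀ w ∈ Y, S.ρ (Q2.F k) w ∈ Y := hYgen fun i j => by
    rw [← Module.End.mul_apply, ← pow_succ']; exact hmem (i + 1) j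
  have hE : ∀ w ∈ Y, S.ρ (Q2.E k) w ∈ Y := hYgen fun i j => by
    induction i with
    | zero =>
      have := hmem 0 (j + 1)
      rwa [pow_succ', Module.End.mul_apply] at this
    | succ i ih =>
      rw [pow_succ', Module.End.mul_apply, S.ρ_E_F]
      exact add_mem (hF _ ih) (sub_mem (hH1 _ (hmem i j)) (hH2 _ (hmem i j)))
  have hY : S.EvenStable Y := EvenStable.of_basis hE hF hH1 hH2
  have hvY : v ∈ Y := by simpa using hmem 0 0
  -- `K ⊔ Y` is stable under the even part and contains `v ∉ K`, so maximality makes it everything.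
  have htop : K ⊔ Y = ⊤ := (hmax _ (hK.sup hY) le_sup_left).resolve_left fun h =>
    hvK (h ▸ Submodule.mem_sup_right hvY)
  have hle : Y ≤ R ⊔ ⨆ b, ⨆ (_ : b ≠ a), Module.End.eigenspace (S.ρ (Q2.H1 k)) b := by
    refine Submodule.span_le.2 ?_
    rintro _ ⟨i, j, rfl⟩
    by_cases hij : i = j
    · subst hij
      obtain ⟨g, hg⟩ := S.exists_pow_F_pow_E hc hv i
      exact Submodule.mem_sup_left ⟨g, hg.symm⟩
    · refine Submodule.mem_sup_right (Submodule.mem_iSup_of_mem (a + j - i)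
        (Submodule.mem_iSup_of_mem ?_ (hwt i j)))
      intro h
      apply hij
      rw [add_sub_assoc, add_eq_left, sub_eq_zero] at h
      exact (Nat.cast_injective h).symm
  -- `K ⊔ R` is `H₁`-stable, so the components of weight different from `a` can be discarded.
  have hyKR : y ∈ K ⊔ R := by
    refine eigenspace_le_of_le_sup (f := S.ρ (Q2.H1 k)) ?_ (S.mem_wt.1 hy) (a := a) ?_
    · intro w hw
      obtain ⟨p, hp, _, ⟨g, rfl⟩, rfl⟩ := Submodule.mem_sup.1 hw
      rw [map_add]
      refine Submodule.add_mem_sup (hK _ Q2.H1_mem p hp) ⟨Polynomial.C a * g, ?_⟩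
      change Polynomial.aeval S.casimir (Polynomial.C a * g) v
        = S.ρ (Q2.H1 k) (Polynomial.aeval S.casimir g v)
      rw [← S.aeval_casimir_ρ Q2.H1_mem, S.mem_wt.1 hv, map_smul]
      simp [Module.algebraMap_end_apply]
    · have : y ∈ K ⊔ Y := by rw [htop]; trivial
      rw [sup_assoc]
      exact sup_le_sup_left hle K this
  obtain ⟨p, hp, _, ⟨g, rfl⟩, rfl⟩ := Submodule.mem_sup.1 hyKR
  exact ⟨g, by simpa using hp⟩

/-- Schur's lemma for the Casimir operator `C` on `V/K`. Some nonzero polynomial in `C` kills the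
class of a weight vector `v ∉ K`. It splits into linear factors `C - r`, and each of these is
injective or zero on `V/K`; if none were zero, `v` would lie in `K`. -/
theorem EvenStable.exists_casimir_sub_mem [IsAlgClosed k] (hK : S.EvenStable K) (hne : K ≠ ⊤)
    (hmax : ∀ K', S.EvenStable K' → K ≤ K' → K' = K ∨ K' = ⊤) {c : k}
    (hc : ∀ v, S.ρ (Q2.H1 k) v + S.ρ (Q2.H2 k) v = c • v) (hwt : ⨆ a, S.wt a = ⊤) :
    ∃ r : k, ∀ v, S.casimir v - r • v ∈ K := by
  obtain ⟨a, v, hv, hvK⟩ : ∃ (a : k) (v : V), v ∈ S.wt a ∧ v ∉ K := by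
    by_contra! h
    exact hne (eq_top_iff.2 (hwt ▸ iSup_le fun a v hv => h a v hv))
  -- The preimage of `K` under `g(C)` is stable under the even part and contains `K`, so it is `K`
  -- or everything.
  have hcomap : ∀ g : Polynomial k, (∀ w, Polynomial.aeval S.casimir g w ∈ K → w ∈ K) ∨
      ∀ w, Polynomial.aeval S.casimir g w ∈ K := by
    intro g
    rcases hmax _ (hK.comap_aeval_casimir g) (fun w hw => hK.aeval_casimir_mem g hw) with h | h
    · left
      intro w hw
      rw [← h]; exact hw
    · right
      intro w
      have : w ∈ K.comap (Polynomial.aeval S.casimir g) := by rw [h]; trivial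
      exact this
  -- If `C` maps `V` into `K`, take `f = X`. Otherwise `C` is onto modulo `K`, so `v ≡ C y` with `y`
  -- of the same weight, and `y ≡ g(C) v`; then `f = 1 - X g`, which is nonzero since its constant
  -- term is `1`.
  obtain ⟨f, hf0, hf⟩ : ∃ f : Polynomial k, f ≠ 0 ∧ Polynomial.aeval S.casimir f v ∈ K := by
    have hR : S.EvenStable (LinearMap.range S.casimir) := by
      rintro x hx _ ⟨w, rfl⟩
      exact ⟨S.ρ x w, S.casimir_ρ hx w⟩
    rcases hmax _ (hK.sup hR) le_sup_left with h | h
    · refine ⟨Polynomial.X, Polynomial.X_ne_zero, ?_⟩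
      rw [Polynomial.aeval_X, ← h]
      exact Submodule.mem_sup_right ⟨v, rfl⟩
    · have hle : LinearMap.range S.casimir ≤ (S.wt a).map S.casimir
          ⊔ ⨆ b, ⨆ (_ : b ≠ a), Module.End.eigenspace (S.ρ (Q2.H1 k)) b := by
        rw [LinearMap.range_eq_map, ← hwt, Submodule.map_iSup]
        refine iSup_le fun b => ?_
        by_cases hb : b = a
        · subst hb; exact le_sup_left
        · refine le_trans ?_ le_sup_right
          refine le_trans ?_ (le_iSup_of_le b (le_iSup_of_le hb le_rfl))
          rintro _ ⟨w, hw, rfl⟩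
          rw [Module.End.mem_eigenspace_iff, ← S.casimir_ρ Q2.H1_mem, S.mem_wt.1 hw, map_smul]
      have hv' : v ∈ K ⊔ (S.wt a).map S.casimir := by
        refine eigenspace_le_of_le_sup (f := S.ρ (Q2.H1 k)) ?_ (S.mem_wt.1 hv) (a := a) ?_
        · intro w hw
          obtain ⟨p, hp, _, ⟨g, hg, rfl⟩, rfl⟩ := Submodule.mem_sup.1 hw
          rw [map_add]
          refine Submodule.add_mem_sup (hK _ Q2.H1_mem p hp) ⟨a • g, (S.wt a).smul_mem _ hg, ?_⟩
          rw [← S.casimir_ρ Q2.H1_mem, S.mem_wt.1 hg]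
        · have : v ∈ K ⊔ LinearMap.range S.casimir := by rw [h]; trivial
          rw [sup_assoc]
          exact sup_le_sup_left hle K this
      obtain ⟨p, hp, _, ⟨y, hy, rfl⟩, hpy⟩ := Submodule.mem_sup.1 hv'
      obtain ⟨g, hg⟩ := hK.exists_aeval_sub_mem hmax hc hv hvK hy
      refine ⟨1 - Polynomial.X * g, fun h0 => ?_, ?_⟩
      · have := congrArg (Polynomial.eval 0) h0
        simp at this
      · have h1 := add_mem hp (hK.casimir_mem hg)
        have e : p + S.casimir (y - Polynomial.aeval S.casimir g v)
            = Polynomial.aeval S.casimir (1 - Polynomial.X * g) v := by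
          rw [map_sub, ← add_sub_assoc, hpy]; simp
        rwa [e] at h1
  by_contra! hr
  have hinj : ∀ (r : k) (w : V), S.casimir w - r • w ∈ K → w ∈ K := by
    intro r w hw
    have e : ∀ w, Polynomial.aeval S.casimir (Polynomial.X - Polynomial.C r) w
        = S.casimir w - r • w := fun w => by simp [Module.algebraMap_end_apply]
    rcases hcomap (Polynomial.X - Polynomial.C r) with h | h
    · exact h w (by rwa [e])
    · obtain ⟨w', hw'⟩ := hr r
      exact absurd (by rw [← e]; exact h w') hw'
  have key : ∀ (n : ℕ) (f : Polynomial k), f ≠ 0 → f.natDegree = n → ∀ w,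
      Polynomial.aeval S.casimir f w ∈ K → w ∈ K := by
    intro n
    induction n with
    | zero =>
      intro f hf0 hf w hw
      rw [Polynomial.eq_C_of_natDegree_eq_zero hf] at hw hf0
      simp only [Polynomial.aeval_C, Module.algebraMap_end_apply] at hw
      exact (K.smul_mem_iff (by simpa using hf0)).1 hw
    | succ n ih =>
      intro f hf0 hf w hw
      obtain ⟨r, hr⟩ := IsAlgClosed.exists_root f (by
        rw [Polynomial.degree_eq_natDegree hf0, hf]
        exact_mod_cast n.succ_ne_zero)
      obtain ⟨g, rfl⟩ := Polynomial.dvd_iff_isRoot.2 hr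
      have hg0 : g ≠ 0 := right_ne_zero_of_mul hf0
      rw [Polynomial.natDegree_mul (Polynomial.X_sub_C_ne_zero r) hg0,
        Polynomial.natDegree_X_sub_C] at hf
      refine ih g hg0 (by omega) w (hinj r _ ?_)
      simpa [Module.algebraMap_end_apply] using hw
  exact hvK (key _ f hf0 rfl v hf)

/-- The weight spaces of `V/K` have dimension at most one, expressed without the quotient: if `v ∉
K` has weight `a`, each `y` of weight `a` satisfies `y ≡ g(C) v ≡ g(r) v`, where `C ≡ r` is the
Casimir operator. -/
theorem EvenStable.exists_functional [IsAlgClosed k] (hK : S.EvenStable K) (hne : K ≠ ⊤)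
    (hmax : ∀ K', S.EvenStable K' → K ≤ K' → K' = K ∨ K' = ⊤) {c : k}
    (hc : ∀ v, S.ρ (Q2.H1 k) v + S.ρ (Q2.H2 k) v = c • v) (hwt : ⨆ a, S.wt a = ⊤) (a : k) :
    ∃ φ : V →ₗ[k] k, ∀ y ∈ S.wt a, φ y = 0 → y ∈ K := by
  by_cases h : ∀ y ∈ S.wt a, y ∈ K
  · exact ⟨0, fun y hy _ => h y hy⟩
  push Not at h
  obtain ⟨v, hv, hvK⟩ := h
  obtain ⟨r, hr⟩ := hK.exists_casimir_sub_mem hne hmax hc hwt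
  obtain ⟨φ, hφv, hφK⟩ := Submodule.exists_le_ker_of_notMem hvK
  refine ⟨φ, fun y hy hφy => ?_⟩
  obtain ⟨g, hg⟩ := hK.exists_aeval_sub_mem hmax hc hv hvK hy
  -- `X - r` divides `g - g(r)`, and `C - r` maps `V` into `K`.
  have hg' : Polynomial.aeval S.casimir g v - g.eval r • v ∈ K := by
    obtain ⟨q, hq⟩ := Polynomial.X_sub_C_dvd_sub_C_eval (a := r) (p := g)
    have e := LinearMap.congr_fun (congrArg (Polynomial.aeval S.casimir) hq) v
    simp only [map_sub, map_mul, Polynomial.aeval_C, Polynomial.aeval_X, LinearMap.sub_apply,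
      Module.algebraMap_end_apply, Module.End.mul_apply] at e
    rw [e]
    exact hr _
  have h1 : y - g.eval r • v ∈ K := by simpa using add_mem hg hg'
  have h2 := hφK h1
  rw [LinearMap.mem_ker, map_sub, hφy, map_smul, zero_sub, neg_eq_zero, smul_eq_mul,
    mul_eq_zero] at h2
  rw [h2.resolve_right hφv, zero_smul, sub_zero] at h1
  exact h1

end Maximal

/-! ### Finite-dimensionality of the weight spaces -/

/-- The weight spaces of a simple weight supermodule are finite-dimensional. -/
theorem IsSimple.finiteDimensional_wt [CharZero k] [IsAlgClosed k] {S : Supermodule k V}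
    (hS : S.IsSimple) {c : k} (hc : ∀ v, S.ρ (Q2.H1 k) v + S.ρ (Q2.H2 k) v = c • v)
    (hwt : ⨆ a, S.wt a = ⊤) (a : k) : FiniteDimensional k (S.wt a) := by
  obtain ⟨K, hne, hK, hmax⟩ := hS.exists_maximal_evenStable
  choose φ hφ using hK.exists_functional hne hmax hc hwt
  -- The letters are weight vectors, so a word maps `S.wt a` into a single weight space, where one
  -- functional `φ` detects membership in `K`.
  have hword : ∀ l : List (Fin 4), ∃ s : k, ∀ v ∈ S.wt a, S.act (U.word k l) v ∈ S.wt s := by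
    intro l
    induction l with
    | nil => exact ⟨a, fun v hv => by simpa [U.word] using hv⟩
    | cons i l ih =>
      obtain ⟨s, hs⟩ := ih
      obtain ⟨t, ht⟩ := Q2.exists_weight_oddBasis (k := k) i
      refine ⟨s + t, fun v hv => ?_⟩
      rw [U.word_cons, map_mul, act_ι]
      exact S.ρ_mem_wt ht (hs v hv)
  choose s hs using hword
  -- The largest subsupermodule contained in `K`; the second condition makes it stable under parity.
  -- It is zero by simplicity.
  let Z : Submodule k V :=
    { carrier := {v | ∀ d : U k, S.act d v ∈ K ∧ S.act d (S.parity v) ∈ K}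
      add_mem' := fun {v w} hv hw d => by
        simp only [map_add]
        exact ⟨add_mem (hv d).1 (hw d).1, add_mem (hv d).2 (hw d).2⟩
      zero_mem' := fun d => by simp
      smul_mem' := fun r v hv d => by
        simp only [map_smul]
        exact ⟨K.smul_mem _ (hv d).1, K.smul_mem _ (hv d).2⟩ }
  have hZ : S.IsSub Z := by
    refine S.isSub_iff.2 ⟨fun v hv d => ⟨(hv d).2, ?_⟩, fun x v hv d => ⟨?_, ?_⟩⟩
    · rw [S.parity_parity]; exact (hv d).1
    · have := (hv (d * U.ι k x)).1
      rwa [map_mul, act_ι] at this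
    · have := (hv (d * U.ι k (Q2.parity k x))).2
      rwa [map_mul, act_ι, Module.End.mul_apply, ← S.parity_ρ] at this
  have hZbot : Z = ⊥ := (hS.2 Z hZ).resolve_right fun h => hne (eq_top_iff.2 fun v _ => by
    have : v ∈ Z := by rw [h]; trivial
    simpa using (this 1).1)
  -- `K` is stable under `U.even k`, so membership in `Z` need only be tested on the words of length
  -- at most four.
  have hmem : ∀ v : V, (∀ l : List (Fin 4), l.length ≤ 4 → S.act (U.word k l) v ∈ K) →
      ∀ d : U k, S.act d v ∈ K := by
    intro v hv d
    have hd : d ∈ U.filt k 4 := by rw [U.filt_four_eq_top]; trivial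
    induction hd using Submodule.span_induction with
    | mem d hd =>
      obtain ⟨b, hb, l, hl, rfl⟩ := hd
      rw [map_mul]
      exact hK.act_mem hb (hv l hl)
    | zero => simp
    | add b d _ _ hb hd => rw [map_add]; exact add_mem hb hd
    | smul r d _ hd => rw [map_smul]; exact K.smul_mem _ hd
  have hpar : ∀ v ∈ S.wt a, S.parity v ∈ S.wt a := fun v hv => by
    rw [mem_wt] at *
    rw [← S.parity_ρ_even Q2.H1_mem, hv, map_smul]
  have : Finite {l : List (Fin 4) // l.length ≤ 4} := (List.finite_length_le (Fin 4) 4).to_subtype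
  -- Finitely many linear forms whose common kernel on `S.wt a` lies in `Z = ⊥`.
  let Φ : V →ₗ[k] ({l : List (Fin 4) // l.length ≤ 4} → k) ×
      ({l : List (Fin 4) // l.length ≤ 4} → k) :=
    LinearMap.prod (LinearMap.pi fun l => φ (s l) ∘ₗ S.act (U.word k l))
      (LinearMap.pi fun l => φ (s l) ∘ₗ S.act (U.word k l) ∘ₗ S.parity)
  refine FiniteDimensional.of_injective (Φ ∘ₗ (S.wt a).subtype)
    (LinearMap.ker_eq_bot.1 (LinearMap.ker_eq_bot'.2 ?_))
  rintro ⟨v, hv⟩ h0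
  have h1 : ∀ l : List (Fin 4), l.length ≤ 4 → φ (s l) (S.act (U.word k l) v) = 0 :=
    fun l hl => congrFun (congrArg Prod.fst h0) ⟨l, hl⟩
  have h2 : ∀ l : List (Fin 4), l.length ≤ 4 → φ (s l) (S.act (U.word k l) (S.parity v)) = 0 :=
    fun l hl => congrFun (congrArg Prod.snd h0) ⟨l, hl⟩
  have hvZ : v ∈ Z := fun d =>
    ⟨hmem v (fun l hl => hφ _ _ (hs l v hv) (h1 l hl)) d,
      hmem _ (fun l hl => hφ _ _ (hs l _ (hpar v hv)) (h2 l hl)) d⟩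
  rw [hZbot, Submodule.mem_bot] at hvZ
  exact Subtype.ext hvZ

end Supermodule

namespace Supermodule

variable {k : Type u} [Field k] {V : Type v} [AddCommGroup V] [Module k V]
  {W : Type w} [AddCommGroup W] [Module k W]

/-! ### Restriction to a subsupermodule -/

/-- A subsupermodule as a supermodule. -/
def restrict (S : Supermodule k V) (L : Submodule k V) (hL : S.IsSub L) : Supermodule k L where
  part i := (S.part i).comap L.subtype
  isCompl := by
    constructor
    · rw [Submodule.disjoint_def]
      intro v h0 h1
      exact Subtype.ext (Submodule.disjoint_def.1 S.isCompl.disjoint v h0 h1)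
    · rw [codisjoint_iff, eq_top_iff]
      rintro ⟨v, hv⟩ -
      have hv' := hv
      rw [hL.1] at hv'
      obtain ⟨a, ha, b, hb, hab⟩ := Submodule.mem_sup.1 hv'
      have e : (⟨v, hv⟩ : L) = ⟨a, ha.1⟩ + ⟨b, hb.1⟩ := Subtype.ext hab.symm
      rw [e]
      exact Submodule.add_mem_sup ha.2 hb.2
  ρ :=
    { toFun := fun x => (S.ρ x).restrict (hL.2 x)
      map_add' := fun x y => by ext v; simp
      map_smul' := fun r x => by ext v; simp }
  ρ_mem hx hv := S.ρ_mem hx hv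
  ρ_sbracket hx hy := by
    ext v
    have := LinearMap.congr_fun (S.ρ_sbracket hx hy) v
    simpa using this

theorem coe_restrict_ρ (S : Supermodule k V) {L : Submodule k V} (hL : S.IsSub L) (x : Q2 k)
    (v : L) : ((S.restrict L hL).ρ x v : V) = S.ρ x v := rfl

theorem coe_restrict_act (S : Supermodule k V) {L : Submodule k V} (hL : S.IsSub L) (c : U k)
    (v : L) : ((S.restrict L hL).act c v : V) = S.act c v := by
  induction c using U.induction generalizing v with
  | hs c => simp [Module.algebraMap_end_apply]
  | hι x => rw [act_ι, act_ι, coe_restrict_ρ]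
  | hadd a b ha hb => simp [ha, hb]
  | hmul a b ha hb => simp [ha, hb]

theorem restrict_isSimple (S : Supermodule k V) {L : Submodule k V} (hL : S.IsSub L)
    (h0 : L ≠ ⊥) (hmin : ∀ X, S.IsSub X → X ≤ L → X = ⊥ ∨ X = L) :
    (S.restrict L hL).IsSimple := by
  refine ⟨Submodule.nontrivial_iff_ne_bot.2 h0, fun X hX => ?_⟩
  have hsub : S.IsSub (X.map L.subtype) := by
    refine ⟨le_antisymm ?_ (sup_le inf_le_left inf_le_left), ?_⟩
    · rintro _ ⟨v, hv, rfl⟩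
      have hv' : v ∈ X := hv
      rw [hX.1] at hv'
      obtain ⟨a, ha, b, hb, rfl⟩ := Submodule.mem_sup.1 hv'
      rw [map_add]
      exact Submodule.add_mem_sup ⟨⟨a, ha.1, rfl⟩, ha.2⟩ ⟨⟨b, hb.1, rfl⟩, hb.2⟩
    · rintro x _ ⟨v, hv, rfl⟩
      exact ⟨_, hX.2 x v hv, rfl⟩
  rcases hmin _ hsub (Submodule.map_subtype_le L X) with h | h
  · left
    exact (Submodule.eq_bot_iff _).2 fun v hv => Subtype.ext
      ((Submodule.eq_bot_iff _).1 h _ ⟨v, hv, rfl⟩)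
  · right
    refine eq_top_iff.2 fun v _ => ?_
    have hv : (v : V) ∈ X.map L.subtype := by rw [h]; exact v.2
    obtain ⟨w, hw, hwv⟩ := hv
    rwa [← Subtype.ext hwv]

/-! ### Isomorphisms -/

theorem Iso.isSimple [CharZero k] {S : Supermodule k V} {T : Supermodule k W} (h : S.Iso T)
    (hS : S.IsSimple) : T.IsSimple := by
  obtain ⟨e, hpart, hρ⟩ := h
  have hpar : ∀ v, e (S.parity v) = T.parity (e v) := by
    intro v
    obtain ⟨a, ha, b, hb, rfl⟩ := S.exists_parts v
    simp only [map_add, S.parity_of_mem ha, S.parity_of_mem hb, T.parity_of_mem (hpart _ a ha),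
      T.parity_of_mem (hpart _ b hb), map_smul]
  have := hS.1
  refine ⟨e.symm.toEquiv.nontrivial, fun X hX => ?_⟩
  have hsub : S.IsSub (X.comap (e : V →ₗ[k] W)) := by
    refine S.isSub_iff.2 ⟨fun v hv => ?_, fun x v hv => ?_⟩
    · change e (S.parity v) ∈ X
      rw [hpar]; exact hX.parity_mem hv
    · change e (S.ρ x v) ∈ X
      rw [hρ]; exact hX.2 x _ hv
  rcases hS.2 _ hsub with h | h
  · left
    refine (Submodule.eq_bot_iff _).2 fun w hw => ?_
    have : e.symm w ∈ X.comap (e : V →ₗ[k] W) := by simpa using hw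
    rw [h, Submodule.mem_bot] at this
    simpa using this
  · right
    refine eq_top_iff.2 fun w _ => ?_
    have : e.symm w ∈ X.comap (e : V →ₗ[k] W) := by rw [h]; trivial
    simpa using this

/-! ### Simple subsupermodules of the `E`-nilpotent part -/

/-- In a nonzero subsupermodule of the `E`-nilpotent part there is a vector killed by `E`. -/
theorem exists_ker_E (S : Supermodule k V) {K : Submodule k V} (hK : S.IsSub K) (h0 : K ≠ ⊥)
    (hle : K ≤ S.nilPart (Q2.E k)) : ∃ v ∈ K, v ≠ 0 ∧ S.ρ (Q2.E k) v = 0 := by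
  obtain ⟨v, hv, hv0⟩ := (Submodule.ne_bot_iff _).1 h0
  obtain ⟨n, hn⟩ := S.mem_nilPart.1 (hle hv)
  induction n generalizing v with
  | zero => exact absurd (by simpa using hn) hv0
  | succ n ih =>
    by_cases hz : S.ρ (Q2.E k) v = 0
    · exact ⟨v, hv, hv0, hz⟩
    · exact ih _ (hK.2 _ v hv) hz (by rwa [pow_succ, Module.End.mul_apply] at hn)

/-- Every nonzero subsupermodule of the `E`-nilpotent part meets the finite-dimensional space `ker
E`. Choose `K` with `K ∩ ker E` of least dimension and let `L` be generated by this intersection: a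
nonzero `X ≤ L` has the same intersection with `ker E`, so it contains the generators of `L`. -/
theorem exists_simple_sub [CharZero k] (S : Supermodule k V)
    (hfin : FiniteDimensional k (LinearMap.ker (S.ρ (Q2.E k))))
    (hne : S.nilPart (Q2.E k) ≠ ⊥) :
    ∃ L : Submodule k V, S.IsSub L ∧ L ≠ ⊥ ∧ L ≤ S.nilPart (Q2.E k) ∧
      ∀ X, S.IsSub X → X ≤ L → X = ⊥ ∨ X = L := by
  set A := LinearMap.ker (S.ρ (Q2.E k)) with hA
  have hfinA : ∀ K : Submodule k V, FiniteDimensional k ↥(K ⊓ A) := fun K =>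
    Submodule.finiteDimensional_of_le inf_le_right
  have hinf : ∀ K, S.IsSub K → K ≠ ⊥ → K ≤ S.nilPart (Q2.E k) → K ⊓ A ≠ ⊥ := by
    intro K hK h0 hle
    obtain ⟨v, hv, hv0, hEv⟩ := S.exists_ker_E hK h0 hle
    exact (Submodule.ne_bot_iff _).2 ⟨v, ⟨hv, hEv⟩, hv0⟩
  have hex : ∃ n : ℕ, ∃ K, S.IsSub K ∧ K ≠ ⊥ ∧ K ≤ S.nilPart (Q2.E k) ∧
      Module.finrank k ↥(K ⊓ A) = n := ⟨_, _, S.isSub_nilPart_E, hne, le_rfl, rfl⟩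
  classical
  obtain ⟨K, hK, hK0, hKle, hKn⟩ := Nat.find_spec hex
  let L : Submodule k V := sInf {X | S.IsSub X ∧ K ⊓ A ≤ X}
  have hL : S.IsSub L := S.isSub_sInf fun X hX => hX.1
  have hLK : L ≤ K := sInf_le ⟨hK, inf_le_left⟩
  have hKL : K ⊓ A ≤ L := le_sInf fun X hX => hX.2
  refine ⟨L, hL, fun h => hinf K hK hK0 hKle (eq_bot_iff.2 (h ▸ hKL)), hLK.trans hKle, ?_⟩
  intro X hX hXL
  by_cases hX0 : X = ⊥
  · exact Or.inl hX0
  · right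
    refine le_antisymm hXL (sInf_le ⟨hX, ?_⟩)
    have hXn := Nat.find_min' hex ⟨X, hX, hX0, (hXL.trans hLK).trans hKle, rfl⟩
    have := hfinA K
    have e : X ⊓ A = K ⊓ A :=
      Submodule.eq_of_le_of_finrank_le (inf_le_inf_right A (hXL.trans hLK)) (by rwa [hKn])
    rw [← e]; exact inf_le_left

/-! ### Weights of a simple weight supermodule -/

theorem IsWeight.iSup_wt {S : Supermodule k V} (h : S.IsWeight) : ⨆ a, S.wt a = ⊤ := by
  rw [eq_top_iff, ← h.2]
  exact iSup_le fun μ => le_iSup_of_le μ.1 fun v hv => S.mem_wt.2 (S.mem_weightSpace.1 hv).1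

theorem IsWeight.exists_weight_vector {S : Supermodule k V} (h : S.IsWeight) [Nontrivial V] :
    ∃ μ : k × k, ∃ v ∈ S.weightSpace μ, v ≠ 0 := by
  by_contra! H
  have : (⊤ : Submodule k V) = ⊥ := by
    rw [← h.2, eq_bot_iff]
    exact iSup_le fun μ v hv => H μ v hv
  exact top_ne_bot this

/-- All weights of a simple supermodule lie in one coset of `ℤ`. -/
theorem IsSimple.iSup_wt_int [CharZero k] {S : Supermodule k V} (hS : S.IsSimple) {a : k} {v : V}
    (hv : v ∈ S.wt a) (h0 : v ≠ 0) : ⨆ j : ℤ, S.wt (a + j) = ⊤ := by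
  have hgen : ∀ {x : Q2 k} {s : ℤ}, Q2.sbracket (Q2.H1 k) x = (s : k) • x →
      ∀ w ∈ ⨆ j : ℤ, S.wt (a + j), S.ρ x w ∈ ⨆ j : ℤ, S.wt (a + j) := by
    intro x s hx w hw
    have : ⨆ j : ℤ, S.wt (a + j) ≤ (⨆ j : ℤ, S.wt (a + j)).comap (S.ρ x) := by
      refine iSup_le fun j w hw => Submodule.mem_iSup_of_mem (j + s) ?_
      have := S.ρ_mem_wt hx hw
      rwa [add_assoc, ← Int.cast_add] at this
    exact this hw
  refine hS.eq_top (S.isSub_iff.2 ⟨fun w hw => ?_, fun x w hw => ?_⟩)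
    (Submodule.mem_iSup_of_mem 0 (by simpa using hv)) h0
  · have : ⨆ j : ℤ, S.wt (a + j) ≤ (⨆ j : ℤ, S.wt (a + j)).comap S.parity := by
      refine iSup_le fun j w hw => Submodule.mem_iSup_of_mem j ?_
      rw [mem_wt] at *
      rw [← S.parity_ρ_even Q2.H1_mem, hw, map_smul]
    exact this hw
  · obtain ⟨y, hy, z, hz, rfl⟩ := Q2.eq_even_add_odd x
    rw [Q2.eq_even y hy, Q2.eq_odd z hz]
    simp only [map_add, map_smul, LinearMap.add_apply, LinearMap.smul_apply]
    have g := fun (r : k) {x : Q2 k} {s : ℤ} (hx : Q2.sbracket (Q2.H1 k) x = (s : k) • x) =>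
      Submodule.smul_mem _ r (hgen hx w hw)
    exact add_mem
      (add_mem (add_mem (add_mem (g _ (s := 1) (by simpa using Q2.sbracket_H1_E (k := k)))
        (g _ (s := -1) (by simpa using Q2.sbracket_H1_F (k := k))))
        (g _ (s := 0) (by simpa using Q2.sbracket_H1_H1 (k := k))))
        (g _ (s := 0) (by simpa using Q2.sbracket_H1_H2 (k := k))))
      (add_mem (add_mem (add_mem (g _ (s := 1) (by simpa using Q2.sbracket_H1_Ebar (k := k)))
        (g _ (s := -1) (by simpa using Q2.sbracket_H1_Fbar (k := k))))
        (g _ (s := 0) (by simpa using Q2.sbracket_H1_H1bar (k := k))))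
        (g _ (s := 0) (by simpa using Q2.sbracket_H1_H2bar (k := k))))

/-! ### Consequences of the injectivity of `E` and `F` -/

/-- If `E` and `F` are injective and the weight spaces are finite-dimensional, then `F` is
surjective. -/
theorem surjective_F (S : Supermodule k V) (hwt : ⨆ a, S.wt a = ⊤)
    (hfin : ∀ a, FiniteDimensional k (S.wt a))
    (hE : Function.Injective (S.ρ (Q2.E k))) (hF : Function.Injective (S.ρ (Q2.F k))) :
    Function.Surjective (S.ρ (Q2.F k)) := by
  rw [← LinearMap.range_eq_top, eq_top_iff, ← hwt]
  refine iSup_le fun a => ?_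
  have h1 : ∀ v ∈ S.wt a, S.ρ (Q2.E k) v ∈ S.wt (a + 1) := fun v hv =>
    S.ρ_mem_wt Q2.sbracket_H1_E hv
  have h2 : ∀ v ∈ S.wt (a + 1), S.ρ (Q2.F k) v ∈ S.wt a := fun v hv => by
    have := S.ρ_mem_wt Q2.sbracket_H1_F hv
    rwa [add_neg_cancel_right] at this
  -- `E` bounds the dimension of `S.wt a` by that of `S.wt (a + 1)`, and `F` gives the opposite
  -- bound; so `F` is an isomorphism between them.
  have hle : Module.finrank k (S.wt a) ≤ Module.finrank k (S.wt (a + 1)) :=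
    LinearMap.finrank_le_finrank_of_injective (f := (S.ρ (Q2.E k)).restrict h1)
      fun v w h => Subtype.ext (hE (congrArg Subtype.val h))
  have hinj : Function.Injective ((S.ρ (Q2.F k)).restrict h2) :=
    fun v w h => Subtype.ext (hF (congrArg Subtype.val h))
  have heq := le_antisymm (LinearMap.finrank_le_finrank_of_injective hinj) hle
  have hsurj := (LinearMap.injective_iff_surjective_of_finrank_eq_finrank heq).1 hinj
  intro v hv
  obtain ⟨w, hw⟩ := hsurj ⟨v, hv⟩
  exact ⟨w, congrArg Subtype.val hw⟩

theorem coe_aeval_restrict {f : Module.End k V} {p : Submodule k V} (h : ∀ x ∈ p, f x ∈ p)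
    (g : Polynomial k) (v : p) :
    (Polynomial.aeval (f.restrict h) g v : V) = Polynomial.aeval f g (v : V) := by
  induction g using Polynomial.induction_on' generalizing v with
  | add p q hp hq => simp [hp, hq]
  | monomial n a =>
    simp only [Polynomial.aeval_monomial, Module.End.mul_apply, Module.algebraMap_end_apply,
      Submodule.coe_smul]
    congr 1
    induction n generalizing v with
    | zero => simp
    | succ n ih => rw [pow_succ, pow_succ, Module.End.mul_apply, Module.End.mul_apply, ih]; rfl

/-- If `E` and `F` are injective, the Casimir operator is algebraic. -/
theorem IsSimple.exists_aeval_casimir_eq_zero [CharZero k] {S : Supermodule k V}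
    (hS : S.IsSimple) (hfin : ∀ a, FiniteDimensional k (S.wt a)) {a : k} {v : V}
    (hv : v ∈ S.wt a) (h0 : v ≠ 0)
    (hE : Function.Injective (S.ρ (Q2.E k))) (hF : Function.Injective (S.ρ (Q2.F k))) :
    ∃ p : Polynomial k, p ≠ 0 ∧ ∀ w, Polynomial.aeval S.casimir p w = 0 := by
  have hC : ∀ w ∈ S.wt a, S.casimir w ∈ S.wt a := fun w hw => by
    rw [mem_wt] at *
    rw [← S.casimir_ρ Q2.H1_mem, hw, map_smul]
  have := hfin a
  -- By Cayley–Hamilton `p` annihilates the Casimir operator on one weight space. A power of `F` or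
  -- `E` carries each weight `a + j` to `a`; being injective and commuting with the Casimir
  -- operator, it propagates the annihilation.
  let p := (S.casimir.restrict hC).charpoly
  have hp : ∀ w ∈ S.wt a, Polynomial.aeval S.casimir p w = 0 := fun w hw => by
    have := coe_aeval_restrict hC p ⟨w, hw⟩
    rw [LinearMap.aeval_self_charpoly] at this
    simpa using this.symm
  refine ⟨p, (LinearMap.charpoly_monic _).ne_zero, fun w => ?_⟩
  have hpow : ∀ {x : Q2 k}, x ∈ Q2.part k 0 → Function.Injective (S.ρ x) →
      ∀ (n : ℕ) (w : V), Polynomial.aeval S.casimir p ((S.ρ x ^ n) w) = 0 →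
        Polynomial.aeval S.casimir p w = 0 := by
    intro x hx hinj n
    induction n with
    | zero => intro w hw; simpa using hw
    | succ n ih =>
      intro w hw
      rw [pow_succ', Module.End.mul_apply, S.aeval_casimir_ρ hx] at hw
      exact ih w (hinj (by rw [hw, map_zero]))
  have hle : ⨆ j : ℤ, S.wt (a + j) ≤ LinearMap.ker (Polynomial.aeval S.casimir p) := by
    refine iSup_le fun j w hw => ?_
    obtain ⟨n, rfl | rfl⟩ := j.eq_nat_or_neg
    · refine hpow (Q2.F_mem k) hF n w (hp _ ?_)
      have := S.pow_mem_wt Q2.sbracket_H1_F hw n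
      simpa using this
    · refine hpow Q2.E_mem hE n w (hp _ ?_)
      have := S.pow_mem_wt Q2.sbracket_H1_E hw n
      simpa using this
  rw [hS.iSup_wt_int hv h0] at hle
  exact hle (Submodule.mem_top (x := w))

end Supermodule

namespace Supermodule

variable {k : Type u} [Field k] {V : Type v} [AddCommGroup V] [Module k V]

/-! ### Fractions in `U' ⊗ L` -/

/-- In `F^(-n) b ⊗ m` the numerator `b` moves across the tensor sign, and two fractions are added
over a common denominator using `F^(-n) ⊗ m = F^(-(n+r)) ⊗ F^r m`. -/
theorem exists_tmul_eq (T : Supermodule k V) (t : T.LocTensor) :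
    ∃ (n : ℕ) (m : V), t = T.tmul ((U'.F k ^ n)⁻¹ : (U' k)ˣ).val m := by
  induction t using locTensor_induction with
  | h0 => exact ⟨0, 0, by simp [tmul]⟩
  | ht a m =>
    obtain ⟨n, b, rfl⟩ := U'.exists_eq a
    exact ⟨n, T.act b m, T.tmul_act _ b m⟩
  | hadd s t hs ht =>
    obtain ⟨n, m, rfl⟩ := hs
    obtain ⟨r, w, rfl⟩ := ht
    have key : ∀ (n r : ℕ) (m : V), T.tmul ((U'.F k ^ n)⁻¹ : (U' k)ˣ).val m
        = T.tmul ((U'.F k ^ (n + r))⁻¹ : (U' k)ˣ).val (T.act (U.ι k (Q2.F k) ^ r) m) := by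
      intro n r m
      rw [← T.tmul_act]
      congr 1
      have e : U'.of k (U.ι k (Q2.F k) ^ r) = ((U'.F k ^ r : (U' k)ˣ) : U' k) := by
        rw [map_pow, Units.val_pow_eq_pow_val, U'.F_val]; rfl
      rw [e, ← Units.val_mul]
      congr 1
      group
    refine ⟨n + r, T.act (U.ι k (Q2.F k) ^ r) m + T.act (U.ι k (Q2.F k) ^ n) w, ?_⟩
    rw [tmul_add_right, ← key n r m, add_comm n r, ← key r n w]

/-! ### The action of `U'` when `F` is bijective -/

/-- `F` as a unit of the operators, if it is bijective. -/
def unitF (S : Supermodule k V) (hF : Function.Bijective (S.ρ (Q2.F k))) : (Module.End k V)ˣ where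
  val := S.ρ (Q2.F k)
  inv := (LinearEquiv.ofBijective _ hF).symm
  val_inv := LinearMap.ext fun v => (LinearEquiv.ofBijective _ hF).apply_symm_apply v
  inv_val := LinearMap.ext fun v => (LinearEquiv.ofBijective _ hF).symm_apply_apply v

/-- The extension to `U'` of the action of `U(𝔮₂)`, if `F` is bijective. -/
def locAct (S : Supermodule k V) (hF : Function.Bijective (S.ρ (Q2.F k))) :
    U' k →ₐ[k] Module.End k V :=
  U'.lift S.act (S.unitF hF) (S.act_ι _)

variable (S : Supermodule k V) (hF : Function.Bijective (S.ρ (Q2.F k)))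

theorem locAct_of (c : U k) : S.locAct hF (U'.of k c) = S.act c := U'.lift_of _ _ _ c

theorem locAct_ι (x : Q2 k) : S.locAct hF (U'.ι k x) = S.ρ x :=
  (S.locAct_of hF _).trans (S.act_ι x)

theorem locAct_F : S.locAct hF (U'.F k : U' k) = S.ρ (Q2.F k) := S.locAct_ι hF _

theorem ρ_F_locAct_inv (v : V) :
    S.ρ (Q2.F k) (S.locAct hF ((U'.F k)⁻¹ : (U' k)ˣ).val v) = v := by
  rw [← S.locAct_F hF, ← Module.End.mul_apply, ← map_mul, Units.mul_inv, map_one,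
    Module.End.one_apply]

theorem parity_locAct (a : U' k) (v : V) :
    S.parity (S.locAct hF a v) = S.locAct hF (U'.parity k a) (S.parity v) := by
  induction a using U'.induction generalizing v with
  | hs c => simp [Module.algebraMap_end_apply]
  | hι x => rw [U'.parity_ι, locAct_ι, locAct_ι, S.parity_ρ]
  | hF =>
    rw [U'.mem_part.1 U'.F_inv_mem, psign_zero, one_smul]
    apply hF.1
    rw [← S.parity_ρ_even (Q2.F_mem k), ρ_F_locAct_inv, ρ_F_locAct_inv]
  | hadd a b ha hb => simp [ha, hb]
  | hmul a b ha hb => simp [ha, hb]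

variable [CharZero k]

theorem locAct_mem {i j : ZMod 2} {a : U' k} {v : V} (ha : a ∈ U'.part k i) (hv : v ∈ S.part j) :
    S.locAct hF a v ∈ S.part (i + j) := by
  rw [mem_part_iff, parity_locAct, U'.mem_part.1 ha, S.parity_of_mem hv, psign_add]
  simp [smul_smul, mul_comm]

/-- The space `V` on which `x ∈ 𝔮₂` acts as `θ_z(x)`. -/
def conj (z : k) : Supermodule k V where
  part := S.part
  isCompl := S.isCompl
  ρ := (S.locAct hF).toLinearMap ∘ₗ (theta z).toLinearMap ∘ₗ U'.ι k
  ρ_mem hx hv := S.locAct_mem hF (theta_mem z hx) hv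
  ρ_sbracket {i j x y} hx hy := by
    have h := thetaGen_rel z i j x y hx hy
    simp only [LinearMap.comp_apply, AlgEquiv.toLinearMap_apply, AlgHom.toLinearMap_apply,
      theta_ι, ← map_mul, ← map_smul, ← map_sub]
    rw [h, add_sub_cancel_left]

theorem conj_ρ (z : k) (x : Q2 k) :
    (S.conj hF z).ρ x = S.locAct hF (theta z (U'.ι k x)) := rfl

theorem conj_act (z : k) (c : U k) :
    (S.conj hF z).act c = S.locAct hF (theta z (U'.of k c)) := by
  induction c using U.induction with
  | hs c => simp
  | hι x => rw [act_ι, conj_ρ]; rfl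
  | hadd a b ha hb => simp [ha, hb]
  | hmul a b ha hb => simp [ha, hb]

theorem conj_F (z : k) : (S.conj hF z).ρ (Q2.F k) = S.ρ (Q2.F k) := by
  rw [conj_ρ, theta_ι, thetaGen_F, locAct_F]

/-- `[F, H₁] = F` and `[F, F] = 0` give `θ_z(H₁) = H₁ + z`. The twist therefore keeps the weight
spaces and only shifts their labels. -/
theorem conj_H1 (z : k) (v : V) : (S.conj hF z).ρ (Q2.H1 k) v = S.ρ (Q2.H1 k) v + z • v := by
  have h : Q2.adF k (Q2.H1 k) = Q2.F k := by simp [Q2.adF, Q2.sbracket, Q2.F, Q2.H1]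
  rw [conj_ρ, theta_ι, thetaGen_apply, h, Q2.adF_F, ← U'.F_val, Units.mul_inv]
  simp [locAct_ι]

theorem conj_H2 (z : k) (v : V) : (S.conj hF z).ρ (Q2.H2 k) v = S.ρ (Q2.H2 k) v - z • v := by
  have h : Q2.adF k (Q2.H2 k) = -Q2.F k := by simp [Q2.adF, Q2.sbracket, Q2.F, Q2.H2]
  rw [conj_ρ, theta_ι, thetaGen_apply, h, map_neg, map_neg, Q2.adF_F, ← U'.F_val, neg_mul,
    Units.mul_inv]
  simp [locAct_ι, sub_eq_add_neg]

/-- Composing with `F` removes the denominators: `[F, E] = -h` and `[F, [F, E]] = -2F`, so `θ_z(E) F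
= E F - z h - z(z - 1)` with `h = H₁ - H₂`. -/
theorem conj_E_F (z : k) (v : V) :
    (S.conj hF z).ρ (Q2.E k) (S.ρ (Q2.F k) v) = S.ρ (Q2.E k) (S.ρ (Q2.F k) v)
      - z • (S.ρ (Q2.H1 k) v - S.ρ (Q2.H2 k) v) - (z * (z - 1)) • v := by
  have h1 : Q2.adF k (Q2.E k) = Q2.H2 k - Q2.H1 k := by
    apply Q2.ext_entries <;> intro i j <;> fin_cases i <;> fin_cases j <;>
      simp [Q2.adF, Q2.sbracket, Q2.E, Q2.F, Q2.H1, Q2.H2]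
  have h2 : Q2.adF k (Q2.H2 k - Q2.H1 k) = (-2 : k) • Q2.F k := by
    apply Q2.ext_entries <;> intro i j <;> fin_cases i <;> fin_cases j <;>
      simp [Q2.adF, Q2.sbracket, Q2.F, Q2.H1, Q2.H2]
    norm_num
  have key : thetaGen z (Q2.E k) * (U'.F k : U' k) = U'.ι k (Q2.E k) * (U'.F k : U' k)
      + z • U'.ι k (Q2.H2 k - Q2.H1 k) - (z * (z - 1)) • 1 := by
    have e1 : ∀ a : U' k, a * ((U'.F k)⁻¹ : (U' k)ˣ).val * (U'.F k : U' k) = a := fun a => by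
      rw [mul_assoc, Units.inv_mul, mul_one]
    rw [thetaGen_apply, h1, h2, map_smul, ← U'.F_val, add_mul, add_mul, smul_mul_assoc, e1,
      smul_mul_assoc _ _ (U'.F k : U' k), pow_two, ← mul_assoc, e1, smul_mul_assoc,
      Units.mul_inv, smul_smul, sub_eq_add_neg _ ((z * (z - 1)) • (1 : U' k)), ← neg_smul]
    congr 2
    ring
  rw [conj_ρ, theta_ι, ← S.locAct_F hF, ← Module.End.mul_apply, ← map_mul, key]
  simp only [map_sub, map_add, map_mul, map_smul, map_one, locAct_ι, locAct_F,
    LinearMap.sub_apply, LinearMap.add_apply, LinearMap.smul_apply, Module.End.mul_apply,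
    Module.End.one_apply]
  module

/-! ### The kernel of `θ_z(E)` -/

/-- The kernel is `H₁`-stable, so it is spanned by weight vectors `F w`. If `F w ≠ 0` has weight
`b`, the equation `θ_z(E) F w = 0` makes `w` a Casimir eigenvector whose eigenvalue is a quadratic
polynomial `Q(b)`. As `p(Q(b)) = 0`, only finitely many `b` occur. -/
theorem finiteDimensional_ker_conj_E (z : k) {c : k}
    (hc : ∀ v, S.ρ (Q2.H1 k) v + S.ρ (Q2.H2 k) v = c • v) (hwt : ⨆ a, S.wt a = ⊤)
    (hfin : ∀ a, FiniteDimensional k (S.wt a)) {p : Polynomial k} (hp0 : p ≠ 0)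
    (hp : ∀ w, Polynomial.aeval S.casimir p w = 0) :
    FiniteDimensional k (LinearMap.ker ((S.conj hF z).ρ (Q2.E k))) := by
  classical
  set T := S.conj hF z with hT
  -- The vector `w` has weight `b + 1`, so `h` acts on it by `m = 2b + 2 - c`. Solving for the
  -- Casimir eigenvalue gives `ℓ² - 2ℓ` with `ℓ = m + 2z`.
  let ℓ : Polynomial k := Polynomial.C 2 * Polynomial.X + Polynomial.C (2 - c + 2 * z)
  let Q : Polynomial k := ℓ ^ 2 - Polynomial.C 2 * ℓ
  have hQ : ∀ b, Q.eval b = (2 * b + (2 - c + 2 * z)) ^ 2 - 2 * (2 * b + (2 - c + 2 * z)) := by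
    intro b; simp [Q, ℓ]
  -- `Q` is not constant: its second difference over `-1`, `0`, `1` equals `8`.
  have hcomp : p.comp Q ≠ 0 := by
    rw [Ne, Polynomial.comp_eq_zero_iff, not_or, not_and]
    refine ⟨hp0, fun _ hconst => ?_⟩
    have h01 : Q.eval 0 = Q.eval 1 := by rw [hconst]; simp
    have h02 : Q.eval 0 = Q.eval (-1) := by rw [hconst]; simp
    rw [hQ, hQ] at h01 h02
    have : (8 : k) = 0 := by linear_combination -h01 - h02
    norm_num at this
  let B : Finset k := (p.comp Q).roots.toFinset
  have hle : LinearMap.ker (T.ρ (Q2.E k)) ≤ ⨆ b ∈ B, S.wt b := by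
    intro n hn
    obtain ⟨s, v, hv, rfl⟩ := exists_sum_eigenvectors hwt n
    have hstab : ∀ w ∈ LinearMap.ker (T.ρ (Q2.E k)),
        S.ρ (Q2.H1 k) w ∈ LinearMap.ker (T.ρ (Q2.E k)) := by
      intro w hw
      rw [LinearMap.mem_ker] at *
      have h1 := T.ρ_comm Q2.H1_mem (Q2.E k) w
      have e : S.ρ (Q2.H1 k) w = T.ρ (Q2.H1 k) w - z • w := by
        rw [hT, conj_H1, add_sub_cancel_right]
      rw [Q2.sbracket_H1_E, map_smul, LinearMap.smul_apply, hw, map_zero, smul_zero,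
        add_zero] at h1
      rw [e, map_sub, map_smul, hw, ← h1, smul_zero, sub_zero]
    have hker := eigenvector_mem_of_sum_mem hstab s v (fun b _ => hv b) hn
    refine sum_mem fun b hb => ?_
    by_cases h0 : v b = 0
    · rw [h0]; exact zero_mem _
    refine Submodule.mem_iSup_of_mem b (Submodule.mem_iSup_of_mem ?_
      (Module.End.mem_eigenspace_iff.2 (hv b)))
    rw [Multiset.mem_toFinset, Polynomial.mem_roots hcomp, Polynomial.IsRoot,
      Polynomial.eval_comp]
    obtain ⟨w, hw⟩ := hF.2 (v b)
    have hw0 : w ≠ 0 := fun h => h0 (by rw [← hw, h, map_zero])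
    have hwb : w ∈ S.wt (b + 1) := by
      rw [mem_wt]
      apply hF.1
      have h1 := S.ρ_comm Q2.H1_mem (Q2.F k) w
      rw [Q2.sbracket_H1_F, map_smul, LinearMap.smul_apply, hw, hv b] at h1
      rw [map_smul, hw, eq_sub_of_add_eq h1.symm]
      module
    have hE0 : T.ρ (Q2.E k) (S.ρ (Q2.F k) w) = 0 := by rw [hw]; exact hker b hb
    rw [hT, conj_E_F, S.ρ_E_F, S.ρ_F_E hc hwb, S.ρ_H2_eq hc, S.mem_wt.1 hwb] at hE0
    have hCw : S.casimir w = Q.eval b • w := by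
      rw [hQ]
      linear_combination (norm := module) (4 : k) • hE0
    have haev := Module.End.aeval_apply_of_hasEigenvector (f := S.casimir) (p := p)
      (μ := Q.eval b) (x := w) ⟨Module.End.mem_eigenspace_iff.2 hCw, hw0⟩
    rw [hp] at haev
    exact (smul_eq_zero.1 haev.symm).resolve_right hw0
  have : FiniteDimensional k ↥(⨆ b ∈ B, S.wt b) := by
    rw [← Finset.sup_eq_iSup]
    exact Submodule.finite_finset_sup _ _
  exact Submodule.finiteDimensional_of_le hle

/-! ### Comparison with the twisted localization -/

variable {S} in
/-- The map `U' ⊗ L → V`, `a ⊗ l ↦ θ_z(a) l`. -/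
def locMap (z : k) {L : Submodule k V} (hL : (S.conj hF z).IsSub L) :
    ((S.conj hF z).restrict L hL).LocTensor →ₗ[k] V :=
  ((S.conj hF z).restrict L hL).balanced.liftQ
    (TensorProduct.lift ((LinearMap.lcomp k V L.subtype) ∘ₗ (S.locAct hF).toLinearMap ∘ₗ
      (theta z).toLinearMap)) (by
    rw [balanced, Submodule.span_le]
    rintro _ ⟨a, c, m, rfl⟩
    simp [coe_restrict_act, conj_act])

theorem locMap_tmul (z : k) {L : Submodule k V} (hL : (S.conj hF z).IsSub L) (a : U' k) (m : L) :
    locMap hF z hL (((S.conj hF z).restrict L hL).tmul a m) = S.locAct hF (theta z a) m := by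
  simp [locMap, tmul]

theorem locMap_lmul (z : k) {L : Submodule k V} (hL : (S.conj hF z).IsSub L) (b : U' k)
    (t : ((S.conj hF z).restrict L hL).LocTensor) :
    locMap hF z hL (((S.conj hF z).restrict L hL).lmul b t)
      = S.locAct hF (theta z b) (locMap hF z hL t) := by
  induction t using locTensor_induction with
  | h0 => simp
  | ht a m => rw [lmul_tmul, locMap_tmul, locMap_tmul, map_mul, map_mul]; rfl
  | hadd s t hs ht => simp only [map_add, hs, ht]

theorem theta_theta_neg (z : k) (a : U' k) : theta z (theta (-z) a) = a := by
  have := DFunLike.congr_fun (thetaHom_comp z (-z)) a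
  rw [add_neg_cancel, thetaHom_zero] at this
  exact this

/-- For `t = F^(-n) ⊗ m` in the kernel, multiplication by `F^n` gives `1 ⊗ m`, whose image is `m`
itself as a vector of `V`. -/
theorem locMap_injective (z : k) {L : Submodule k V} (hL : (S.conj hF z).IsSub L) :
    Function.Injective (locMap hF z hL) := by
  refine LinearMap.ker_eq_bot.1 (LinearMap.ker_eq_bot'.2 fun t ht => ?_)
  obtain ⟨n, m, rfl⟩ := exists_tmul_eq _ t
  have h1 := locMap_lmul S hF z hL ((U'.F k ^ n : (U' k)ˣ) : U' k)
    (((S.conj hF z).restrict L hL).tmul ((U'.F k ^ n)⁻¹ : (U' k)ˣ).val m)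
  rw [ht, map_zero, lmul_tmul, Units.mul_inv, locMap_tmul, map_one, map_one] at h1
  have hm : m = 0 := Subtype.ext h1
  simp [hm, tmul]

/-- `θ_z` commutes with the parity automorphism of `U'`, which is checked on homogeneous generators.
-/
theorem locMap_mem (z : k) {L : Submodule k V} (hL : (S.conj hF z).IsSub L) {i : ZMod 2}
    {t : ((S.conj hF z).restrict L hL).LocTensor}
    (ht : t ∈ ((S.conj hF z).restrict L hL).locPart i) : locMap hF z hL t ∈ S.part i := by
  induction ht using Submodule.span_induction with
  | mem t ht =>
    obtain ⟨j, l, a, m, rfl, ha, hm, rfl⟩ := ht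
    rw [locMap_tmul]
    refine S.locAct_mem hF ?_ hm
    rw [U'.mem_part] at *
    have : (U'.parity k).comp (thetaHom z) = (thetaHom z).comp (U'.parity k) := by
      refine U'.hom_ext fun x => ?_
      obtain ⟨y, hy, w, hw, rfl⟩ := Q2.eq_even_add_odd x
      have key : ∀ {i : ZMod 2} {x : Q2 k}, x ∈ Q2.part k i →
          (U'.parity k).comp (thetaHom z) (U'.ι k x) = (thetaHom z).comp (U'.parity k) (U'.ι k x) :=
        fun {i x} hx => by
          have h1 := U'.mem_part.1 (theta_mem z hx)
          have h2 := U'.mem_part.1 (U'.ι_mem hx)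
          rw [AlgHom.comp_apply, AlgHom.comp_apply, h2, map_smul]
          exact h1
      rw [map_add, map_add, map_add, key hy, key hw]
    have h := DFunLike.congr_fun this a
    rw [AlgHom.comp_apply, AlgHom.comp_apply, ha, map_smul] at h
    exact h
  | zero => simp
  | add s t _ _ hs ht => rw [map_add]; exact add_mem hs ht
  | smul c t _ ht => rw [map_smul]; exact Submodule.smul_mem _ _ ht

-- In `L^(-z)` an element `x` acts through `θ_(-z)(x)`, and `locMap` applies `θ_z` to it, so the
-- original action of `x` on `V` comes back. The image is then a nonzero subsupermodule of the
-- simple `S`.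
variable {S} in
theorem IsSimple.iso_twist (hS : S.IsSimple) (z : k) {L : Submodule k V}
    (hL : (S.conj hF z).IsSub L) (h0 : L ≠ ⊥) :
    S.Iso (((S.conj hF z).restrict L hL).twist (-z)) := by
  set T := (S.conj hF z).restrict L hL with hT
  have hρ : ∀ (x : Q2 k) (t : T.LocTensor),
      locMap hF z hL ((T.twist (-z)).ρ x t) = S.ρ x (locMap hF z hL t) := by
    intro x t
    change locMap hF z hL (T.lmul (theta (-z) (U'.ι k x)) t) = _
    rw [locMap_lmul, theta_theta_neg, locAct_ι]
  have hsurj : LinearMap.range (locMap hF z hL) = ⊤ := by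
    obtain ⟨v, hv, hv0⟩ := (Submodule.ne_bot_iff _).1 h0
    refine hS.eq_top (S.isSub_iff.2 ⟨?_, ?_⟩) (v := v)
      ⟨T.tmul 1 ⟨v, hv⟩, by rw [locMap_tmul, map_one, map_one]; rfl⟩ hv0
    · rintro _ ⟨t, rfl⟩
      obtain ⟨a, ha, b, hb, rfl⟩ := (T.twist (-z)).exists_parts t
      rw [map_add, map_add, S.parity_of_mem (locMap_mem S hF z hL ha),
        S.parity_of_mem (locMap_mem S hF z hL hb)]
      exact add_mem (Submodule.smul_mem _ _ ⟨a, rfl⟩) (Submodule.smul_mem _ _ ⟨b, rfl⟩)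
    · rintro x _ ⟨t, rfl⟩
      exact ⟨_, hρ x t⟩
  let e : T.LocTensor ≃ₗ[k] V := LinearEquiv.ofBijective (locMap hF z hL)
    ⟨locMap_injective S hF z hL, LinearMap.range_eq_top.1 hsurj⟩
  have he : ∀ t, e t = locMap hF z hL t := fun _ => rfl
  refine ⟨e.symm, fun i v hv => ?_, fun x v => ?_⟩
  -- That the inverse map is even is tested on the parity eigenvalue after applying the injective
  -- `e`.
  · rw [mem_part_iff]
    apply e.injective
    obtain ⟨a, ha, b, hb, hab⟩ := (T.twist (-z)).exists_parts (e.symm v)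
    have hv' : v = e a + e b := by rw [← map_add, hab, e.apply_symm_apply]
    have h1 := S.parity_of_mem hv
    have ea := S.parity_of_mem (locMap_mem S hF z hL ha)
    have eb := S.parity_of_mem (locMap_mem S hF z hL hb)
    rw [← he] at ea eb
    rw [map_smul, e.apply_symm_apply, ← h1, ← hab, map_add, map_add,
      (T.twist (-z)).parity_of_mem ha, (T.twist (-z)).parity_of_mem hb, hv', map_add, ea, eb,
      map_smul, map_smul]
  · apply e.injective
    rw [e.apply_symm_apply, he, hρ, ← he, e.apply_symm_apply]

end Supermodule

namespace Supermodule

variable {k : Type u} [Field k] {V : Type v} [AddCommGroup V] [Module k V]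

/-! ### Classification -/

/-- The vectors `F^n v` are nonzero eigenvectors of `H₁` for the distinct eigenvalues `a - n`. -/
theorem not_finiteDimensional_of_injective_F [CharZero k] (S : Supermodule k V)
    (hF : Function.Injective (S.ρ (Q2.F k))) {a : k} {v : V} (hv : v ∈ S.wt a) (h0 : v ≠ 0) :
    ¬ FiniteDimensional k V := by
  intro hfin
  refine Set.infinite_of_injective_forall_mem (f := fun n : ℕ => a - n) ?_ ?_
    (Module.End.finite_hasEigenvalue (S.ρ (Q2.H1 k)))
  · intro m n h
    exact Nat.cast_injective (sub_right_injective h)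
  · intro n
    have h := S.pow_mem_wt Q2.sbracket_H1_F hv n
    rw [mul_neg_one, ← sub_eq_add_neg] at h
    refine Module.End.hasEigenvalue_of_hasEigenvector ⟨h, fun h' => h0 ?_⟩
    have hinj : Function.Injective (S.ρ (Q2.F k) ^ n) := by
      rw [Module.End.coe_pow]; exact hF.iterate n
    exact hinj (h'.trans (map_zero _).symm)

/-- A nonzero `H₁`-stable subspace contains an eigenvector of `H₁`. -/
theorem exists_wt_mem (S : Supermodule k V) (hwt : ⨆ a, S.wt a = ⊤) {L : Submodule k V}
    (hL : ∀ v ∈ L, S.ρ (Q2.H1 k) v ∈ L) (h0 : L ≠ ⊥) :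
    ∃ (a : k) (v : V), v ∈ L ∧ v ∈ S.wt a ∧ v ≠ 0 := by
  obtain ⟨w, hw, hw0⟩ := (Submodule.ne_bot_iff _).1 h0
  obtain ⟨s, v, hv, rfl⟩ := exists_sum_eigenvectors hwt w
  have hmem := eigenvector_mem_of_sum_mem hL s v (fun b _ => hv b) hw
  obtain ⟨b, hb, hb0⟩ := Finset.exists_ne_zero_of_sum_ne_zero hw0
  exact ⟨b, v b, hmem b hb, S.mem_wt.2 (hv b), hb0⟩

/-- A vector killed by `θ_z(E)`, for a suitable `z`. -/
theorem exists_conj_E_eq_zero [CharZero k] [IsAlgClosed k] (S : Supermodule k V)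
    (hF : Function.Bijective (S.ρ (Q2.F k))) {c : k}
    (hc : ∀ v, S.ρ (Q2.H1 k) v + S.ρ (Q2.H2 k) v = c • v)
    (hfin : ∀ a, FiniteDimensional k (S.wt a)) {a : k} {v : V} (hv : v ∈ S.wt a) (h0 : v ≠ 0) :
    ∃ (z : k) (w : V), w ≠ 0 ∧ (S.conj hF z).ρ (Q2.E k) w = 0 := by
  have hEF : ∀ w ∈ S.wt a, (S.ρ (Q2.E k) * S.ρ (Q2.F k)) w ∈ S.wt a := fun w hw => by
    have := S.ρ_mem_wt Q2.sbracket_H1_E (S.ρ_mem_wt Q2.sbracket_H1_F hw)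
    rwa [neg_add_cancel_right] at this
  have := hfin a
  have : Nontrivial (S.wt a) := ⟨⟨v, hv⟩, 0, fun h => h0 (congrArg Subtype.val h)⟩
  obtain ⟨e, he⟩ := Module.End.exists_eigenvalue ((S.ρ (Q2.E k) * S.ρ (Q2.F k)).restrict hEF)
  obtain ⟨⟨w, hw⟩, hwe⟩ := he.exists_hasEigenvector
  have hw0 : w ≠ 0 := fun h => hwe.2 (Subtype.ext h)
  have hwe' : S.ρ (Q2.E k) (S.ρ (Q2.F k) w) = e • w := congrArg Subtype.val hwe.apply_eq_smul
  -- With `E F w = e w`, the scalar of `θ_z(E) F` on `w` is `e - z m - z(z - 1)` with `m = 2a - c`.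
  -- It vanishes when `z² + (m - 1) z - e = 0`, and `s` is a square root of this discriminant.
  obtain ⟨s, hs⟩ := IsAlgClosed.exists_eq_mul_self ((2 * a - c - 1) ^ 2 + 4 * e)
  have hz : ∃ z : k, e - z * (2 * a - c) - z * (z - 1) = 0 :=
    ⟨(s - (2 * a - c - 1)) / 2, by linear_combination hs / 4⟩
  obtain ⟨z, hz⟩ := hz
  refine ⟨z, S.ρ (Q2.F k) w, fun h => hw0 (hF.1 (h.trans (map_zero _).symm)), ?_⟩
  rw [conj_E_F, hwe', S.ρ_H2_eq hc, S.mem_wt.1 hw]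
  rw [show (0 : V) = (0 : k) • w by simp, ← hz]; module

/-- A simple weight supermodule on which `E` and `F` are injective is a twisted localization of a
simple highest weight supermodule. -/
theorem IsSimple.exists_iso_twist [CharZero k] [IsAlgClosed k] {S : Supermodule k V}
    (hS : S.IsSimple) (hweight : S.IsWeight)
    (hE : Function.Injective (S.ρ (Q2.E k))) (hF : Function.Injective (S.ρ (Q2.F k))) :
    ∃ (L : Type v) (_ : AddCommGroup L) (_ : Module k L) (T : Supermodule k L) (z : k),
      T.IsSimple ∧ ¬ FiniteDimensional k L ∧ T.IsHighestWeight ∧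
      (T.twist z).IsSimple ∧ S.Iso (T.twist z) := by
  have := hS.1
  obtain ⟨μ, v, hv, h0⟩ := hweight.exists_weight_vector
  obtain ⟨c, hc⟩ := hS.exists_central ⟨μ, v, hv, h0⟩
  have hwt := hweight.iSup_wt
  have hva : v ∈ S.wt μ.1 := S.mem_wt.2 (S.mem_weightSpace.1 hv).1
  have hfin := hS.finiteDimensional_wt hc hwt
  have hFb : Function.Bijective (S.ρ (Q2.F k)) := ⟨hF, S.surjective_F hwt hfin hE hF⟩
  obtain ⟨p, hp0, hp⟩ := hS.exists_aeval_casimir_eq_zero hfin hva h0 hE hF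
  obtain ⟨z, w, hw0, hw⟩ := S.exists_conj_E_eq_zero hFb hc hfin hva h0
  have hnil : (S.conj hFb z).nilPart (Q2.E k) ≠ ⊥ := (Submodule.ne_bot_iff _).2
    ⟨w, (S.conj hFb z).mem_nilPart.2 ⟨1, by simpa using hw⟩, hw0⟩
  obtain ⟨L, hL, hL0, hLnil, hmin⟩ := (S.conj hFb z).exists_simple_sub
    (S.finiteDimensional_ker_conj_E hFb z hc hwt hfin hp0 hp) hnil
  have hT := (S.conj hFb z).restrict_isSimple hL hL0 hmin
  -- `L` is stable under the twisted `H₁`, which differs from `H₁` by the scalar `z`; hence it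
  -- contains a weight vector.
  obtain ⟨b, u, huL, hub, hu0⟩ := S.exists_wt_mem hwt (L := L) (fun u hu => by
    have := sub_mem (hL.2 (Q2.H1 k) u hu) (L.smul_mem z hu)
    rwa [conj_H1, add_sub_cancel_right] at this) hL0
  rw [mem_wt] at hub
  have hu : (⟨u, huL⟩ : L) ∈ ((S.conj hFb z).restrict L hL).weightSpace (b + z, c - b - z) := by
    rw [mem_weightSpace]
    refine ⟨Subtype.ext ?_, Subtype.ext ?_⟩
    · rw [coe_restrict_ρ, conj_H1, hub]
      exact (add_smul b z u).symm
    · rw [coe_restrict_ρ, conj_H2, S.ρ_H2_eq hc, hub]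
      change c • u - b • u - z • u = (c - b - z) • u
      module
  have hu0' : (⟨u, huL⟩ : L) ≠ 0 := fun h => hu0 (congrArg Subtype.val h)
  obtain ⟨y, hyL, hy0, hy⟩ := (S.conj hFb z).exists_ker_E hL hL0 hLnil
  have hiso := hS.iso_twist hFb z hL hL0
  -- `L` sits in the twist of `V` by `θ_z`, so recovering `V` takes the opposite parameter `-z`.
  refine ⟨L, inferInstance, inferInstance, (S.conj hFb z).restrict L hL, -z, hT, ?_, ?_,
    hiso.isSimple hS, hiso⟩
  · refine not_finiteDimensional_of_injective_F _ (fun s t hst => Subtype.ext (hF ?_))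
      (Supermodule.mem_wt _ |>.2 ((mem_weightSpace _).1 hu).1) hu0'
    have := congrArg Subtype.val hst
    rwa [coe_restrict_ρ, coe_restrict_ρ, conj_F] at this
  · exact hT.isHighestWeight ⟨_, _, hu, hu0'⟩
      ⟨⟨y, hyL⟩, fun h => hy0 (congrArg Subtype.val h), Subtype.ext hy⟩

end Supermodule

end

end Queer

/-! ### Proof of the classification: the cases according to the kernels of `E` and `F` -/

theorem mainTheorem10 {k : Type u} [Field k] [IsAlgClosed k] [CharZero k] [Uncountable k]
    {N : Type v} [AddCommGroup N] [Module k N] (S : Queer.Supermodule k N)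
    (hsimple : S.IsSimple) (hweight : S.IsWeight) :
    FiniteDimensional k N ∨
    (¬ FiniteDimensional k N ∧ S.IsHighestWeight) ∨
    (¬ FiniteDimensional k N ∧ S.IsLowestWeight) ∨
    ∃ (L : Type v) (_ : AddCommGroup L) (_ : Module k L) (T : Queer.Supermodule k L) (z : k),
      T.IsSimple ∧ ¬ FiniteDimensional k L ∧ T.IsHighestWeight ∧
      (T.twist z).IsSimple ∧ S.Iso (T.twist z) := by
  by_cases hfin : FiniteDimensional k N
  · exact Or.inl hfin
  have := hsimple.1
  have hvec := hweight.exists_weight_vector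
  have hinj : ∀ f : Module.End k N, (¬ ∃ v, v ≠ 0 ∧ f v = 0) → Function.Injective f := by
    intro f hf
    refine (injective_iff_map_eq_zero f).2 fun v hv => ?_
    by_contra h
    exact hf ⟨v, h, hv⟩
  by_cases hE : ∃ v, v ≠ 0 ∧ S.ρ (Queer.Q2.E k) v = 0
  · exact Or.inr (Or.inl ⟨hfin, hsimple.isHighestWeight hvec hE⟩)
  by_cases hF : ∃ v, v ≠ 0 ∧ S.ρ (Queer.Q2.F k) v = 0
  · exact Or.inr (Or.inr (Or.inl ⟨hfin, hsimple.isLowestWeight hvec hF⟩))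
  exact Or.inr (Or.inr (Or.inr
    (hsimple.exists_iso_twist hweight (hinj _ hE) (hinj _ hF))))
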